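/- **Setting.** A quantum circuit $C$ on $n$ qubits is a sequence of gates from $\{H,T,CZ\}$; its size is the number of gates, and its depth is the least number of layers into which its gates can be arranged such that gates in one layer act on pairwise disjoint sets of qubits and gates sharing a qubit keep their order. We also write $C$ for its unitary operator. For $m\le n$ and $f:\{0,1\}^m\to\{0,1\}$, the computation "$C$ followed by $f$" applies $C$ to $|0^n\rangle$, measures the first $m$ qubits in the computational basis and applies $f$ to the outcome; it outputs $1$ with probability $$p(C,f)=\sum_{x\in\{0,1\}^m} f(x)\,\langle 0^n|C^\dagger(|x\rangle\langle x|\otimes I_{n-m})C|0^n\rangle .$$ Let $\widehat f(s)=2^{-m}\sum_x f(x)(-1)^{s\cdot x}$; the Fourier sparsity of $f$ is $|\{s:\widehat f(s)\ne0\}|$ and, for $f\neq 0$, $\deg(f)=\max\{|s| : \widehat f(s)\neq 0\}$, where $|s|$ is the Hamming weight. The support $\mathrm{supp}(U)$ of an operator $U$ on a set of qubits is the set of qubits on which $U$ acts non-trivially (i.e. $U$ is not the identity on that qubit tensored with an operator on the others). A commuting quantum circuit is a sequence of pairwise commuting unitary gates, each of them described by a circuit over $\{H,T,CZ\}$; a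 gate acts on the qubits in its support. An algorithm has access to a class of commuting quantum circuits on $n+1$ qubits if it may submit the description of a circuit of the class and receives the outcome of measuring all qubits in the computational basis after the circuit has been applied to $|0^{n+1}\rangle$; submitting anything else ends the run without output. **Theorem.** Let $d\ge 0$ be an integer and let $q,r,a,b,T$ be polynomials with natural-number coefficients, with $q(n)>0$ for all $n\geq 1$. There are a probabilistic algorithm $\mathcal A$ and a polynomial $R$ such that the following holds for all integers $0<m\le n\le r(m)$, every circuit $C$ on $n$ qubits of size at most $a(n)$ and depth at most $d$, every non-zero $f:\{0,1\}^m\to\{0,1\}$ of Fourier sparsity at most $b(m)$, and every deterministic classical algorithm $P$ that evaluates $f$ in time at most $T(m)$. Put $$k = 1+\max_{1\le j\le m}\bigl|\mathrm{supp}\bigl(C^\dagger (Z_j\otimes I_{n-m}) C\bigr)\bigr| .$$ Then $k\le 2^d+1$. Moreover, given $m$, $n$ and the classical description of $C$ as input, $P$ as a subroutine (each call costs the running time of $P$), and access to the commuting quantum circuits on $n+1$ qubits that consist of at most $\deg(f)$ gates, each acting on at most $k$ qubits, every run of $\mathcal A$ ends within time $R(n)$, and with probability greater than $1-1/\exp(n)$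 the algorithm $\mathcal A$ outputs a rational number $A$ with $$|p(C,f)-A|\le \frac1{q(n)} .$$ -/

import Mathlib

namespace SCP

open scoped Matrix

noncomputable section

/-- Computational basis states of `n` qubits. -/
abbrev Bits (n : ℕ) : Type := Fin n → Bool

/-- Operators on `n` qubits, in the computational basis. -/
abbrev Op (n : ℕ) : Type := Matrix (Bits n) (Bits n) ℂ

/-- The all-zero string. -/
def zeros (n : ℕ) : Bits n := fun _ => false

/-! ### Quantum circuits over the gate set H, T, CZ -/

/-- The elementary gates `H`, `T` on a qubit and `CZ` on two different qubits. -/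
inductive Gate (n : ℕ) : Type
  | h (i : Fin n)
  | t (i : Fin n)
  | cz (i j : Fin n) (hij : i ≠ j)

/-- The one-qubit operator `A` applied to qubit `i` (identity on all other qubits). -/
def onQubit {n : ℕ} (i : Fin n) (A : Matrix Bool Bool ℂ) : Op n :=
  Matrix.of fun x y => if ∀ k, k ≠ i → x k = y k then A (x i) (y i) else 0

/-- The Hadamard matrix. -/
def hMat : Matrix Bool Bool ℂ :=
  Matrix.of fun a b => ((Real.sqrt 2 : ℝ) : ℂ)⁻¹ * (if a && b then -1 else 1)

/-- The matrix `T = diag(1, exp(iπ/4))`. -/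
def tMat : Matrix Bool Bool ℂ :=
  Matrix.diagonal fun a => if a then Complex.exp (Real.pi * Complex.I / 4) else 1

/-- The operator of an elementary gate on `n` qubits. -/
def Gate.op {n : ℕ} : Gate n → Op n
  | .h i => onQubit i hMat
  | .t i => onQubit i tMat
  | .cz i j _ => Matrix.diagonal fun x => if x i && x j then -1 else 1

/-- The qubits to which an elementary gate is applied. -/
def Gate.qubits {n : ℕ} : Gate n → Finset (Fin n)
  | .h i => {i}
  | .t i => {i}
  | .cz i j _ => {i, j}

/-- A circuit: its elementary gates in the order of application. Its size is the length. -/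
abbrev Circuit (n : ℕ) : Type := List (Gate n)

/-- The operator of a circuit; the head of the list is applied first. -/
def Circuit.op {n : ℕ} : Circuit n → Op n
  | [] => 1
  | g :: c => Circuit.op c * g.op

/-- The gates of `C` can be arranged in `d` layers: gates of one layer act on pairwise disjoint
sets of qubits, and gates sharing a qubit keep their order. The depth of `C` is the least
such `d`. -/
def Circuit.DepthLE {n : ℕ} (C : Circuit n) (d : ℕ) : Prop :=
  ∃ layer : Fin C.length → Fin d, ∀ a b : Fin C.length, a < b →
    ¬ Disjoint (C.get a).qubits (C.get b).qubits → layer a < layer b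

/-- Pauli `Z` on qubit `j`. -/
def pauliZ {n : ℕ} (j : Fin n) : Op n :=
  onQubit j (Matrix.diagonal fun a => if a then -1 else 1)

/-- `U` acts trivially on qubit `k`: it is the tensor product of the identity on qubit `k` with an
operator on the other qubits. -/
def ActsTrivially {n : ℕ} (U : Op n) (k : Fin n) : Prop :=
  (∀ x y : Bits n, x k ≠ y k → U x y = 0) ∧
  (∀ (x y : Bits n) (b : Bool), x k = y k →
    U (Function.update x k b) (Function.update y k b) = U x y)

open Classical in
/-- The set of qubits on which `U` acts non-trivially. -/
def supp {n : ℕ} (U : Op n) : Finset (Fin n) :=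
  Finset.univ.filter fun k => ¬ ActsTrivially U k

/-- `max_{1 ≤ j ≤ m} |supp(C† Z_j C)|`. -/
def maxSupp {n m : ℕ} (hmn : m ≤ n) (C : Circuit n) : ℕ :=
  Finset.univ.sup fun j : Fin m => (supp (C.opᴴ * pauliZ (Fin.castLE hmn j) * C.op)).card

/-- `|x⟩⟨x| ⊗ I`, the projector onto the outcome `x` for the first `m` qubits. -/
def outcomeProj {n m : ℕ} (hmn : m ≤ n) (x : Bits m) : Op n :=
  Matrix.diagonal fun y => if ∀ j : Fin m, y (Fin.castLE hmn j) = x j then 1 else 0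

/-- `p_m(x) = ⟨0ⁿ| C† (|x⟩⟨x| ⊗ I) C |0ⁿ⟩`. -/
def outcomeProb {n m : ℕ} (hmn : m ≤ n) (C : Circuit n) (x : Bits m) : ℝ :=
  ((C.opᴴ * outcomeProj hmn x * C.op) (zeros n) (zeros n)).re

/-- The probability that `C` followed by `f` outputs `1`. -/
def acceptProb {n m : ℕ} (hmn : m ≤ n) (C : Circuit n) (f : Bits m → Bool) : ℝ :=
  ∑ x : Bits m, (if f x then 1 else 0) * outcomeProb hmn C x

/-! ### Fourier expansion of Boolean functions -/

/-- The Fourier coefficient of a `{0,1}`-valued function. -/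
def fourier {m : ℕ} (f : Bits m → Bool) (s : Bits m) : ℝ :=
  1 / 2 ^ m * ∑ x : Bits m, (if f x then 1 else 0) * (-1 : ℝ) ^ (∑ j, (s j && x j).toNat)

open Classical in
/-- The set of `s` with a non-zero Fourier coefficient; its size is the Fourier sparsity. -/
def spectrum {m : ℕ} (f : Bits m → Bool) : Finset (Bits m) :=
  Finset.univ.filter fun s => fourier f s ≠ 0

/-- The Fourier degree of a non-zero function. -/
def fourierDegree {m : ℕ} (f : Bits m → Bool) : ℕ :=
  (spectrum f).sup fun s => ∑ j, (s j).toNat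

/-! ### Circuits are unitary; measurement distributions -/

theorem sum_onQubit {n : ℕ} (i : Fin n) (x : Bits n) (F : Bits n → ℂ)
    (hF : ∀ z, ¬ (∀ k, k ≠ i → x k = z k) → F z = 0) :
    ∑ z, F z = ∑ b : Bool, F (Function.update x i b) := by
  classical
  have hinj : Function.Injective (fun b : Bool => Function.update x i b) :=
    Function.update_injective x i
  rw [← Finset.sum_image (s := Finset.univ) (g := fun b : Bool => Function.update x i b)
    (f := F) (fun a _ b _ h => hinj h)]
  symm
  apply Finset.sum_subset (Finset.subset_univ _)
  intro z _ hz
  apply hF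
  intro h
  apply hz
  rw [Finset.mem_image]
  refine ⟨z i, Finset.mem_univ _, ?_⟩
  funext k
  by_cases hk : k = i
  · subst hk; simp
  · simp [Function.update_of_ne hk, h k hk]

theorem onQubit_unitary {n : ℕ} (i : Fin n) (A : Matrix Bool Bool ℂ) (hA : Aᴴ * A = 1) :
    (onQubit i A)ᴴ * onQubit i A = 1 := by
  ext x y
  rw [Matrix.mul_apply, sum_onQubit i x]
  · have h1 : ∀ b, (∀ k, k ≠ i → Function.update x i b k = x k) := by
      intro b k hk; simp [Function.update_of_ne hk]
    have h2 : ∀ b, (∀ k, k ≠ i → Function.update x i b k = y k) ↔ ∀ k, k ≠ i → x k = y k := by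
      intro b
      refine forall_congr' fun k => forall_congr' fun hk => ?_
      rw [Function.update_of_ne hk]
    have h3 : (Aᴴ * A) (x i) (y i) = (1 : Matrix Bool Bool ℂ) (x i) (y i) := by rw [hA]
    rw [Matrix.mul_apply] at h3
    simp only [Matrix.conjTranspose_apply, onQubit, Matrix.of_apply, h2, if_pos (h1 _), Function.update_self]
    simp only [Matrix.conjTranspose_apply] at h3
    by_cases hxy : ∀ k, k ≠ i → x k = y k
    · simp only [if_pos hxy]
      rw [h3]
      by_cases hi : x i = y i
      · have : x = y := by
          funext k
          by_cases hk : k = i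
          · rw [hk, hi]
          · exact hxy k hk
        rw [this, Matrix.one_apply_eq, Matrix.one_apply_eq]
      · have : x ≠ y := fun h => hi (by rw [h])
        rw [Matrix.one_apply_ne hi, Matrix.one_apply_ne this]
    · have : x ≠ y := fun h => hxy (by intro k _; rw [h])
      simp [if_neg hxy, Matrix.one_apply_ne this]
  · intro z hz
    have : ¬ ∀ k, k ≠ i → z k = x k := fun h => hz fun k hk => (h k hk).symm
    simp [onQubit, if_neg this]

theorem hMat_unitary : hMatᴴ * hMat = 1 := by
  have h2 : ((Real.sqrt 2 : ℝ) : ℂ)⁻¹ * ((Real.sqrt 2 : ℝ) : ℂ)⁻¹ = 1 / 2 := by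
    rw [← mul_inv, ← Complex.ofReal_mul, Real.mul_self_sqrt (by norm_num)]
    norm_num
  ext a b
  rw [Matrix.mul_apply]
  cases a <;> cases b <;>
    simp [hMat, Matrix.conjTranspose_apply] <;> rw [h2] <;> norm_num

theorem tMat_unitary : tMatᴴ * tMat = 1 := by
  have h : (starRingEnd ℂ) (Complex.exp (Real.pi * Complex.I / 4)) *
      Complex.exp (Real.pi * Complex.I / 4) = 1 := by
    rw [← Complex.exp_conj, ← Complex.exp_add]
    have h4 : (starRingEnd ℂ) (4 : ℂ) = 4 := Complex.conj_ofNat 4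
    rw [map_div₀, map_mul, Complex.conj_ofReal, Complex.conj_I, h4]
    ring_nf
    exact Complex.exp_zero
  rw [tMat, Matrix.diagonal_conjTranspose, Matrix.diagonal_mul_diagonal, ← Matrix.diagonal_one]
  congr 1
  funext a
  cases a
  · simp
  · simpa using h

theorem Gate.op_unitary {n : ℕ} (g : Gate n) : g.opᴴ * g.op = 1 := by
  cases g with
  | h i => exact onQubit_unitary i _ hMat_unitary
  | t i => exact onQubit_unitary i _ tMat_unitary
  | cz i j hij =>
    simp only [Gate.op]
    rw [Matrix.diagonal_conjTranspose, Matrix.diagonal_mul_diagonal, ← Matrix.diagonal_one]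
    congr 1
    funext x
    cases hi : x i <;> cases hj : x j <;> simp [hi, hj]

theorem Circuit.op_unitary {n : ℕ} (C : Circuit n) : (Circuit.op C)ᴴ * Circuit.op C = 1 := by
  induction C with
  | nil => simp [Circuit.op]
  | cons g c ih =>
    simp only [Circuit.op]
    rw [Matrix.conjTranspose_mul, Matrix.mul_assoc, ← Matrix.mul_assoc (Circuit.op c)ᴴ, ih,
      Matrix.one_mul, g.op_unitary]

theorem born_sum {n : ℕ} (C : Circuit n) :
    ∑ y, ENNReal.ofReal (Complex.normSq (Circuit.op C y (zeros n))) = 1 := by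
  rw [← ENNReal.ofReal_sum_of_nonneg (fun _ _ => Complex.normSq_nonneg _)]
  have h : ((Circuit.op C)ᴴ * Circuit.op C) (zeros n) (zeros n) =
      (1 : Op n) (zeros n) (zeros n) := by rw [Circuit.op_unitary]
  rw [Matrix.mul_apply, Matrix.one_apply_eq] at h
  simp only [Matrix.conjTranspose_apply] at h
  have h' : ((∑ y, Complex.normSq (Circuit.op C y (zeros n)) : ℝ) : ℂ) = 1 := by
    rw [← h, Complex.ofReal_sum]
    refine Finset.sum_congr rfl fun y _ => ?_
    exact Complex.normSq_eq_conj_mul_self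
  have h'' : (∑ y, Complex.normSq (Circuit.op C y (zeros n)) : ℝ) = 1 := by exact_mod_cast h'
  rw [h'', ENNReal.ofReal_one]

/-- The distribution of the outcome when all qubits of `C |0ⁿ⟩` are measured in the
computational basis. -/
def measure {n : ℕ} (C : Circuit n) : PMF (Bits n) :=
  PMF.ofFintype (fun y => ENNReal.ofReal (Complex.normSq (Circuit.op C y (zeros n)))) (born_sum C)

/-! ### Data and encodings -/

/-- The data on which programs work: binary trees. -/
inductive Val : Type
  | nil
  | cons (a b : Val)
  deriving DecidableEq

/-- The number of nodes of a tree. -/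
def Val.size : Val → ℕ
  | .nil => 1
  | .cons a b => 1 + a.size + b.size

/-- First component. -/
def Val.fst : Val → Val
  | .nil => .nil
  | .cons a _ => a

/-- Second component. -/
def Val.snd : Val → Val
  | .nil => .nil
  | .cons _ b => b

def encBool : Bool → Val
  | false => .nil
  | true => .cons .nil .nil

/-- Natural numbers in unary. -/
def encNat : ℕ → Val
  | 0 => .nil
  | k + 1 => .cons .nil (encNat k)

def encList {α : Type} (e : α → Val) : List α → Val
  | [] => .nil
  | a :: l => .cons (e a) (encList e l)

def encBits {n : ℕ} (x : Bits n) : Val := encList encBool (List.ofFn x)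

def encGate {n : ℕ} : Gate n → Val
  | .h i => .cons (encNat 0) (encNat i)
  | .t i => .cons (encNat 1) (encNat i)
  | .cz i j _ => .cons (encNat 2) (.cons (encNat i) (encNat j))

/-- The classical description of a circuit. -/
def encCircuit {n : ℕ} (C : Circuit n) : Val := encList encGate C

theorem encNat_injective : Function.Injective encNat := by
  intro a
  induction a with
  | zero => intro b h; cases b <;> simp_all [encNat]
  | succ a ih =>
    intro b h
    cases b with
    | zero => simp [encNat] at h
    | succ b => simp only [encNat, Val.cons.injEq, true_and] at h; rw [ih h]

theorem encList_injective {α : Type} {e : α → Val} (he : Function.Injective e) :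
    Function.Injective (encList e) := by
  intro a
  induction a with
  | nil => intro b h; cases b <;> simp_all [encList]
  | cons a l ih =>
    intro b h
    cases b with
    | nil => simp [encList] at h
    | cons b l' =>
      simp only [encList, Val.cons.injEq] at h
      rw [he h.1, ih h.2]

theorem encGate_injective {n : ℕ} : Function.Injective (encGate (n := n)) := by
  intro a b h
  cases a <;> cases b <;> simp [encGate, encNat] at h
  · rw [Fin.ext (encNat_injective h)]
  · rw [Fin.ext (encNat_injective h)]
  · obtain ⟨h1, h2⟩ := h
    have h1 := Fin.ext (encNat_injective h1)
    have h2 := Fin.ext (encNat_injective h2)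
    subst h1; subst h2; rfl

theorem encCircuit_injective {n : ℕ} : Function.Injective (encCircuit (n := n)) :=
  encList_injective encGate_injective

/-! ### Commuting quantum circuits -/

/-- A circuit whose gates are the operators of the listed circuits over `H`, `T`, `CZ`, applied in
the order of the list. Each entry counts as one gate. -/
abbrev GateList (n : ℕ) : Type := List (Circuit n)

/-- `Q` is a commuting quantum circuit with at most `g` gates, each of which acts
(non-trivially) on at most `k` qubits. -/
def GateList.IsCommuting {N : ℕ} (g k : ℕ) (Q : GateList N) : Prop :=
  Q.length ≤ g ∧
  Q.Pairwise (fun U V => Commute (Circuit.op U) (Circuit.op V)) ∧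
  ∀ U ∈ Q, (supp (Circuit.op U)).card ≤ k

/-- The classical description of a circuit composed of compound gates. It is injective, by
`encList_injective` and `encCircuit_injective`. -/
def encGateList {N : ℕ} (Q : GateList N) : Val := encList encCircuit Q

/-! ### Probabilistic programs and their running time -/

/-- Programs of a first-order language on binary trees. Every program maps an input tree to an
output tree. `coin` is a fair coin, `sub` calls a given subroutine on the input, `query` submits
the input to a device. -/
inductive Prog : Type
  | id
  | nil
  | fst
  | snd
  | pair (a b : Prog)
  | comp (b a : Prog)
  | ite (c a b : Prog)
  | while (c a : Prog)
  | coin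
  | sub
  | query

/-- No coins, subroutine calls or queries. -/
def Prog.IsClassical : Prog → Prop
  | .id | .nil | .fst | .snd => True
  | .pair a b => a.IsClassical ∧ b.IsClassical
  | .comp b a => b.IsClassical ∧ a.IsClassical
  | .ite c a b => c.IsClassical ∧ a.IsClassical ∧ b.IsClassical
  | .while c a => c.IsClassical ∧ a.IsClassical
  | .coin | .sub | .query => False

/-- How a run ends: with an output, with a request refused by the device (or by a missing
subroutine), or by being cut off. -/
inductive Res : Type
  | out (v : Val)
  | refused
  | cutoff

/-- The random result of a run together with its running time. -/
abbrev Runs : Type := PMF (Res × ℕ)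

/-- End with output `v` after `t` time steps. -/
def Runs.done (v : Val) (t : ℕ) : Runs := PMF.pure (Res.out v, t)

/-- Spend `t` additional time steps. -/
def Runs.charge (t : ℕ) (p : Runs) : Runs := p.map fun o => (o.1, t + o.2)

/-- Sequential composition; running times are added. -/
def Runs.andThen (p : Runs) (k : Val → Runs) : Runs :=
  p.bind fun o => match o with
    | (.out v, t) => (k v).charge t
    | (.refused, t) => PMF.pure (.refused, t)
    | (.cutoff, t) => PMF.pure (.cutoff, t)

/-- Repeat `a` as long as `c` has a non-`nil` result, with at most `N` evaluations of `c`, after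
which the run is cut off. -/
def Runs.whileLoop (c a : Val → Runs) : ℕ → Val → Runs
  | 0, _ => PMF.pure (.cutoff, 0)
  | N + 1, v => (c v).andThen fun r =>
      if r = .nil then Runs.done v 1 else (a v).andThen (Runs.whileLoop c a N)

/-- The runs of a program. Each construct costs one step plus the size of its input. `N` bounds the
number of rounds of each loop; runs that would exceed it end in `cutoff`, and all other runs do
not depend on it. `sub` and `dev` give the behaviour of the subroutine and of the device. -/
def Prog.exec (sub dev : Val → Runs) (N : ℕ) : Prog → Val → Runs
  | .id, v => Runs.done v (1 + v.size)
  | .nil, v => Runs.done .nil (1 + v.size)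
  | .fst, v => Runs.done v.fst (1 + v.size)
  | .snd, v => Runs.done v.snd (1 + v.size)
  | .pair a b, v => Runs.charge (1 + v.size) <|
      (Prog.exec sub dev N a v).andThen fun x =>
      (Prog.exec sub dev N b v).andThen fun y => Runs.done (.cons x y) 0
  | .comp b a, v => Runs.charge (1 + v.size) <|
      (Prog.exec sub dev N a v).andThen (Prog.exec sub dev N b)
  | .ite c a b, v => Runs.charge (1 + v.size) <|
      (Prog.exec sub dev N c v).andThen fun r =>
        if r = .nil then Prog.exec sub dev N b v else Prog.exec sub dev N a v
  | .while c a, v => Runs.charge (1 + v.size) <|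
      Runs.whileLoop (Prog.exec sub dev N c) (Prog.exec sub dev N a) N v
  | .coin, v => Runs.charge (1 + v.size) <|
      (PMF.uniformOfFintype Bool).bind fun b => Runs.done (encBool b) (encBool b).size
  | .sub, v => Runs.charge (1 + v.size) (sub v)
  | .query, v => Runs.charge (1 + v.size) (dev v)

/-- Refuse every request. -/
def refuse : Val → Runs := fun _ => PMF.pure (.refused, 0)

open Classical in
/-- A device which runs commuting quantum circuits on `N` qubits initialized to `|0^N⟩`, with at most
`g` gates, each acting on at most `k` qubits, and returns the outcome of a measurement of all qubits
in the computational basis. Any other request is refused, which ends the run without output. -/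
def device (N g k : ℕ) (v : Val) : Runs :=
  match Function.partialInv (encGateList (N := N)) v with
  | some Q =>
      if Q.IsCommuting g k then
        (measure Q.flatten).bind fun y => Runs.done (encBits y) (encBits y).size
      else refuse v
  | none => refuse v

/-- `P` is a classical (deterministic) program that evaluates `f` on every input in time at
most `T`. -/
def Evaluates {m : ℕ} (P : Prog) (f : Bits m → Bool) (T : ℕ) : Prop :=
  P.IsClassical ∧ ∀ x : Bits m, ∃ t ≤ T,
    P.exec refuse refuse T (encBits x) = Runs.done (encBool (f x)) t

/-- The runs of the algorithm `A` when it is given the classical description of `C` (with the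
numbers `m` and `n`) as its input, the program `P` as its subroutine, and access to commuting
quantum circuits on `n + 1` qubits with at most `g` gates, each acting on at most `k` qubits.
A subroutine call costs the running time of `P`. -/
def Prog.runs (A P : Prog) {n : ℕ} (m : ℕ) (C : Circuit n) (g k N : ℕ) : Runs :=
  A.exec (P.exec refuse refuse N) (device (n + 1) g k) N
    (.cons (encNat m) (.cons (encNat n) (encCircuit C)))

/-- All runs end on their own, within time `R`. -/
def Prog.RunsInTime (A P : Prog) {n : ℕ} (m : ℕ) (C : Circuit n) (g k R : ℕ) : Prop :=
  ∀ o ∈ (A.runs P m C g k R).support, o.1 ≠ Res.cutoff ∧ o.2 ≤ R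

/-- The runs that output a fraction `a / b` (numerator and denominator in unary) at distance at
most `ε` from `p`. -/
def goodRuns (p ε : ℝ) : Set (Res × ℕ) :=
  {o | ∃ a b : ℕ, 0 < b ∧ o.1 = Res.out (.cons (encNat a) (encNat b)) ∧
    |p - (a : ℝ) / (b : ℝ)| ≤ ε}

end

end SCP

/-! Expanding `f` in characters gives p(C,f) = Σ_s f̂(s)⟨0ⁿ|C†Z_sC|0ⁿ⟩
(`acceptProb_eq_sum_fourier`), and sparsity leaves polynomially many non-zero terms. It remains to
find the relevant s and to estimate the corresponding products.

The s with large |f̂(s)| are found by a Kushilevitz–Mansour search over prefixes. The sum of f̂(s)²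
over all s with a given prefix is the mean of a product of two values of `f` and a sign
(`weight_mean`), so it can be estimated from random inputs. If the estimates are accurate, a prefix
of weight zero is dropped and one of weight at least θ² is kept (`searchStep_inv`). Every surviving
prefix therefore extends to an element of the spectrum, so there are never more survivors than the
sparsity, and at the end all candidates lie in the spectrum. This is also why the device accepts
their test circuits: |s| is at most deg f. A coefficient that is missed is at most θ in absolute
value, so together these cost little.

For a candidate s, the number ⟨0ⁿ|C†Z_sC|0ⁿ⟩ is the bias of the ancilla in a Hadamard test of C†Z_sC
(`test_bias`). This operator is the product of the commuting operators C†Z_jC over the j with s_j =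
1. Between consecutive factors the two Hadamards on the ancilla cancel, so the test is a product of
|s| commuting gates (`op_flatten_testGate`, `testGate_commute`), each acting only on the ancilla and
on the support of one C†Z_jC. That support is bounded by 2^d through a light cone argument with a
potential function (`exists_light_cone`).

For a random input x and a fresh test outcome y, the number f(x)χ_s(x)(-1)^y has mean
f̂(s)⟨0ⁿ|C†Z_sC|0ⁿ⟩. The algorithm adds these numbers over all candidates and all inputs drawn and
divides by the number of draws. Hoeffding's inequality (`seqPMF_tail_le`) controls the classical
estimates, by a union bound over all prefixes and all s, and then the measurement outcomes
(`outcome_tail_le`, `success_prob`).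

The running time has to be polynomial on every run, also after misleading samples. The program is
assembled from combinators for the predicate `Poly`, which couples the law of the result with bounds
on time and output size; the list of candidates is truncated in each round so that these bounds hold
unconditionally. -/

namespace SCP

open scoped Matrix

noncomputable section

/-! ### Encodings of data types as trees -/

/-- Types whose elements are represented by trees. -/
class Enc (α : Type) where
  enc : α → Val

instance : Enc Val := ⟨fun v => v⟩
instance : Enc Unit := ⟨fun _ => .nil⟩
instance : Enc Bool := ⟨encBool⟩
instance : Enc ℕ := ⟨encNat⟩
instance {α β : Type} [Enc α] [Enc β] : Enc (α × β) :=
  ⟨fun p => .cons (Enc.enc p.1) (Enc.enc p.2)⟩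
instance {α : Type} [Enc α] : Enc (List α) := ⟨encList Enc.enc⟩

/-- The size of the representation. -/
def sz {α : Type} [Enc α] (a : α) : ℕ := (Enc.enc a).size

section
variable {α β : Type} [Enc α] [Enc β]

@[simp] theorem enc_prod (a : α) (b : β) : Enc.enc (a, b) = .cons (Enc.enc a) (Enc.enc b) := rfl
@[simp] theorem enc_nil : Enc.enc ([] : List α) = .nil := rfl
@[simp] theorem enc_cons (a : α) (l : List α) :
    Enc.enc (a :: l) = .cons (Enc.enc a) (Enc.enc l) := rfl
@[simp] theorem sz_prod (a : α) (b : β) : sz (a, b) = 1 + sz a + sz b := rfl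
@[simp] theorem sz_nil : sz ([] : List α) = 1 := rfl
@[simp] theorem sz_cons (a : α) (l : List α) : sz (a :: l) = 1 + sz a + sz l := rfl
@[simp] theorem sz_true : sz true = 3 := rfl
@[simp] theorem sz_false : sz false = 1 := rfl

theorem size_enc (a : α) : (Enc.enc a).size = sz a := rfl

theorem sz_bool_le (b : Bool) : sz b ≤ 3 := by cases b <;> simp

theorem sz_pos (a : α) : 0 < sz a := by
  unfold sz
  cases Enc.enc a <;> simp [Val.size]

@[simp] theorem sz_nat (k : ℕ) : sz k = 2 * k + 1 := by
  induction k with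
  | zero => rfl
  | succ k ih =>
    have : sz (k + 1) = 1 + 1 + sz k := rfl
    omega

theorem length_lt_sz (l : List α) : l.length < sz l := by
  induction l with
  | nil => simp
  | cons a l ih => simp; omega

/-- The extra one is the terminating `nil` of the first list, which disappears. -/
theorem sz_append (l l' : List α) : sz (l ++ l') + 1 = sz l + sz l' := by
  induction l with
  | nil => simp; omega
  | cons a l ih => simp; omega

theorem sz_mem_lt {a : α} {l : List α} (h : a ∈ l) : sz a < sz l := by
  induction l with
  | nil => simp at h
  | cons b l ih =>
    rcases List.mem_cons.1 h with rfl | h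
    · simp; omega
    · have := ih h; simp; omega

theorem sz_suffix_le {l l' : List α} (h : l' <:+ l) : sz l' ≤ sz l := by
  obtain ⟨t, rfl⟩ := h
  have := sz_append t l'
  have := sz_pos t
  omega

theorem sz_le_of_forall_mem {l : List α} {B : ℕ} (h : ∀ a ∈ l, sz a ≤ B) :
    sz l ≤ 1 + l.length * (1 + B) := by
  induction l with
  | nil => simp
  | cons a l ih =>
    have h1 := h a (by simp)
    have h2 := ih fun b hb => h b (by simp [hb])
    simp only [sz_cons, List.length_cons, Nat.add_mul]
    omega

end

/-! ### Sequencing of random results which may fail -/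

/-- Sequential composition of random computations, `none` being failure. -/
def bindO {α β : Type} (D : PMF (Option α)) (k : α → PMF (Option β)) : PMF (Option β) :=
  D.bind fun o => o.elim (PMF.pure none) k

/-- Apply a function to the random result. -/
def mapO {α β : Type} (f : α → β) (D : PMF (Option α)) : PMF (Option β) := D.map (Option.map f)

/-- The computation with the certain result `a`. -/
def pureO {α : Type} (a : α) : PMF (Option α) := PMF.pure (some a)

section
variable {α β γ : Type}

@[simp] theorem pureO_bindO (a : α) (k : α → PMF (Option β)) : bindO (pureO a) k = k a := by
  simp [bindO, pureO, PMF.pure_bind]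

@[simp] theorem bindO_pureO (D : PMF (Option α)) : bindO D pureO = D := by
  unfold bindO pureO
  conv_rhs => rw [← PMF.bind_pure D]
  congr 1; funext o; cases o <;> rfl

theorem bindO_assoc (D : PMF (Option α)) (k : α → PMF (Option β)) (k' : β → PMF (Option γ)) :
    bindO (bindO D k) k' = bindO D fun a => bindO (k a) k' := by
  unfold bindO
  rw [PMF.bind_bind]
  congr 1; funext o; cases o <;> simp [PMF.pure_bind]

theorem mapO_eq_bindO (f : α → β) (D : PMF (Option α)) :
    mapO f D = bindO D fun a => pureO (f a) := by
  unfold mapO bindO pureO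
  rw [← PMF.bind_pure_comp]
  congr 1; funext o; cases o <;> rfl

@[simp] theorem mapO_pureO (f : α → β) (a : α) : mapO f (pureO a) = pureO (f a) := by
  simp [mapO_eq_bindO]

theorem mapO_bindO (f : β → γ) (D : PMF (Option α)) (k : α → PMF (Option β)) :
    mapO f (bindO D k) = bindO D fun a => mapO f (k a) := by
  simp only [mapO_eq_bindO, bindO_assoc]

theorem bindO_mapO (f : α → β) (D : PMF (Option α)) (k : β → PMF (Option γ)) :
    bindO (mapO f D) k = bindO D fun a => k (f a) := by
  simp only [mapO_eq_bindO, bindO_assoc, pureO_bindO]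

theorem mapO_mapO (f : α → β) (g : β → γ) (D : PMF (Option α)) :
    mapO g (mapO f D) = mapO (fun a => g (f a)) D := by
  simp only [mapO_eq_bindO, bindO_assoc, pureO_bindO]

theorem some_mem_support_bindO {D : PMF (Option α)} {k : α → PMF (Option β)} {b : β} :
    some b ∈ (bindO D k).support ↔ ∃ a, some a ∈ D.support ∧ some b ∈ (k a).support := by
  unfold bindO
  rw [PMF.mem_support_bind_iff]
  constructor
  · rintro ⟨o, ho, h⟩
    cases o with
    | none => simp at h
    | some a => exact ⟨a, ho, h⟩
  · rintro ⟨a, ha, h⟩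
    exact ⟨some a, ha, h⟩

theorem some_mem_support_pureO {a b : α} : some b ∈ (pureO a).support ↔ b = a := by
  simp [pureO]

theorem some_mem_support_mapO {f : α → β} {D : PMF (Option α)} {b : β} :
    some b ∈ (mapO f D).support ↔ ∃ a, some a ∈ D.support ∧ b = f a := by
  simp only [mapO_eq_bindO, some_mem_support_bindO, some_mem_support_pureO]

/-- Process a list from left to right with a random state update. -/
def foldO (F : β → α → PMF (Option β)) : β → List α → PMF (Option β)
  | s, [] => pureO s
  | s, a :: l => bindO (F s a) fun s' => foldO F s' l

/-- Apply a random function to the elements of a list, from the last to the first. -/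
def mapListO (F : α → PMF (Option β)) : List α → PMF (Option (List β))
  | [] => pureO []
  | a :: l => bindO (mapListO F l) fun r => mapO (fun b => b :: r) (F a)

theorem foldO_append (F : β → α → PMF (Option β)) (s : β) (l l' : List α) :
    foldO F s (l ++ l') = bindO (foldO F s l) fun s' => foldO F s' l' := by
  induction l generalizing s with
  | nil => simp [foldO]
  | cons a l ih => simp only [List.cons_append, foldO, bindO_assoc, ih]

theorem foldO_pureO (f : β → α → β) (s : β) (l : List α) :
    foldO (fun s a => pureO (f s a)) s l = pureO (l.foldl f s) := by
  induction l generalizing s with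
  | nil => rfl
  | cons a l ih => simp [foldO, ih]

/-- A loop can only prepend cheaply, so it consumes the reversed list and the results come out in
the original order. This is why `mapListO` evaluates from the last element to the first. -/
theorem foldO_reverse (F : α → PMF (Option β)) (l : List α) :
    foldO (fun r a => mapO (fun b => b :: r) (F a)) [] l.reverse = mapListO F l := by
  induction l with
  | nil => rfl
  | cons a l ih =>
    rw [List.reverse_cons, foldO_append, ih]
    simp [foldO, mapListO]

theorem mapListO_pureO (f : α → β) (l : List α) :
    mapListO (fun a => pureO (f a)) l = pureO (l.map f) := by
  induction l with
  | nil => rfl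
  | cons a l ih => simp [mapListO, ih]

theorem mapListO_congr {F G : α → PMF (Option β)} {l : List α} (h : ∀ a ∈ l, F a = G a) :
    mapListO F l = mapListO G l := by
  induction l with
  | nil => rfl
  | cons a l ih =>
    simp only [mapListO]
    rw [ih fun b hb => h b (by simp [hb]), h a (by simp)]

end

/-! ### Specification of runs -/

/-- Outputs as results of runs; failure is a refused request. -/
def resOf {α : Type} [Enc α] : Option α → Res
  | none => .refused
  | some a => .out (Enc.enc a)

/-- The runs `μ` end in time at most `B`, with an output distributed as `D` and of size at
most `B`. -/
structure Spec {α : Type} [Enc α] (μ : Runs) (D : PMF (Option α)) (B : ℕ) : Prop where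
  -- No value of `resOf` is `cutoff`, so this equation also certifies that no run is cut off.
  dist : μ.map Prod.fst = D.map resOf
  time : ∀ o ∈ μ.support, o.2 ≤ B
  size : ∀ a, some a ∈ D.support → sz a ≤ B

section
variable {α β γ σ : Type} [Enc α] [Enc β] [Enc γ] [Enc σ]

theorem Spec.mono {μ : Runs} {D : PMF (Option α)} {B B' : ℕ} (h : Spec μ D B) (hB : B ≤ B') :
    Spec μ D B' :=
  ⟨h.dist, fun o ho => (h.time o ho).trans hB, fun a ha => (h.size a ha).trans hB⟩

theorem Spec.done {v : Val} {a : α} {t B : ℕ} (hv : v = Enc.enc a) (ht : t ≤ B) (ha : sz a ≤ B) :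
    Spec (Runs.done v t) (pureO a) B := by
  refine ⟨?_, ?_, ?_⟩
  · simp [Runs.done, pureO, PMF.pure_map, resOf, hv]
  · intro o ho
    simp [Runs.done] at ho
    simp [ho, ht]
  · intro b hb
    rw [some_mem_support_pureO.1 hb]; exact ha

theorem Spec.charge {μ : Runs} {D : PMF (Option α)} {B : ℕ} (t : ℕ) (h : Spec μ D B) :
    Spec (Runs.charge t μ) D (t + B) := by
  refine ⟨?_, ?_, fun a ha => (h.size a ha).trans (Nat.le_add_left _ _)⟩
  · rw [← h.dist, Runs.charge, PMF.map_comp]; rfl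
  · intro o ho
    rw [Runs.charge, PMF.mem_support_map_iff] at ho
    obtain ⟨o', ho', rfl⟩ := ho
    have := h.time o' ho'
    simp only; omega

/-- The effect on results of continuing with `k`. -/
def Res.next (k : Val → PMF Res) : Res → PMF Res
  | .out v => k v
  | .refused => PMF.pure .refused
  | .cutoff => PMF.pure .cutoff

/-- Charging time does not change results, so the law of the results composes without reference to
running times. -/
theorem andThen_map_fst (μ : Runs) (k : Val → Runs) :
    (μ.andThen k).map Prod.fst = (μ.map Prod.fst).bind (Res.next fun v => (k v).map Prod.fst) := by
  rw [Runs.andThen, PMF.map_bind, PMF.bind_map]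
  congr 1
  funext o
  obtain ⟨r, t⟩ := o
  cases r
  · simp [Runs.charge, PMF.map_comp, Res.next, Function.comp_def]
  · simp [PMF.pure_map, Res.next]
  · simp [PMF.pure_map, Res.next]

/-- The continuation is only examined on outputs that occur with positive probability; this is how
preconditions established by the first part reach the second. -/
theorem Spec.andThen {μ : Runs} {k : Val → Runs} {D : PMF (Option α)} {E : α → PMF (Option β)}
    {B B' : ℕ} (h : Spec μ D B)
    (hk : ∀ a, some a ∈ D.support → Spec (k (Enc.enc a)) (E a) B') :
    Spec (μ.andThen k) (bindO D E) (B + B') := by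
  refine ⟨?_, ?_, ?_⟩
  · rw [andThen_map_fst, h.dist, PMF.bind_map, bindO, PMF.map_bind]
    ext r
    simp only [PMF.bind_apply]
    refine tsum_congr fun o => ?_
    cases o with
    | none => simp [resOf, Res.next, PMF.pure_map]
    | some a =>
      by_cases ha : some a ∈ D.support
      · simp [resOf, Res.next, (hk a ha).dist]
      · rw [PMF.mem_support_iff, not_not] at ha
        simp [ha]
  · intro o ho
    rw [Runs.andThen, PMF.mem_support_bind_iff] at ho
    obtain ⟨⟨r, t⟩, h1, h2⟩ := ho
    have ht := h.time _ h1
    -- A result that occurs is `resOf` of something, which excludes `cutoff` and leaves only two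
    -- cases.
    have hr : r ∈ (D.map resOf).support := by
      rw [← h.dist, PMF.mem_support_map_iff]
      exact ⟨_, h1, rfl⟩
    rw [PMF.mem_support_map_iff] at hr
    obtain ⟨d, hd, rfl⟩ := hr
    cases d with
    | none =>
      simp [resOf] at h2
      simp only at ht
      simp [h2]; omega
    | some a =>
      simp only [resOf, Runs.charge, PMF.mem_support_map_iff] at h2
      obtain ⟨o', ho', rfl⟩ := h2
      have := (hk a hd).time _ ho'
      simp only at ht ⊢; omega
  · intro b hb
    obtain ⟨a, ha, hb⟩ := some_mem_support_bindO.1 hb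
    exact ((hk a ha).size b hb).trans (Nat.le_add_left _ _)

/-- Loops which consume a list. -/
theorem Spec.whileLoop {cond body : Val → Runs} {F : σ → α → PMF (Option σ)} {c : γ}
    {Inv : List α → σ → Prop} {B : ℕ}
    (hc : ∀ l s, Inv l s → Spec (cond (Enc.enc (c, s, l))) (pureO l) B)
    (hb : ∀ a l s, Inv (a :: l) s →
      Spec (body (Enc.enc (c, s, a :: l))) (mapO (fun s' => (c, s', l)) (F s a)) B)
    (hInv : ∀ a l s, Inv (a :: l) s → ∀ s', some s' ∈ (F s a).support → Inv l s')
    (hsz : ∀ l s, Inv l s → sz (c, s, l) ≤ B) (l : List α) :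
    -- The condition is evaluated once more than there are elements, hence the strict inequality.
    -- Each round costs at most `B` for the condition and `B` for the body, and leaving the loop
    -- takes one more step.
    ∀ (s : σ) (N : ℕ), Inv l s → l.length < N →
      Spec (Runs.whileLoop cond body N (Enc.enc (c, s, l)))
        (mapO (fun s' => (c, s', ([] : List α))) (foldO F s l)) ((l.length + 1) * (2 * B + 1)) := by
  induction l with
  | nil =>
    intro s N h hN
    obtain ⟨N, rfl⟩ := Nat.exists_eq_add_of_lt hN
    simp only [List.length_nil, Nat.zero_add, Runs.whileLoop, foldO, mapO_pureO]
    have := (hc [] s h).andThen (E := fun _ => pureO (c, s, ([] : List α)))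
      (k := fun r => if r = .nil then Runs.done (Enc.enc (c, s, ([] : List α))) 1
        else (body (Enc.enc (c, s, ([] : List α)))).andThen (Runs.whileLoop cond body N))
      (B' := B + 1) (by
        intro a ha
        rw [some_mem_support_pureO.1 ha]
        simp only [enc_nil, if_true]
        exact Spec.done rfl (by omega) ((hsz _ _ h).trans (by omega)))
    rw [pureO_bindO] at this
    exact this.mono (by omega)
  | cons a l ih =>
    intro s N h hN
    obtain ⟨N, rfl⟩ := Nat.exists_eq_succ_of_ne_zero (n := N) (by omega)
    simp only [Runs.whileLoop]
    have hl : l.length < N := by simpa using hN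
    have hbody := (hb a l s h).andThen (k := Runs.whileLoop cond body N)
      (E := fun x => mapO (fun s' => (c, s', ([] : List α))) (foldO F x.2.1 l))
      (B' := (l.length + 1) * (2 * B + 1)) (by
        intro x hx
        obtain ⟨s', hs', rfl⟩ := some_mem_support_mapO.1 hx
        exact ih s' N (hInv _ _ _ h s' hs') hl)
    have := (hc _ s h).andThen
      (E := fun _ => mapO (fun s' => (c, s', ([] : List α))) (foldO F s (a :: l)))
      (k := fun r => if r = .nil then Runs.done (Enc.enc (c, s, a :: l)) 1
        else (body (Enc.enc (c, s, a :: l))).andThen (Runs.whileLoop cond body N))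
      (B' := B + (l.length + 1) * (2 * B + 1)) (by
        intro x hx
        rw [some_mem_support_pureO.1 hx]
        simp only [enc_cons, reduceCtorEq, if_false]
        rw [bindO_mapO] at hbody
        simp only [foldO, mapO_bindO]
        exact hbody)
    rw [pureO_bindO] at this
    refine this.mono ?_
    simp only [List.length_cons]
    nlinarith

end

/-! ### Programs with polynomial running time -/

/-- What a program can call: a subroutine (depending on the bound for loops), a device, and a
parameter that may enter the bounds for the running time. -/
structure Env where
  sub : ℕ → Val → Runs
  dev : Val → Runs
  par : ℕ

theorem eval_mono (R : Polynomial ℕ) {a b : ℕ} (h : a ≤ b) : R.eval a ≤ R.eval b := by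
  rw [Polynomial.eval_eq_sum_range, Polynomial.eval_eq_sum_range]
  exact Finset.sum_le_sum fun i _ => Nat.mul_le_mul_left _ (Nat.pow_le_pow_left h i)

/-- Some program computes `F i a` from every `a` in the domain `dom i`, in the environment `env i`,
with a running time polynomial in the size of `a` and the parameter of the environment. -/
def Poly {ι α β : Type} [Enc α] [Enc β] (env : ι → Env) (dom : ι → α → Prop)
    (F : ι → α → PMF (Option β)) : Prop :=
  -- Program and polynomial are chosen before the index, so a single algorithm serves all circuits,
  -- functions and subroutines. Any loop bound `N` above the time bound is allowed, so parts with
  -- different time bounds can run under a common one.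
  ∃ (p : Prog) (R : Polynomial ℕ), ∀ i a, dom i a → ∀ N,
    R.eval ((env i).par + sz a) ≤ N →
    Spec (p.exec ((env i).sub N) (env i).dev N (Enc.enc a)) (F i a) (R.eval ((env i).par + sz a))

/-- The function `f` is computed by a deterministic program in polynomial time. -/
def PolyTime {ι α β : Type} [Enc α] [Enc β] (env : ι → Env) (f : α → β) : Prop :=
  Poly env (fun _ _ => True) fun _ a => pureO (f a)

section
variable {ι α β γ δ σ : Type} [Enc α] [Enc β] [Enc γ] [Enc δ] [Enc σ] {env : ι → Env}

theorem Poly.congr {dom dom' : ι → α → Prop} {F F' : ι → α → PMF (Option β)}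
    (h : Poly env dom F) (hd : ∀ i a, dom' i a → dom i a)
    (hF : ∀ i a, dom' i a → F i a = F' i a) : Poly env dom' F' := by
  obtain ⟨p, R, h⟩ := h
  refine ⟨p, R, fun i a ha N hN => ?_⟩
  rw [← hF i a ha]
  exact h i a (hd i a ha) N hN

theorem PolyTime.poly {f : α → β} (h : PolyTime env f) (dom : ι → α → Prop) :
    Poly env dom fun _ a => pureO (f a) :=
  Poly.congr h (fun _ _ _ => trivial) fun _ _ _ => rfl

theorem PolyTime.congr {f g : α → β} (h : PolyTime env f) (hfg : ∀ a, f a = g a) :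
    PolyTime env g := by
  rwa [← show f = g from funext hfg]

/-- A program that does not change the representation. -/
theorem PolyTime.of_enc {f : α → β} (hf : ∀ a, Enc.enc (f a) = Enc.enc a) : PolyTime env f := by
  refine ⟨.id, 1 + Polynomial.X, fun i a _ N hN => ?_⟩
  have h1 : sz (f a) = sz a := by unfold sz; rw [hf]
  simp only [Polynomial.eval_add, Polynomial.eval_one, Polynomial.eval_X, Prog.exec]
  exact Spec.done (hf a).symm (by rw [size_enc]; omega) (by omega)

theorem PolyTime.id : PolyTime env (fun a : α => a) := .of_enc fun _ => rfl

/-- The size clause of `Spec` bounds the intermediate result by `R`, so the second program runs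
within `R'` evaluated at `X + R`, again a polynomial. -/
theorem Poly.comp {dom : ι → α → Prop} {dom' : ι → β → Prop} {F : ι → α → PMF (Option β)}
    {G : ι → β → PMF (Option γ)} (hG : Poly env dom' G) (hF : Poly env dom F)
    (hd : ∀ i a, dom i a → ∀ b, some b ∈ (F i a).support → dom' i b) :
    Poly env dom fun i a => bindO (F i a) (G i) := by
  obtain ⟨p, R, hF⟩ := hF
  obtain ⟨p', R', hG⟩ := hG
  refine ⟨.comp p' p, 1 + Polynomial.X + R + R'.comp (Polynomial.X + R), fun i a ha N hN => ?_⟩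
  simp only [Polynomial.eval_add, Polynomial.eval_one, Polynomial.eval_X,
    Polynomial.eval_comp] at hN ⊢
  have h1 := hF i a ha N (by omega)
  refine ((h1.andThen (B' := R'.eval ((env i).par + sz a + R.eval ((env i).par + sz a))) ?_).charge
    (1 + (Enc.enc a).size)).mono ?_
  · intro b hb
    have h2 := h1.size b hb
    have h3 : R'.eval ((env i).par + sz b) ≤
        R'.eval ((env i).par + sz a + R.eval ((env i).par + sz a)) := eval_mono _ (by omega)
    exact (hG i b (hd i a ha b hb) N (h3.trans (by omega))).mono h3
  · rw [size_enc]; omega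

theorem PolyTime.comp {g : β → γ} {f : α → β} (hg : PolyTime env g) (hf : PolyTime env f) :
    PolyTime env fun a => g (f a) :=
  (Poly.comp hg hf fun _ _ _ _ _ => trivial).congr (fun _ _ h => h) (by simp)

theorem Poly.comp_det {dom : ι → β → Prop} {G : ι → β → PMF (Option γ)} {f : α → β}
    (hG : Poly env dom G) (hf : PolyTime env f) :
    Poly env (fun i a => dom i (f a)) fun i a => G i (f a) :=
  (Poly.comp hG (hf.poly _) fun i a h b hb => by
    rw [some_mem_support_pureO.1 hb]; exact h).congr (fun _ _ h => h) (by simp)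

theorem PolyTime.after {dom : ι → α → Prop} {F : ι → α → PMF (Option β)} {g : β → γ}
    (hg : PolyTime env g) (hF : Poly env dom F) : Poly env dom fun i a => mapO g (F i a) :=
  (Poly.comp hg hF fun _ _ _ _ _ => trivial).congr (fun _ _ h => h)
    (by simp [mapO_eq_bindO])

theorem Poly.pair {dom : ι → α → Prop} {F : ι → α → PMF (Option β)}
    {G : ι → α → PMF (Option γ)} (hF : Poly env dom F) (hG : Poly env dom G) :
    Poly env dom fun i a => bindO (F i a) fun b => mapO (fun c => (b, c)) (G i a) := by
  obtain ⟨p, R, hF⟩ := hF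
  obtain ⟨p', R', hG⟩ := hG
  refine ⟨.pair p p', 1 + Polynomial.X + R + (R' + (1 + R + R')), fun i a ha N hN => ?_⟩
  simp only [Polynomial.eval_add, Polynomial.eval_one, Polynomial.eval_X] at hN ⊢
  have h1 := hF i a ha N (by omega)
  have h2 := hG i a ha N (by omega)
  refine ((h1.andThen (B' := R'.eval ((env i).par + sz a) +
    (1 + R.eval ((env i).par + sz a) + R'.eval ((env i).par + sz a))) ?_).charge
    (1 + (Enc.enc a).size)).mono ?_
  · intro b hb
    rw [mapO_eq_bindO]
    refine h2.andThen fun c hc => Spec.done rfl (Nat.zero_le _) ?_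
    have := h1.size b hb
    have := h2.size c hc
    simp only [sz_prod]; omega
  · rw [size_enc]; omega

theorem PolyTime.pair {f : α → β} {g : α → γ} (hf : PolyTime env f) (hg : PolyTime env g) :
    PolyTime env fun a => (f a, g a) :=
  (Poly.pair hf hg).congr (fun _ _ h => h) (by simp)

theorem PolyTime.fst : PolyTime env (Prod.fst : α × β → α) := by
  refine ⟨.fst, 1 + Polynomial.X, fun i a _ N hN => ?_⟩
  obtain ⟨a, b⟩ := a
  simp only [Polynomial.eval_add, Polynomial.eval_one, Polynomial.eval_X, Prog.exec]
  refine Spec.done rfl (by rw [size_enc]; omega) ?_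
  simp only [sz_prod]; omega

theorem PolyTime.snd : PolyTime env (Prod.snd : α × β → β) := by
  refine ⟨.snd, 1 + Polynomial.X, fun i a _ N hN => ?_⟩
  obtain ⟨a, b⟩ := a
  simp only [Polynomial.eval_add, Polynomial.eval_one, Polynomial.eval_X, Prog.exec]
  refine Spec.done rfl (by rw [size_enc]; omega) ?_
  simp only [sz_prod]; omega

theorem PolyTime.const_val (v : Val) : PolyTime env (fun _ : α => v) := by
  induction v with
  | nil =>
    refine ⟨.nil, 1 + Polynomial.X, fun i a _ N hN => ?_⟩
    simp only [Polynomial.eval_add, Polynomial.eval_one, Polynomial.eval_X, Prog.exec]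
    refine Spec.done rfl (by rw [size_enc]; omega) ?_
    exact Nat.le_add_right 1 _
  | cons v w hv hw =>
    exact (PolyTime.of_enc (f := fun p : Val × Val => Val.cons p.1 p.2)
      fun _ => rfl).comp (hv.pair hw)

theorem PolyTime.const (b : β) : PolyTime env (fun _ : α => b) := by
  obtain ⟨p, R, h⟩ := PolyTime.const_val (env := env) (α := α) (Enc.enc b)
  refine ⟨p, R, fun i a ha N hN => ?_⟩
  have h1 := h i a ha N hN
  refine ⟨?_, h1.time, fun c hc => ?_⟩
  · rw [h1.dist]; simp [pureO, PMF.pure_map, resOf]; rfl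
  · rw [some_mem_support_pureO.1 hc]
    exact h1.size _ (some_mem_support_pureO.2 rfl)

theorem Poly.ite {dom domF domG : ι → α → Prop} {c : α → Bool} {F G : ι → α → PMF (Option β)}
    (hc : PolyTime env c) (hF : Poly env domF F) (hG : Poly env domG G)
    (hdF : ∀ i a, dom i a → c a = true → domF i a)
    (hdG : ∀ i a, dom i a → c a = false → domG i a) :
    Poly env dom fun i a => if c a then F i a else G i a := by
  obtain ⟨p, R, hF⟩ := hF
  obtain ⟨p', R', hG⟩ := hG
  obtain ⟨pc, Rc, hc⟩ := hc
  refine ⟨.ite pc p p', 1 + Polynomial.X + Rc + (R + R'), fun i a ha N hN => ?_⟩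
  simp only [Polynomial.eval_add, Polynomial.eval_one, Polynomial.eval_X] at hN ⊢
  have h0 := hc i a trivial N (by omega)
  have := ((h0.andThen (E := fun _ => if c a then F i a else G i a)
    (B' := R.eval ((env i).par + sz a) + R'.eval ((env i).par + sz a))
    (k := fun r => if r = .nil then Prog.exec ((env i).sub N) (env i).dev N p' (Enc.enc a) else
      Prog.exec ((env i).sub N) (env i).dev N p (Enc.enc a)) ?_).charge
    (1 + (Enc.enc a).size)).mono (B' := 1 + ((env i).par + sz a) +
      Rc.eval ((env i).par + sz a) + (R.eval ((env i).par + sz a) + R'.eval ((env i).par + sz a)))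
        (by rw [size_enc]; omega)
  · rw [pureO_bindO] at this
    exact this
  · intro b hb
    rw [some_mem_support_pureO.1 hb]
    cases hca : c a with
    | true =>
      have : Enc.enc true ≠ Val.nil := by intro h; cases h
      simp only [this, if_true, if_false]
      exact (hF i a (hdF i a ha hca) N (by omega)).mono (by omega)
    | false =>
      have : Enc.enc false = Val.nil := rfl
      simp only [this, if_true, Bool.false_eq_true, if_false]
      exact (hG i a (hdG i a ha hca) N (by omega)).mono (by omega)

theorem PolyTime.ite {c : α → Bool} {f g : α → β} (hc : PolyTime env c) (hf : PolyTime env f)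
    (hg : PolyTime env g) : PolyTime env fun a => if c a then f a else g a :=
  (Poly.ite (dom := fun _ _ => True) hc hf hg (fun _ _ _ _ => trivial)
    (fun _ _ _ _ => trivial)).congr (fun _ _ h => h) (fun _ a _ => by cases h : c a <;> simp [h])

theorem PolyTime.bool_comp (φ : Bool → β) {f : α → Bool} (hf : PolyTime env f) :
    PolyTime env fun a => φ (f a) :=
  (PolyTime.ite hf (.const (φ true)) (.const (φ false))).congr
    fun a => by cases f a <;> rfl

theorem PolyTime.bool_comp₂ (φ : Bool → Bool → β) {f g : α → Bool} (hf : PolyTime env f)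
    (hg : PolyTime env g) : PolyTime env fun a => φ (f a) (g a) :=
  (PolyTime.ite hf (hg.bool_comp (φ true)) (hg.bool_comp (φ false))).congr
    fun a => by cases f a <;> rfl

theorem PolyTime.isEmpty {f : α → List β} (hf : PolyTime env f) :
    PolyTime env fun a => (f a).isEmpty := by
  suffices h : PolyTime env (fun l : List β => l.isEmpty) from h.comp hf
  -- A list is represented by `nil` exactly when it is empty, so the list itself serves as the
  -- condition; `pair nil nil` produces the code of `true`.
  refine ⟨.ite .id .nil (.pair .nil .nil), 10 + 10 * Polynomial.X, fun i l _ N hN => ?_⟩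
  simp only [Prog.exec, Runs.andThen, Runs.done, Runs.charge, PMF.pure_bind, PMF.pure_map]
  cases l with
  | nil =>
    simp only [enc_nil, if_true, PMF.pure_map]
    refine Spec.done rfl ?_ ?_ <;>
    simp [Val.size]
    omega
  | cons a l =>
    simp only [enc_cons, reduceCtorEq, if_false, PMF.pure_map]
    refine Spec.done rfl ?_ ?_ <;>
    simp [Val.size, size_enc] <;> omega

theorem PolyTime.tail {f : α → List β} (hf : PolyTime env f) :
    PolyTime env fun a => (f a).tail := by
  suffices h : PolyTime env (fun l : List β => l.tail) from h.comp hf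
  refine ⟨.snd, 1 + Polynomial.X, fun i l _ N hN => ?_⟩
  simp only [Polynomial.eval_add, Polynomial.eval_one, Polynomial.eval_X, Prog.exec]
  cases l with
  | nil => exact Spec.done rfl (by rw [size_enc]; omega) (by simp)
  | cons a l =>
    exact Spec.done rfl (by rw [size_enc]; omega) (by simp; omega)

theorem PolyTime.cons {f : α → β} {g : α → List β} (hf : PolyTime env f) (hg : PolyTime env g) :
    PolyTime env fun a => f a :: g a :=
  (PolyTime.of_enc (f := fun p : β × List β => p.1 :: p.2) fun _ => rfl).comp (hf.pair hg)

/-- The first element of a non-empty list. -/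
theorem Poly.head : Poly env (fun _ l => l ≠ [])
    fun _ (l : List β) => l.head?.elim (PMF.pure none) pureO := by
  refine ⟨.fst, 1 + Polynomial.X, fun i l hl N hN => ?_⟩
  simp only [Polynomial.eval_add, Polynomial.eval_one, Polynomial.eval_X, Prog.exec]
  cases l with
  | nil => exact absurd rfl hl
  | cons a l =>
    exact Spec.done rfl (by rw [size_enc]; omega) (by simp; omega)

/-- Processing a list from left to right. The state has to stay of polynomial size. -/
theorem Poly.fold {dom : ι → γ × σ × α → Prop} {F : ι → γ × σ × α → PMF (Option σ)}
    (hF : Poly env dom F) {dom' : ι → γ × σ × List α → Prop} (Q : Polynomial ℕ)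
    -- The invariant relates the unread rest of the list to the state and may depend on the initial
    -- data; its bound on the state is in terms of the initial size, so sizes cannot compound over
    -- the rounds.
    (hInv : ∀ i c s l, dom' i (c, s, l) → ∃ Inv : List α → σ → Prop, Inv l s ∧
      ∀ l' s', Inv l' s' → sz s' ≤ Q.eval ((env i).par + sz (c, s, l)) ∧
        ∀ a t, l' = a :: t → a ∈ l → dom i (c, s', a) ∧
          ∀ s'', some s'' ∈ (F i (c, s', a)).support → Inv t s'') :
    Poly env dom' fun i x => foldO (fun s a => F i (x.1, s, a)) x.2.1 x.2.2 := by
  have hbody : Poly env (fun i (x : γ × σ × List α) =>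
        ∃ a t, x.2.2 = a :: t ∧ dom i (x.1, x.2.1, a))
      (fun i x => bindO (x.2.2.head?.elim (PMF.pure none) pureO) fun a =>
        mapO (fun s' => (x.1, s', x.2.2.tail)) (F i (x.1, x.2.1, a))) := by
    have p1 : PolyTime env (fun x : γ × σ × List α => x.1) := .fst
    have p2 : PolyTime env (fun x : γ × σ × List α => x.2.1) := PolyTime.fst.comp .snd
    have p3 : PolyTime env (fun x : γ × σ × List α => x.2.2) := PolyTime.snd.comp .snd
    have hh := (Poly.head (env := env) (β := α)).comp_det p3
    have harg := (p1.poly _).pair ((p2.poly _).pair hh)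
    have hstep := Poly.comp hF (harg.congr (dom' := fun i x =>
        ∃ a t, x.2.2 = a :: t ∧ dom i (x.1, x.2.1, a)) (by rintro i x ⟨a, t, h, -⟩; simp [h])
        (fun _ _ _ => rfl)) (by
      rintro i x ⟨a, t, h, hd⟩ b hb
      simp only [h, pureO_bindO, List.head?_cons, Option.elim, mapO_pureO] at hb
      rw [some_mem_support_pureO.1 hb]; exact hd)
    refine ((p1.poly _).pair (hstep.pair (p3.tail.poly _))).congr (fun _ _ h => h) ?_
    rintro i x ⟨a, t, h, hd⟩
    simp [h, mapO_eq_bindO, bindO_assoc]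
  obtain ⟨p, R, hp⟩ := hbody
  obtain ⟨pc, Rc, hpc⟩ : PolyTime env (fun x : γ × σ × List α => x.2.2) := PolyTime.snd.comp .snd
  have hwhile : Poly env dom' (fun i x => mapO (fun s' => (x.1, s', ([] : List α)))
      (foldO (fun s a => F i (x.1, s, a)) x.2.1 x.2.2)) := by
    -- A bound for the parameter plus the size of the loop variable in every round: context and rest
    -- of the list stay below the initial size, and the state below `Q`.
    let S : Polynomial ℕ := 1 + 2 * Polynomial.X + Q
    refine ⟨.while pc p, 1 + Polynomial.X + (R.comp S + Rc.comp S) +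
      (Polynomial.X + 1) * (2 * (R.comp S + Rc.comp S + S) + 1), fun i x hx N hN => ?_⟩
    obtain ⟨c, s, l⟩ := x
    obtain ⟨Inv, h0, hI⟩ := hInv i c s l hx
    set u := (env i).par + sz (c, s, l) with hu
    set B := R.eval (S.eval u) + Rc.eval (S.eval u) + S.eval u with hB
    have hS : S.eval u = 1 + 2 * u + Q.eval u := by simp [S]
    simp only [Polynomial.eval_add, Polynomial.eval_one, Polynomial.eval_X,
      Polynomial.eval_comp, Polynomial.eval_mul, Polynomial.eval_ofNat, ← hB] at hN ⊢
    have hlen : l.length + 1 ≤ u := by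
      have := length_lt_sz l; simp only [sz_prod] at hu; omega
    have hstate : ∀ l' s', Inv l' s' ∧ l' <:+ l → (env i).par + sz (c, s', l') ≤ S.eval u := by
      rintro l' s' ⟨h1, h2⟩
      have h3 := (hI _ _ h1).1
      have h4 := sz_suffix_le h2
      simp only [sz_prod] at hu ⊢
      omega
    have hloop := Spec.whileLoop (cond := Prog.exec ((env i).sub N) (env i).dev N pc)
      (body := Prog.exec ((env i).sub N) (env i).dev N p)
      (F := fun s a => F i (c, s, a)) (c := c) (Inv := fun l' s' => Inv l' s' ∧ l' <:+ l) (B := B)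
      (fun l' s' h => by
        have h1 := eval_mono Rc (hstate l' s' h)
        exact (hpc i (c, s', l') trivial N (h1.trans (by omega))).mono (h1.trans (by omega)))
      (fun a t s' h => by
        have h1 := eval_mono R (hstate _ s' h)
        have h2 := ((hI _ _ h.1).2 a t rfl (h.2.subset (by simp))).1
        have := hp i (c, s', a :: t) ⟨a, t, rfl, h2⟩ N (h1.trans (by omega))
        simp only [List.head?_cons, Option.elim, pureO_bindO, List.tail_cons] at this
        exact this.mono (h1.trans (by omega)))
      (fun a t s' h s'' hs'' => ⟨((hI _ _ h.1).2 a t rfl (h.2.subset (by simp))).2 s'' hs'',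
        (List.suffix_cons a t).trans h.2⟩)
      (fun l' s' h => by have := hstate l' s' h; omega) l s N ⟨h0, List.suffix_refl l⟩ (by
        have : u ≤ N := by omega
        omega)
    refine (hloop.charge (1 + (Enc.enc (c, s, l)).size)).mono ?_
    have h5 : (l.length + 1) * (2 * B + 1) ≤ (u + 1) * (2 * B + 1) :=
      Nat.mul_le_mul_right _ (by omega)
    rw [size_enc]
    omega
  refine ((PolyTime.fst.comp .snd : PolyTime env (fun x : γ × σ × List α => x.2.1)).after
    hwhile).congr (fun _ _ h => h) fun i x hx => ?_
  rw [mapO_mapO, mapO_eq_bindO]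
  exact bindO_pureO _

/-- The invariant of `Poly.fold` says that the state is the fold over the part already read; a size
bound for all prefixes is then enough. -/
theorem PolyTime.foldl {f : γ × σ × α → σ} (hf : PolyTime env f) (Q : Polynomial ℕ)
    (hQ : ∀ c s (l l' : List α), l' <+: l →
      sz (l'.foldl (fun s a => f (c, s, a)) s) ≤ Q.eval (sz (c, s, l))) :
    PolyTime env fun x : γ × σ × List α => x.2.2.foldl (fun s a => f (x.1, s, a)) x.2.1 := by
  refine (Poly.fold hf (dom' := fun _ _ => True) Q ?_).congr (fun _ _ h => h)
    (fun i x _ => foldO_pureO (fun s a => f (x.1, s, a)) _ _)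
  intro i c s l _
  refine ⟨fun t s' => ∃ l', l' ++ t = l ∧ s' = l'.foldl (fun s a => f (c, s, a)) s,
    ⟨[], rfl, rfl⟩, ?_⟩
  rintro t s' ⟨l', h1, rfl⟩
  refine ⟨(hQ c s l l' ⟨t, h1⟩).trans (eval_mono _ (Nat.le_add_left _ _)), ?_⟩
  rintro a t rfl -
  refine ⟨trivial, fun s'' h => ?_⟩
  rw [some_mem_support_pureO.1 h]
  exact ⟨l' ++ [a], by simp [h1], by simp⟩

/-- Folding with a step that increases the size of the state by a bounded amount. -/
theorem PolyTime.foldl_of_add {f : γ × σ × α → σ} (hf : PolyTime env f) (G : Polynomial ℕ)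
    (hG : ∀ c s a, sz (f (c, s, a)) ≤ sz s + G.eval (sz c + sz a)) :
    PolyTime env fun x : γ × σ × List α => x.2.2.foldl (fun s a => f (x.1, s, a)) x.2.1 := by
  refine PolyTime.foldl hf (Polynomial.X + Polynomial.X * G) fun c s l l' hl => ?_
  have key : ∀ (t : List α) (s : σ), (∀ a ∈ t, a ∈ l) →
      sz (t.foldl (fun s a => f (c, s, a)) s) ≤ sz s + t.length * G.eval (sz (c, s, l)) := by
    intro t
    -- The initial state is fixed as `s₀` inside the bound while the current state `s` varies in the
    -- induction.
    suffices h : ∀ (s₀ : σ) (s : σ), (∀ a ∈ t, a ∈ l) →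
        sz (t.foldl (fun s a => f (c, s, a)) s) ≤ sz s + t.length * G.eval (sz (c, s₀, l)) from
      fun s => h s s
    intro s₀
    induction t with
    | nil => simp
    | cons a t ih =>
      intro s ht
      have h1 := ih (f (c, s, a)) fun b hb => ht b (by simp [hb])
      have h2 := hG c s a
      have h3 : G.eval (sz c + sz a) ≤ G.eval (sz (c, s₀, l)) := by
        apply eval_mono
        have := sz_mem_lt (ht a (by simp))
        simp only [sz_prod]; omega
      simp only [List.foldl_cons, List.length_cons, Nat.add_mul]
      omega
  have h1 := key l' s fun a ha => hl.subset ha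
  have h2 : l'.length ≤ sz (c, s, l) := by
    have := hl.length_le
    have := length_lt_sz l
    simp only [sz_prod]; omega
  have h3 := Nat.mul_le_mul_right (G.eval (sz (c, s, l))) h2
  simp only [Polynomial.eval_add, Polynomial.eval_X, Polynomial.eval_mul]
  have h4 : sz s ≤ sz (c, s, l) := by simp only [sz_prod]; omega
  omega

theorem PolyTime.reverse {f : α → List β} (hf : PolyTime env f) :
    PolyTime env fun a => (f a).reverse := by
  have hstep : PolyTime env (fun x : Unit × List β × β => x.2.2 :: x.2.1) :=
    .cons (PolyTime.snd.comp .snd) (PolyTime.fst.comp .snd)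
  have := (PolyTime.foldl_of_add hstep (1 + Polynomial.X) (by
    intro c s a; simp; omega)).comp (((PolyTime.const ()).pair
      ((PolyTime.const ([] : List β)).pair hf)))
  exact this.congr fun a => by
    rw [List.foldl_flip_cons_eq_append]; simp

/-- Applying a random function to all elements of a list. -/
theorem Poly.map {dom : ι → γ × α → Prop} {F : ι → γ × α → PMF (Option β)} (hF : Poly env dom F) :
    Poly env (fun i (x : γ × List α) => ∀ a ∈ x.2, dom i (x.1, a))
      fun i x => mapListO (fun a => F i (x.1, a)) x.2 := by
  -- The size clause for `F` is needed separately, to bound the list of results accumulated by the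
  -- loop.
  obtain ⟨p, R, hp⟩ := id hF
  have hstep : Poly env (fun i (x : γ × List β × α) => dom i (x.1, x.2.2))
      (fun i x => mapO (fun b => b :: x.2.1) (F i (x.1, x.2.2))) := by
    have h1 := hF.comp_det ((PolyTime.fst).pair (PolyTime.snd.comp .snd) :
      PolyTime env (fun x : γ × List β × α => (x.1, x.2.2)))
    have h2 : PolyTime env (fun x : γ × List β × α => x.2.1) := PolyTime.fst.comp .snd
    have h3 : PolyTime env (fun y : List β × β => y.2 :: y.1) := .cons .snd .fst
    refine (h3.after ((h2.poly _).pair h1)).congr (fun _ _ h => h) fun i x _ => ?_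
    simp [mapO_mapO]
  have hfold := Poly.fold hstep (dom' := fun i x => x.2.1 = [] ∧ ∀ a ∈ x.2.2, dom i (x.1, a))
    (1 + Polynomial.X * (1 + R)) (by
      rintro i c s l ⟨hs, hl⟩
      simp only at hs hl
      subst hs
      set u := (env i).par + sz (c, ([] : List β), l) with hu
      -- There are as many results as elements read and each is of size at most `R`, so the state
      -- has size at most about the input size times `R`.
      refine ⟨fun t r => t.length + r.length = l.length ∧ ∀ b ∈ r, sz b ≤ R.eval u,
        by simp, ?_⟩
      rintro t r ⟨h1, h2⟩
      constructor
      · have h3 := sz_le_of_forall_mem h2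
        have h4 : r.length ≤ u := by
          have := length_lt_sz l
          simp only [sz_prod] at hu; omega
        simp only [Polynomial.eval_add, Polynomial.eval_X, Polynomial.eval_mul,
          Polynomial.eval_one]
        have := Nat.mul_le_mul_right (1 + R.eval u) h4
        omega
      · rintro a t rfl ha
        refine ⟨hl a ha, fun r' hr' => ?_⟩
        obtain ⟨b, hb, rfl⟩ := some_mem_support_mapO.1 hr'
        refine ⟨by simp only [List.length_cons] at h1 ⊢; omega, ?_⟩
        intro b' hb'
        rcases List.mem_cons.1 hb' with rfl | hb'
        · refine ((hp i (c, a) (hl a ha) _ le_rfl).size _ hb).trans (eval_mono _ ?_)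
          have := sz_mem_lt ha
          simp only [sz_prod] at hu ⊢; omega
        · exact h2 b' hb')
  have harg : PolyTime env (fun x : γ × List α => (x.1, ([] : List β), x.2.reverse)) :=
    .pair .fst (.pair (.const []) (PolyTime.reverse .snd))
  refine (hfold.comp_det harg).congr ?_ ?_
  · intro i x hx
    exact ⟨rfl, fun a ha => hx a (List.mem_reverse.1 ha)⟩
  · intro i x _
    exact foldO_reverse (fun a => F i (x.1, a)) x.2

theorem PolyTime.map {f : γ × α → β} {c : δ → γ} {g : δ → List α} (hf : PolyTime env f)
    (hc : PolyTime env c) (hg : PolyTime env g) :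
    PolyTime env fun x => (g x).map fun a => f (c x, a) := by
  have h : PolyTime env (fun x : γ × List α => x.2.map fun a => f (x.1, a)) :=
    (Poly.map hf).congr (fun _ _ _ _ _ => trivial) fun _ _ _ => mapListO_pureO _ _
  exact h.comp (hc.pair hg)

end

/-! ### A library of polynomial-time functions -/

/-- The loop behind `zip`: its state is the unread rest of the second list together with the pairs
formed so far, in reverse order. -/
theorem zip_fold_aux {α β : Type} (l : List α) (l' : List β) (r : List (α × β)) :
    (l.foldl (fun (s : List β × List (α × β)) a =>
      (s.1.tail, s.1.head?.elim s.2 fun b => (a, b) :: s.2)) (l', r)).2 =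
      (l.zip l').reverse ++ r := by
  induction l generalizing l' r with
  | nil => simp
  | cons a l ih => cases l' <;> simp [ih]

theorem foldl_tail {α : Type} (k : ℕ) (l : List α) :
    (List.replicate k ()).foldl (fun s _ => s.tail) l = l.drop k := by
  induction k generalizing l with
  | zero => rfl
  | succ k ih => rw [List.replicate_succ, List.foldl_cons, ih]; cases l <;> simp

/-- Zipping with `k` units truncates, so `take` needs no loop of its own. -/
theorem map_fst_zip_units {α : Type} (l : List α) (k : ℕ) :
    (l.zip (List.replicate k ())).map (fun p => p.1) = l.take k := by
  induction l generalizing k with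
  | nil => simp
  | cons a l ih => cases k <;> simp [List.replicate_succ, ih]

section
variable {ι α β γ δ σ : Type} [Enc α] [Enc β] [Enc γ] [Enc δ] [Enc σ] {env : ι → Env}

theorem PolyTime.proj₁ {f : α → β × γ} (hf : PolyTime env f) : PolyTime env fun a => (f a).1 :=
  PolyTime.fst.comp hf

theorem PolyTime.proj₂ {f : α → β × γ} (hf : PolyTime env f) : PolyTime env fun a => (f a).2 :=
  PolyTime.snd.comp hf

theorem PolyTime.list_map {f : δ → α → β} {g : δ → List α}
    (hf : PolyTime env fun p : δ × α => f p.1 p.2) (hg : PolyTime env g) :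
    PolyTime env fun x => (g x).map (f x) :=
  PolyTime.map (f := fun p : δ × α => f p.1 p.2) hf .id hg

theorem PolyTime.foldl_add {f : δ → σ → α → σ} {s : δ → σ} {g : δ → List α}
    (hf : PolyTime env fun p : δ × σ × α => f p.1 p.2.1 p.2.2) (hs : PolyTime env s)
    (hg : PolyTime env g) (G : Polynomial ℕ)
    (hG : ∀ c s a, sz (f c s a) ≤ sz s + G.eval (sz c + sz a)) :
    PolyTime env fun x => (g x).foldl (f x) (s x) :=
  (PolyTime.foldl_of_add (f := fun p : δ × σ × α => f p.1 p.2.1 p.2.2) hf G hG).comp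
    (PolyTime.id.pair (hs.pair hg))

theorem PolyTime.append {f g : α → List β} (hf : PolyTime env f) (hg : PolyTime env g) :
    PolyTime env fun a => f a ++ g a := by
  have hstep : PolyTime env (fun p : α × List β × β => p.2.2 :: p.2.1) :=
    .cons PolyTime.id.proj₂.proj₂ PolyTime.id.proj₂.proj₁
  refine (PolyTime.foldl_add (f := fun _ s a => a :: s) hstep hg hf.reverse (1 + Polynomial.X)
    (by intro c s a; simp; omega)).congr fun a => ?_
  rw [List.foldl_flip_cons_eq_append']; simp

theorem PolyTime.flatten {f : α → List (List β)} (hf : PolyTime env f) :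
    PolyTime env fun a => (f a).flatten := by
  have hstep : PolyTime env (fun p : α × List β × List β => p.2.2 ++ p.2.1) :=
    .append PolyTime.id.proj₂.proj₂ PolyTime.id.proj₂.proj₁
  refine (PolyTime.foldl_add (f := fun _ s a => a ++ s) hstep (.const []) hf.reverse Polynomial.X
    (by intro c s a; have := sz_append a s; simp; omega)).congr fun a => ?_
  generalize f a = l
  rw [List.foldl_reverse]
  induction l with
  | nil => rfl
  | cons a l ih => simp [ih]

theorem PolyTime.flatMap {f : δ → α → List β} {g : δ → List α}
    (hf : PolyTime env fun p : δ × α => f p.1 p.2) (hg : PolyTime env g) :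
    PolyTime env fun x => (g x).flatMap (f x) :=
  (PolyTime.flatten (hf.list_map hg)).congr fun _ => List.flatMap_def.symm

theorem PolyTime.filter {f : δ → α → Bool} {g : δ → List α}
    (hf : PolyTime env fun p : δ × α => f p.1 p.2) (hg : PolyTime env g) :
    PolyTime env fun x => (g x).filter (f x) := by
  refine (PolyTime.flatMap (f := fun x a => if f x a then [a] else [])
    (.ite hf (.cons .snd (.const [])) (.const [])) hg).congr fun x => ?_
  generalize g x = l
  induction l with
  | nil => rfl
  | cons a l ih =>
    rw [List.flatMap_cons, ih, List.filter_cons]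
    cases f x a <;> simp

theorem PolyTime.zip {f : δ → List α} {g : δ → List β} (hf : PolyTime env f)
    (hg : PolyTime env g) : PolyTime env fun x => (f x).zip (g x) := by
  have p3 : PolyTime env (fun p : δ × (List β × List (α × β)) × α => p.2.1.1) :=
    PolyTime.id.proj₂.proj₁.proj₁
  have p2 : PolyTime env (fun p : δ × (List β × List (α × β)) × α => p.2.1.2) :=
    PolyTime.id.proj₂.proj₁.proj₂
  have p1 : PolyTime env (fun p : δ × (List β × List (α × β)) × α => p.2.2) :=
    PolyTime.id.proj₂.proj₂
  have hnew : PolyTime env (fun p : δ × (List β × List (α × β)) × α =>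
      p.2.1.1.head?.elim p.2.1.2 fun b => (p.2.2, b) :: p.2.1.2) := by
    have h1 := (Poly.head (env := env) (β := β)).comp_det p3
    have h2 : PolyTime env (fun y : (α × List (α × β)) × β => (y.1.1, y.2) :: y.1.2) :=
      .cons (.pair PolyTime.id.proj₁.proj₁ .snd) PolyTime.id.proj₁.proj₂
    have h3 := h2.after (((p1.pair p2).poly _).pair h1)
    have h4 := Poly.ite (dom := fun _ _ => True) p3.isEmpty p2 h3 (fun _ _ _ _ => trivial)
      (by intro i a _ h h'; simp [h'] at h)
    refine h4.congr (fun _ _ h => h) ?_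
    rintro i ⟨x, ⟨l, r⟩, a⟩ -
    cases l <;> simp
  have h := PolyTime.foldl_add (f := fun (_ : δ) (s : List β × List (α × β)) (a : α) =>
      (s.1.tail, s.1.head?.elim s.2 fun b => (a, b) :: s.2))
      (PolyTime.pair p3.tail hnew) (hg.pair (.const [])) hf (2 + Polynomial.X) (by
        rintro c ⟨l, r⟩ a
        cases l with
        | nil => simp
        | cons b l => simp; omega)
  exact h.proj₂.reverse.congr fun x => by rw [zip_fold_aux]; simp

/-- A unary number and a list of that many units are the same tree, so arithmetic reduces to
operations on lists. -/
theorem PolyTime.units {f : α → ℕ} (hf : PolyTime env f) :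
    PolyTime env fun a => List.replicate (f a) () := by
  refine (PolyTime.of_enc (f := fun k : ℕ => List.replicate k ()) fun k => ?_).comp hf
  induction k with
  | zero => rfl
  | succ k ih => rw [List.replicate_succ, enc_cons, ih]; rfl

theorem PolyTime.length {f : α → List β} (hf : PolyTime env f) :
    PolyTime env fun a => (f a).length := by
  have h : PolyTime env (fun l : List Unit => l.length) := .of_enc fun l => by
    induction l with
    | nil => rfl
    | cons a l ih => rw [List.length_cons, enc_cons, ← ih]; rfl
  exact (h.comp (PolyTime.list_map (f := fun _ _ => ()) (.const ()) hf)).congr fun a => by simp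

theorem PolyTime.add {f g : α → ℕ} (hf : PolyTime env f) (hg : PolyTime env g) :
    PolyTime env fun a => f a + g a :=
  (PolyTime.length (hf.units.append hg.units)).congr fun a => by simp

theorem PolyTime.sub {f g : α → ℕ} (hf : PolyTime env f) (hg : PolyTime env g) :
    PolyTime env fun a => f a - g a := by
  have h := PolyTime.foldl_add (f := fun (_ : α) (s : List Unit) (_ : Unit) => s.tail)
    (PolyTime.tail PolyTime.id.proj₂.proj₁) hf.units hg.units 0 (by
      intro c s a; cases s <;> simp)
  exact h.length.congr fun a => by rw [foldl_tail]; simp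

theorem PolyTime.le {f g : α → ℕ} (hf : PolyTime env f) (hg : PolyTime env g) :
    PolyTime env fun a => decide (f a ≤ g a) :=
  (hf.sub hg).units.isEmpty.congr fun a => by
    rw [Bool.eq_iff_iff]; simp; omega

theorem PolyTime.nat_eq {f g : α → ℕ} (hf : PolyTime env f) (hg : PolyTime env g) :
    PolyTime env fun a => decide (f a = g a) :=
  ((hf.le hg).bool_comp₂ and (hg.le hf)).congr fun a => by
    rw [Bool.eq_iff_iff]; simp; omega

theorem PolyTime.mul {f g : α → ℕ} (hf : PolyTime env f) (hg : PolyTime env g) :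
    PolyTime env fun a => f a * g a :=
  (PolyTime.flatMap (f := fun x (_ : Unit) => List.replicate (g x) ())
    (hg.comp .fst).units hf.units).length.congr fun a => by simp [List.length_flatMap]

theorem PolyTime.eval (p : Polynomial ℕ) {f : α → ℕ} (hf : PolyTime env f) :
    PolyTime env fun a => p.eval (f a) := by
  induction p using Polynomial.induction_on' with
  | add p q hp hq => exact (hp.add hq).congr fun a => by simp
  | monomial k c =>
    have hk : PolyTime env fun a => f a ^ k := by
      induction k with
      | zero => exact (PolyTime.const 1).congr fun a => by simp
      | succ k ih => exact (ih.mul hf).congr fun a => by rw [pow_succ]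
    exact ((PolyTime.const c).mul hk).congr fun a => by simp

theorem PolyTime.take {f : α → ℕ} {g : α → List β} (hf : PolyTime env f) (hg : PolyTime env g) :
    PolyTime env fun a => (g a).take (f a) := by
  refine (PolyTime.list_map (f := fun _ (p : β × Unit) => p.1) PolyTime.id.proj₂.proj₁
    (hg.zip hf.units)).congr fun a => map_fst_zip_units _ _

/-- The counter runs down and the new element is its distance from `m`. Its size is thus bounded
through the fixed context `m`, as `PolyTime.foldl_add` requires; for a counter running up the bound
would involve the state. -/
theorem range_fold_aux (m k : ℕ) (hk : k ≤ m) :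
    (List.replicate k ()).foldl (fun (s : ℕ × List ℕ) _ => (s.1 - 1, (m - s.1) :: s.2)) (m, []) =
      (m - k, (List.range k).reverse) := by
  induction k with
  | zero => rfl
  | succ k ih =>
    rw [List.replicate_succ', List.foldl_append, ih (by omega), List.range_succ]
    simp
    omega

theorem PolyTime.range {f : α → ℕ} (hf : PolyTime env f) :
    PolyTime env fun a => List.range (f a) := by
  suffices h : PolyTime env List.range from h.comp hf
  have h := PolyTime.foldl_add (env := env)
    (f := fun (m : ℕ) (s : ℕ × List ℕ) (_ : Unit) => (s.1 - 1, (m - s.1) :: s.2))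
    (.pair (.sub PolyTime.id.proj₂.proj₁.proj₁ (.const 1))
      (.cons (.sub .fst PolyTime.id.proj₂.proj₁.proj₁) PolyTime.id.proj₂.proj₁.proj₂))
    (s := fun m => (m, [])) (.pair .id (.const [])) (PolyTime.units .id) (1 + Polynomial.X) (by
      rintro m ⟨k, r⟩ a
      simp; omega)
  exact h.proj₂.reverse.congr fun m => by rw [range_fold_aux m m le_rfl]; simp

theorem PolyTime.nat_val {f : α → ℕ} (hf : PolyTime env f) :
    PolyTime env fun a => encNat (f a) :=
  (PolyTime.of_enc (f := fun k : ℕ => encNat k) fun _ => rfl).comp hf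

theorem PolyTime.cons_val {f g : α → Val} (hf : PolyTime env f) (hg : PolyTime env g) :
    PolyTime env fun a => Val.cons (f a) (g a) :=
  (PolyTime.of_enc (f := fun p : Val × Val => Val.cons p.1 p.2) fun _ => rfl).comp (hf.pair hg)

end

/-! ### The deterministic parts of the algorithm -/

/-- The parity of the inner product of two bit strings. -/
def parity (s u : List Bool) : Bool :=
  ((s.zip u).map fun p => p.1 && p.2).foldl xor false

/-- Each sample `(u, v)` counts with weight `v` and sign `(-1)^{s·u}`. -/
def votes (s : List Bool) (D : List (List Bool × Bool)) : List (Bool × Bool) :=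
  D.map fun x => (x.2, parity s x.1)

/-- The number of positive votes. -/
def posVotes (V : List (Bool × Bool)) : ℕ := (V.filter fun x => x.1 && !x.2).length

/-- The number of negative votes. -/
def negVotes (V : List (Bool × Bool)) : ℕ := (V.filter fun x => x.1 && x.2).length

/-- A sample `(u, q₁, q₂)`: a bit string `u` and two inputs for the Boolean function. -/
abbrev Sample : Type := List Bool × List Bool × List Bool

/-- The sample for estimating a Fourier coefficient. -/
def coeffSample (w : List (Bool × Bool × Bool)) : Sample :=
  (w.map fun t => t.1, w.map fun t => t.1, w.map fun t => t.1)

/-- The sample for estimating the weight of the Fourier coefficients that agree with a given string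
on the positions in `mask`. -/
def weightSample (mask : List Bool) (w : List (Bool × Bool × Bool)) : Sample :=
  -- The two inputs are independent on the mask and coincide off it. The sign uses their difference;
  -- its values off the mask are irrelevant because candidates vanish there.
  (w.map fun t => xor t.1 t.2.1,
    (mask.zip w).map fun p => if p.1 then p.2.1 else p.2.2.2,
    (mask.zip w).map fun p => if p.1 then p.2.2.1 else p.2.2.2)

/-- The positions `0, …, j`. -/
def maskBits (m j : ℕ) : List Bool := (List.range m).map fun i => decide (i ≤ j)

/-- The position `j`. -/
def unitBits (m j : ℕ) : List Bool := (List.range m).map fun i => decide (i = j)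

/-- The samples for Fourier coefficients, and those for the weights, one list for each position. -/
def samples (m : ℕ) (W : List (List (Bool × Bool × Bool))) :
    List Sample × List (List Sample) :=
  (W.map coeffSample, (List.range m).map fun j => W.map (weightSample (maskBits m j)))

/-- Set the positions in `e` to one if `b` is true. -/
def extend (b : Bool) (e s : List Bool) : List Bool := (s.zip e).map fun p => p.1 || (b && p.2)

/-- One round of the search for large Fourier coefficients: extend the candidates and keep at most
`cap` of those with a large estimated weight. -/
def searchStep (thr cap : ℕ) (L : List (List Bool)) (x : List Bool × List (List Bool × Bool)) :
    List (List Bool) :=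
  -- Adding the threshold on the left avoids truncated subtraction. The final `take` keeps the time
  -- polynomial even if the samples mislead; with accurate estimates it removes nothing.
  ((L.map (extend false x.1) ++ L.map (extend true x.1)).filter fun s =>
    decide (negVotes (votes s x.2) + thr ≤ posVotes (votes s x.2))).take cap

/-- The search for large Fourier coefficients. -/
def search (m thr cap : ℕ) (D : List (List (List Bool × Bool))) : List (List Bool) :=
  (((List.range m).map (unitBits m)).zip D).foldl (searchStep thr cap)
    [(List.range m).map fun _ => false]

/-- Encoded elementary gates. -/
abbrev RawGate : Type := ℕ × Val

/-- The inverse circuit. -/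
def rawInverse (C : List RawGate) : List RawGate :=
  -- The tag 1 marks T, whose inverse is its seventh power; H and CZ are their own inverses.
  C.reverse.flatMap fun g => if g.1 = 1 then List.replicate 7 g else [g]

/-- `H C† CZ C H` where `H` acts on qubit `n` and `CZ` on the qubits `n` and `j`. -/
def rawTestGate (n : ℕ) (C : List RawGate) (j : ℕ) : List RawGate :=
  (0, encNat n) :: (C ++ (2, Val.cons (encNat n) (encNat j)) :: (rawInverse C ++ [(0, encNat n)]))

/-- The commuting circuit for the Fourier coefficient `s`. -/
def rawTest (m n : ℕ) (C : List RawGate) (s : List Bool) : List (List RawGate) :=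
  (s.zip (List.range m)).flatMap fun p => if p.1 then [rawTestGate n C p.2] else []

/-- The requests for the device, each with the vote of a sample. -/
def requests (m n : ℕ) (C : List RawGate) (L : List (List Bool)) (D : List (List Bool × Bool)) :
    List ((Bool × Bool) × List (List RawGate)) :=
  L.flatMap fun s => (votes s D).map fun w => (w, rawTest m n C s)

/-- Combine a vote with the last bit of a measurement outcome. -/
def combine (w : Bool × Bool) (y : List Bool) : Bool × Bool :=
  (w.1, xor w.2 (y.foldl (fun _ b => b) false))

section
variable {ι α : Type} [Enc α] {env : ι → Env}

theorem PolyTime.parity {f g : α → List Bool} (hf : PolyTime env f) (hg : PolyTime env g) :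
    PolyTime env fun x => parity (f x) (g x) := by
  refine PolyTime.foldl_add (f := fun _ => xor)
    (PolyTime.bool_comp₂ xor PolyTime.id.proj₂.proj₁ PolyTime.id.proj₂.proj₂) (.const false)
    (PolyTime.list_map (f := fun _ p => p.1 && p.2)
      (PolyTime.bool_comp₂ and PolyTime.id.proj₂.proj₁ PolyTime.id.proj₂.proj₂)
      (hf.zip hg)) 3 ?_
  intro c s a
  have := sz_bool_le (s ^^ a)
  simp; omega

theorem PolyTime.votes {f : α → List Bool} {g : α → List (List Bool × Bool)}
    (hf : PolyTime env f) (hg : PolyTime env g) : PolyTime env fun x => votes (f x) (g x) :=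
  PolyTime.list_map (f := fun x (y : List Bool × Bool) => (y.2, SCP.parity (f x) y.1))
    (.pair PolyTime.id.proj₂.proj₂ (.parity (hf.comp .fst) PolyTime.id.proj₂.proj₁)) hg

theorem PolyTime.posVotes {f : α → List (Bool × Bool)} (hf : PolyTime env f) :
    PolyTime env fun x => posVotes (f x) :=
  (PolyTime.filter (f := fun _ (x : Bool × Bool) => x.1 && !x.2)
    (PolyTime.bool_comp₂ (fun a b => a && !b) PolyTime.id.proj₂.proj₁ PolyTime.id.proj₂.proj₂)
    hf).length

theorem PolyTime.negVotes {f : α → List (Bool × Bool)} (hf : PolyTime env f) :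
    PolyTime env fun x => negVotes (f x) :=
  (PolyTime.filter (f := fun _ (x : Bool × Bool) => x.1 && x.2)
    (PolyTime.bool_comp₂ and PolyTime.id.proj₂.proj₁ PolyTime.id.proj₂.proj₂) hf).length

theorem PolyTime.coeffSample {f : α → List (Bool × Bool × Bool)} (hf : PolyTime env f) :
    PolyTime env fun x => coeffSample (f x) := by
  have h := PolyTime.list_map (env := env) (f := fun (_ : α) (t : Bool × Bool × Bool) => t.1)
    PolyTime.id.proj₂.proj₁ hf
  exact h.pair (h.pair h)

theorem PolyTime.weightSample {f : α → List Bool} {g : α → List (Bool × Bool × Bool)}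
    (hf : PolyTime env f) (hg : PolyTime env g) :
    PolyTime env fun x => weightSample (f x) (g x) := by
  refine .pair (PolyTime.list_map (f := fun _ t => xor t.1 t.2.1)
    (PolyTime.bool_comp₂ xor PolyTime.id.proj₂.proj₁ PolyTime.id.proj₂.proj₂.proj₁) hg) (.pair ?_ ?_)
  · exact PolyTime.list_map (f := fun _ p => if p.1 then p.2.1 else p.2.2.2)
      (.ite PolyTime.id.proj₂.proj₁ PolyTime.id.proj₂.proj₂.proj₁
        PolyTime.id.proj₂.proj₂.proj₂.proj₂) (hf.zip hg)
  · exact PolyTime.list_map (f := fun _ p => if p.1 then p.2.2.1 else p.2.2.2)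
      (.ite PolyTime.id.proj₂.proj₁ PolyTime.id.proj₂.proj₂.proj₂.proj₁
        PolyTime.id.proj₂.proj₂.proj₂.proj₂) (hf.zip hg)

theorem PolyTime.maskBits {f g : α → ℕ} (hf : PolyTime env f) (hg : PolyTime env g) :
    PolyTime env fun x => maskBits (f x) (g x) :=
  PolyTime.list_map (f := fun x i => decide (i ≤ g x)) (.le .snd (hg.comp .fst)) hf.range

theorem PolyTime.unitBits {f g : α → ℕ} (hf : PolyTime env f) (hg : PolyTime env g) :
    PolyTime env fun x => unitBits (f x) (g x) :=
  PolyTime.list_map (f := fun x i => decide (i = g x)) (.nat_eq .snd (hg.comp .fst)) hf.range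

theorem PolyTime.samples {f : α → ℕ} {g : α → List (List (Bool × Bool × Bool))}
    (hf : PolyTime env f) (hg : PolyTime env g) : PolyTime env fun x => samples (f x) (g x) := by
  refine .pair (PolyTime.list_map (f := fun _ w => SCP.coeffSample w) (.coeffSample .snd) hg) ?_
  refine PolyTime.list_map
    (f := fun x j => (g x).map (SCP.weightSample (SCP.maskBits (f x) j))) ?_ hf.range
  exact PolyTime.list_map (δ := α × ℕ)
    (f := fun y w => SCP.weightSample (SCP.maskBits (f y.1) y.2) w)
    (.weightSample (.maskBits (hf.comp PolyTime.id.proj₁.proj₁) PolyTime.id.proj₁.proj₂) .snd)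
    (hg.comp .fst)

theorem PolyTime.extend (b : Bool) {f g : α → List Bool} (hf : PolyTime env f)
    (hg : PolyTime env g) : PolyTime env fun x => extend b (f x) (g x) :=
  PolyTime.list_map (f := fun _ (p : Bool × Bool) => p.1 || (b && p.2))
    (PolyTime.bool_comp₂ (fun c d => c || (b && d)) PolyTime.id.proj₂.proj₁
      PolyTime.id.proj₂.proj₂) (hg.zip hf)

/-- `zip` cuts the result to the length of `e`, so the bound does not involve the candidate `s` and
candidates cannot grow from round to round. -/
theorem sz_extend_le (b : Bool) (e s : List Bool) : sz (extend b e s) ≤ 1 + 4 * sz e := by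
  have h1 : sz (extend b e s) ≤ 1 + (extend b e s).length * (1 + 3) :=
    sz_le_of_forall_mem fun c _ => sz_bool_le c
  have h2 : (extend b e s).length ≤ e.length := by simp [SCP.extend]
  have := length_lt_sz e
  omega

theorem PolyTime.searchStep : PolyTime env fun p : (ℕ × ℕ) × List (List Bool) ×
    (List Bool × List (List Bool × Bool)) => searchStep p.1.1 p.1.2 p.2.1 p.2.2 := by
  refine .take PolyTime.id.proj₁.proj₂ ?_
  refine PolyTime.filter (f := fun (p : (ℕ × ℕ) × List (List Bool) ×
      (List Bool × List (List Bool × Bool))) s =>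
    decide (SCP.negVotes (SCP.votes s p.2.2.2) + p.1.1 ≤ SCP.posVotes (SCP.votes s p.2.2.2))) ?_ ?_
  · have hv : PolyTime env (fun y : ((ℕ × ℕ) × List (List Bool) ×
        (List Bool × List (List Bool × Bool))) × List Bool => SCP.votes y.2 y.1.2.2.2) :=
      .votes .snd PolyTime.id.proj₁.proj₂.proj₂.proj₂
    exact .le (.add hv.negVotes PolyTime.id.proj₁.proj₁.proj₁) hv.posVotes
  · have h : ∀ b, PolyTime env fun p : (ℕ × ℕ) × List (List Bool) ×
        (List Bool × List (List Bool × Bool)) => p.2.1.map (SCP.extend b p.2.2.1) := fun b =>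
      PolyTime.list_map (f := fun (p : (ℕ × ℕ) × List (List Bool) ×
        (List Bool × List (List Bool × Bool))) s => SCP.extend b p.2.2.1 s)
        (.extend b PolyTime.id.proj₁.proj₂.proj₂.proj₁ .snd) PolyTime.id.proj₂.proj₁
    exact (h false).append (h true)

/-- The truncation to `cap` entries makes the size of the new state independent of the old one,
although each round doubles the list before filtering. -/
theorem sz_searchStep_le (thr cap : ℕ) (L : List (List Bool))
    (x : List Bool × List (List Bool × Bool)) :
    sz (searchStep thr cap L x) ≤ 1 + cap * (2 + 4 * sz x.1) := by
  have h1 : sz (searchStep thr cap L x) ≤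
      1 + (searchStep thr cap L x).length * (1 + (1 + 4 * sz x.1)) := by
    refine sz_le_of_forall_mem fun s hs => ?_
    have := List.mem_of_mem_take hs
    rw [List.mem_filter, List.mem_append, List.mem_map, List.mem_map] at this
    obtain ⟨⟨s', -, rfl⟩ | ⟨s', -, rfl⟩, -⟩ := this <;> exact sz_extend_le _ _ _
  have h2 : (searchStep thr cap L x).length ≤ cap := by simp [SCP.searchStep]
  have h3 := Nat.mul_le_mul_right (1 + (1 + 4 * sz x.1)) h2
  rw [show 1 + (1 + 4 * sz x.1) = 2 + 4 * sz x.1 by omega] at h1 h3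
  omega

theorem PolyTime.search {f g h : α → ℕ} {D : α → List (List (List Bool × Bool))}
    (hf : PolyTime env f) (hg : PolyTime env g) (hh : PolyTime env h) (hD : PolyTime env D) :
    PolyTime env fun x => search (f x) (g x) (h x) (D x) := by
  have h1 := PolyTime.foldl_of_add (env := env)
    (f := fun p : (ℕ × ℕ) × List (List Bool) × (List Bool × List (List Bool × Bool)) =>
      SCP.searchStep p.1.1 p.1.2 p.2.1 p.2.2) .searchStep
    (1 + Polynomial.X * (2 + 4 * Polynomial.X)) (by
      rintro ⟨thr, cap⟩ L ⟨e, D⟩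
      refine (sz_searchStep_le thr cap L (e, D)).trans ?_
      simp only [sz_prod, sz_nat, Polynomial.eval_add, Polynomial.eval_one, Polynomial.eval_mul,
        Polynomial.eval_X, Polynomial.eval_ofNat]
      have : cap * (2 + 4 * sz e) ≤ (1 + (2 * thr + 1) + (2 * cap + 1) + (1 + sz e + sz D)) *
          (2 + 4 * (1 + (2 * thr + 1) + (2 * cap + 1) + (1 + sz e + sz D))) :=
        Nat.mul_le_mul (by omega) (by omega)
      omega)
  exact h1.comp ((hg.pair hh).pair ((PolyTime.cons (PolyTime.list_map (f := fun _ _ => false)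
    (.const false) hf.range) (.const [])).pair
    ((PolyTime.list_map (f := fun x j => SCP.unitBits (f x) j) (.unitBits (hf.comp .fst) .snd)
      hf.range).zip hD)))

theorem PolyTime.rawInverse {f : α → List RawGate} (hf : PolyTime env f) :
    PolyTime env fun x => rawInverse (f x) := by
  refine (PolyTime.flatMap (f := fun (_ : α) (g : RawGate) =>
    if decide (g.1 = 1) then [g, g, g, g, g, g, g] else [g])
    (.ite (.nat_eq PolyTime.id.proj₂.proj₁ (.const 1)) ?_ ?_) hf.reverse).congr fun x => ?_
  · iterate 7 refine PolyTime.cons .snd ?_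
    exact .const []
  · exact .cons .snd (.const [])
  · simp [SCP.rawInverse, List.replicate]

theorem PolyTime.rawTestGate {f g : α → ℕ} {C : α → List RawGate} (hf : PolyTime env f)
    (hC : PolyTime env C) (hg : PolyTime env g) :
    PolyTime env fun x => rawTestGate (f x) (C x) (g x) := by
  have hh : PolyTime env fun x => ((0, encNat (f x)) : RawGate) := .pair (.const 0) hf.nat_val
  exact .cons hh (.append hC (.cons (.pair (.const 2) (.cons_val hf.nat_val hg.nat_val))
    (.append hC.rawInverse (.cons hh (.const [])))))

theorem PolyTime.rawTest {f g : α → ℕ} {C : α → List RawGate} {s : α → List Bool}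
    (hf : PolyTime env f) (hg : PolyTime env g) (hC : PolyTime env C) (hs : PolyTime env s) :
    PolyTime env fun x => rawTest (f x) (g x) (C x) (s x) :=
  PolyTime.flatMap (f := fun x (p : Bool × ℕ) => if p.1 then [SCP.rawTestGate (g x) (C x) p.2] else [])
    (.ite PolyTime.id.proj₂.proj₁ (.cons (.rawTestGate (hg.comp .fst) (hC.comp .fst)
      PolyTime.id.proj₂.proj₂) (.const [])) (.const [])) (hs.zip hf.range)

theorem PolyTime.requests {f g : α → ℕ} {C : α → List RawGate} {L : α → List (List Bool)}
    {D : α → List (List Bool × Bool)} (hf : PolyTime env f) (hg : PolyTime env g)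
    (hC : PolyTime env C) (hL : PolyTime env L) (hD : PolyTime env D) :
    PolyTime env fun x => requests (f x) (g x) (C x) (L x) (D x) := by
  refine PolyTime.flatMap (f := fun x s => (SCP.votes s (D x)).map fun w =>
    (w, SCP.rawTest (f x) (g x) (C x) s)) ?_ hL
  refine PolyTime.list_map (δ := α × List Bool)
    (f := fun y w => (w, SCP.rawTest (f y.1) (g y.1) (C y.1) y.2)) (.pair .snd ?_)
    (.votes .snd (hD.comp .fst))
  exact .rawTest (hf.comp PolyTime.id.proj₁.proj₁) (hg.comp PolyTime.id.proj₁.proj₁)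
    (hC.comp PolyTime.id.proj₁.proj₁) PolyTime.id.proj₁.proj₂

theorem PolyTime.combine {f : α → Bool × Bool} {g : α → List Bool}
    (hf : PolyTime env f) (hg : PolyTime env g) : PolyTime env fun x => combine (f x) (g x) := by
  refine .pair hf.proj₁ (PolyTime.bool_comp₂ xor hf.proj₂ ?_)
  refine PolyTime.foldl_add (f := fun _ _ b => b) PolyTime.id.proj₂.proj₂ (.const false) hg
    Polynomial.X ?_
  intro c s a
  simp; omega

end

/-! ### Supports and light cones -/

section
variable {n : ℕ}

/-- Flip the bit at position `k`. -/
def flip (k : Fin n) (x : Bits n) : Bits n := Function.update x k (!x k)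

@[simp] theorem flip_self (k : Fin n) (x : Bits n) : flip k x k = !x k := by simp [flip]

theorem flip_of_ne {k i : Fin n} (h : i ≠ k) (x : Bits n) : flip k x i = x i := by
  simp [flip, Function.update_of_ne h]

theorem flip_flip (k : Fin n) (x : Bits n) : flip k (flip k x) = x := by
  funext i
  by_cases h : i = k
  · subst h; simp
  · rw [flip_of_ne h, flip_of_ne h]

/-- Invariance under a simultaneous flip replaces setting the bit to a value; the flip is an
involution, so sums can be reindexed by it. -/
theorem actsTrivially_iff {U : Op n} {k : Fin n} : ActsTrivially U k ↔
    (∀ x y : Bits n, x k ≠ y k → U x y = 0) ∧ ∀ x y : Bits n, U (flip k x) (flip k y) = U x y := by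
  constructor
  · rintro ⟨h1, h2⟩
    refine ⟨h1, fun x y => ?_⟩
    by_cases h : x k = y k
    · have := h2 x y (!x k) h
      rwa [show Function.update y k (!x k) = flip k y by rw [flip, h]] at this
    · rw [h1 x y h, h1]
      simpa using h
  · rintro ⟨h1, h2⟩
    refine ⟨h1, fun x y b h => ?_⟩
    by_cases hb : b = x k
    · rw [hb, Function.update_eq_self, h, Function.update_eq_self]
    · have hb' : b = !x k := by cases b <;> cases hx : x k <;> simp_all
      have := h2 x y
      rwa [flip, flip, ← h, ← hb'] at this

theorem ActsTrivially.mul {U V : Op n} {k : Fin n} (hU : ActsTrivially U k)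
    (hV : ActsTrivially V k) : ActsTrivially (U * V) k := by
  rw [actsTrivially_iff] at *
  constructor
  · intro x y hxy
    rw [Matrix.mul_apply]
    refine Finset.sum_eq_zero fun z _ => ?_
    by_cases hz : x k = z k
    · rw [hV.1 z y (by rwa [← hz]), mul_zero]
    · rw [hU.1 x z hz, zero_mul]
  · intro x y
    rw [Matrix.mul_apply, Matrix.mul_apply,
      ← Equiv.sum_comp (Function.Involutive.toPerm (flip k) (flip_flip k))]
    refine Finset.sum_congr rfl fun z _ => ?_
    change U (flip k x) (flip k z) * V (flip k z) (flip k y) = _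
    rw [hU.2, hV.2]

theorem ActsTrivially.conjTranspose {U : Op n} {k : Fin n} (hU : ActsTrivially U k) :
    ActsTrivially Uᴴ k := by
  rw [actsTrivially_iff] at *
  exact ⟨fun x y h => by rw [Matrix.conjTranspose_apply, hU.1 _ _ h.symm, star_zero],
    fun x y => by rw [Matrix.conjTranspose_apply, hU.2, Matrix.conjTranspose_apply]⟩

theorem onQubit_actsTrivially {i k : Fin n} (h : k ≠ i) (A : Matrix Bool Bool ℂ) :
    ActsTrivially (onQubit i A) k := by
  rw [actsTrivially_iff]
  constructor
  · intro x y hxy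
    simp only [onQubit, Matrix.of_apply]
    exact if_neg fun h' => hxy (h' k h)
  · intro x y
    simp only [onQubit, Matrix.of_apply]
    rw [flip_of_ne h.symm, flip_of_ne h.symm]
    congr 1
    refine propext (forall_congr' fun l => forall_congr' fun _ => ?_)
    by_cases hl : l = k
    · subst hl; simp
    · rw [flip_of_ne hl, flip_of_ne hl]

theorem diagonal_actsTrivially {k : Fin n} {D : Bits n → ℂ} (h : ∀ x, D (flip k x) = D x) :
    ActsTrivially (Matrix.diagonal D) k := by
  rw [actsTrivially_iff]
  refine ⟨fun x y hxy => Matrix.diagonal_apply_ne _ fun h => hxy (by rw [h]), fun x y => ?_⟩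
  by_cases hxy : x = y
  · subst hxy; simp [h]
  · rw [Matrix.diagonal_apply_ne _ hxy, Matrix.diagonal_apply_ne]
    exact fun h' => hxy (by rw [← flip_flip k x, h', flip_flip])

theorem Gate.actsTrivially (g : Gate n) {k : Fin n} (hk : k ∉ g.qubits) :
    ActsTrivially g.op k := by
  cases g with
  | h i => exact onQubit_actsTrivially (by simpa [Gate.qubits] using hk) _
  | t i => exact onQubit_actsTrivially (by simpa [Gate.qubits] using hk) _
  | cz i j hij =>
    simp only [Gate.qubits, Finset.mem_insert, Finset.mem_singleton, not_or] at hk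
    refine diagonal_actsTrivially fun x => ?_
    rw [flip_of_ne (Ne.symm hk.1), flip_of_ne (Ne.symm hk.2)]

/-- The one-qubit factor leaves two summands, and of these `U` allows only the one in which bit `i`
is unchanged by `U`. The two surviving entries of `U` differ by a common change of bit `i`, hence
agree. -/
theorem ActsTrivially.mul_onQubit {U : Op n} {i : Fin n} (hU : ActsTrivially U i)
    (A : Matrix Bool Bool ℂ) : U * onQubit i A = onQubit i A * U := by
  ext x y
  rw [Matrix.mul_apply, Matrix.mul_apply, sum_onQubit i y, sum_onQubit i x]
  · rw [Finset.sum_eq_single (x i), Finset.sum_eq_single (y i)]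
    · have h1 : ∀ k, k ≠ i → Function.update y i (x i) k = y k := fun k hk => by
        simp [Function.update_of_ne hk]
      have h2 : ∀ k, k ≠ i → x k = Function.update x i (y i) k := fun k hk => by
        simp [Function.update_of_ne hk]
      simp only [onQubit, Matrix.of_apply, if_pos h1, if_pos h2, Function.update_self]
      have h3 := hU.2 x (Function.update y i (x i)) (y i) (by simp)
      rw [Function.update_idem, Function.update_eq_self] at h3
      rw [h3, mul_comm]
    · intro b _ hb
      rw [hU.1 _ _ (by simpa using hb), mul_zero]
    · simp
    · intro b _ hb
      rw [hU.1 _ _ (by simpa using Ne.symm hb), zero_mul]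
    · simp
  · intro z hz
    simp [onQubit, if_neg hz]
  · intro z hz
    have : ¬ ∀ k, k ≠ i → z k = y k := fun h => hz fun k hk => (h k hk).symm
    simp [onQubit, if_neg this]

/-- For CZ, an entry of `U` vanishes unless row and column agree on both qubits of the gate, and
then the two diagonal factors are equal. -/
theorem Gate.mul_comm_of_actsTrivially (g : Gate n) {U : Op n}
    (h : ∀ k ∈ g.qubits, ActsTrivially U k) : U * g.op = g.op * U := by
  cases g with
  | h i => exact (h i (by simp [Gate.qubits])).mul_onQubit _
  | t i => exact (h i (by simp [Gate.qubits])).mul_onQubit _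
  | cz i j hij =>
    have hi := h i (by simp [Gate.qubits])
    have hj := h j (by simp [Gate.qubits])
    ext x y
    simp only [Gate.op, Matrix.mul_diagonal, Matrix.diagonal_mul]
    by_cases h1 : x i = y i
    · by_cases h2 : x j = y j
      · rw [h1, h2, mul_comm]
      · rw [hj.1 x y h2]; simp
    · rw [hi.1 x y h1]; simp

theorem mem_supp {U : Op n} {k : Fin n} : k ∈ supp U ↔ ¬ ActsTrivially U k := by
  simp [supp]

theorem supp_conj_eq (g : Gate n) (U : Op n) (h : Disjoint g.qubits (supp U)) :
    g.opᴴ * U * g.op = U := by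
  rw [mul_assoc, g.mul_comm_of_actsTrivially, ← mul_assoc, g.op_unitary, one_mul]
  intro k hk
  have := Finset.disjoint_left.1 h hk
  rwa [mem_supp, not_not] at this

theorem supp_conj_subset (g : Gate n) (U : Op n) :
    supp (g.opᴴ * U * g.op) ⊆ supp U ∪ g.qubits := by
  intro k hk
  by_contra h
  rw [Finset.mem_union, not_or, mem_supp, not_not] at h
  exact mem_supp.1 hk (((g.actsTrivially h.2).conjTranspose.mul h.1).mul (g.actsTrivially h.2))

theorem Gate.card_qubits_le (g : Gate n) : g.qubits.card ≤ 2 := by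
  cases g with
  | h i => simp [Gate.qubits]
  | t i => simp [Gate.qubits]
  | cz i j hij => exact Finset.card_le_two

/-- The light cone of qubit `j`, with a potential function: `lam i` is at least the first layer in
which qubit `i` is used. -/
theorem exists_light_cone (d : ℕ) (j : Fin n) (C : Circuit n) :
    ∀ layer : Fin C.length → Fin d, (∀ a b : Fin C.length, a < b →
      ¬ Disjoint (C.get a).qubits (C.get b).qubits → layer a < layer b) →
    ∃ (S : Finset (Fin n)) (lam : Fin n → ℕ), supp (C.opᴴ * pauliZ j * C.op) ⊆ S ∧
      ∑ i ∈ S, 2 ^ lam i ≤ 2 ^ d ∧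
      ∀ i b, b ≤ d → (∀ a, i ∈ (C.get a).qubits → b ≤ layer a) → b ≤ lam i := by
  -- The head of the list is applied first, so it conjugates outermost, and the induction follows
  -- the light cone from the end of the circuit back to its beginning. A qubit touched by no gate
  -- may have potential `d`.
  induction C with
  | nil =>
    intro layer _
    refine ⟨{j}, fun _ => d, ?_, by simp, fun _ _ h _ => h⟩
    intro k hk
    rw [mem_supp] at hk
    rw [Finset.mem_singleton]
    by_contra h
    apply hk
    simpa [Circuit.op, pauliZ] using onQubit_actsTrivially h _
  | cons g c ih =>
    intro layer hlayer
    obtain ⟨S, lam, h1, h2, h3⟩ := ih (fun a => layer a.succ) fun a b hab h =>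
      hlayer a.succ b.succ (Fin.succ_lt_succ_iff.2 hab) (by simpa using h)
    set ℓ : ℕ := (layer ⟨0, by simp⟩ : ℕ) with hℓ
    have hℓd : ℓ < d := (layer _).2
    -- All later gates on a qubit of `g` lie in layers strictly after that of `g`.
    have hlam : ∀ i ∈ g.qubits, ℓ + 1 ≤ lam i := by
      intro i hi
      refine h3 i (ℓ + 1) hℓd fun a ha => ?_
      refine hlayer ⟨0, by simp⟩ a.succ (Fin.mk_lt_mk.2 (by simp)) ?_
      exact Finset.not_disjoint_iff.2 ⟨i, by simpa using hi, by simpa using ha⟩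
    have hlow : ∀ i b, b ≤ d → (∀ a, i ∈ ((g :: c).get a).qubits → b ≤ layer a) →
        b ≤ if i ∈ g.qubits then ℓ else lam i := by
      intro i b hb h
      split_ifs with hi
      · exact h ⟨0, by simp⟩ (by simpa using hi)
      · exact h3 i b hb fun a ha => h a.succ (by simpa using ha)
    have hop : Circuit.op (g :: c) = Circuit.op c * g.op := rfl
    have hconj : (Circuit.op (g :: c))ᴴ * pauliZ j * Circuit.op (g :: c) =
        g.opᴴ * ((Circuit.op c)ᴴ * pauliZ j * Circuit.op c) * g.op := by
      rw [hop, Matrix.conjTranspose_mul]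
      simp only [Matrix.mul_assoc]
    by_cases hdis : Disjoint g.qubits S
    · refine ⟨S, _, ?_, ?_, hlow⟩
      · rw [hconj, supp_conj_eq g _ (hdis.mono_right h1)]
        exact h1
      · refine le_of_eq_of_le (Finset.sum_congr rfl fun i hi => ?_) h2
        rw [if_neg (Finset.disjoint_right.1 hdis hi)]
    · refine ⟨S ∪ g.qubits, _, ?_, ?_, hlow⟩
      · rw [hconj]
        exact (supp_conj_subset g _).trans (Finset.union_subset_union_left h1)
      · obtain ⟨i₀, hi₀, hi₀S⟩ := Finset.not_disjoint_iff.1 hdis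
        have e1 : S ∪ g.qubits = S \ g.qubits ∪ g.qubits := by simp
        rw [e1, Finset.sum_union Finset.sdiff_disjoint]
        -- The at most two qubits of `g` get weight `2 ^ ℓ` each; this is paid for by one qubit
        -- already in the cone, whose weight was at least `2 ^ (ℓ + 1)`. So the total weight does
        -- not increase.
        have e2 : ∑ i ∈ g.qubits, 2 ^ (if i ∈ g.qubits then ℓ else lam i) ≤ 2 ^ lam i₀ := by
          calc _ = ∑ i ∈ g.qubits, 2 ^ ℓ := Finset.sum_congr rfl fun i hi => by rw [if_pos hi]
            _ = g.qubits.card * 2 ^ ℓ := by simp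
            _ ≤ 2 * 2 ^ ℓ := Nat.mul_le_mul_right _ g.card_qubits_le
            _ = 2 ^ (ℓ + 1) := by ring
            _ ≤ 2 ^ lam i₀ := Nat.pow_le_pow_right (by norm_num) (hlam i₀ hi₀)
        have e3 : ∑ i ∈ S \ g.qubits, 2 ^ (if i ∈ g.qubits then ℓ else lam i) =
            ∑ i ∈ S \ g.qubits, 2 ^ lam i := Finset.sum_congr rfl fun i hi => by
          rw [if_neg (Finset.mem_sdiff.1 hi).2]
        have e4 : ∑ i ∈ S \ g.qubits, 2 ^ lam i + 2 ^ lam i₀ ≤ ∑ i ∈ S, 2 ^ lam i := by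
          rw [← Finset.sum_sdiff (Finset.inter_subset_left : S ∩ g.qubits ⊆ S),
            Finset.sdiff_inter_self_left]
          refine Nat.add_le_add_left ?_ _
          exact Finset.single_le_sum (f := fun i => 2 ^ lam i) (fun _ _ => Nat.zero_le _)
            (Finset.mem_inter.2 ⟨hi₀S, hi₀⟩)
        omega

theorem maxSupp_le {m d : ℕ} (hmn : m ≤ n) (C : Circuit n) (hC : C.DepthLE d) :
    maxSupp hmn C ≤ 2 ^ d := by
  obtain ⟨layer, hlayer⟩ := hC
  refine Finset.sup_le fun j _ => ?_
  obtain ⟨S, lam, h1, h2, -⟩ := exists_light_cone d (Fin.castLE hmn j) C layer hlayer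
  calc _ ≤ S.card := Finset.card_le_card h1
    _ = ∑ i ∈ S, 1 := by simp
    _ ≤ ∑ i ∈ S, 2 ^ lam i := Finset.sum_le_sum fun i _ => Nat.one_le_two_pow
    _ ≤ 2 ^ d := h2

end

/-! ### Commuting circuits for Fourier characters -/

/-- The character `(-1)^{s·x}`. -/
def chi {m : ℕ} (s x : Bits m) : ℝ := ∏ j, if s j && x j then -1 else 1

/-- `⟨0ⁿ| C† Z_s C |0ⁿ⟩`. -/
def charMean {n m : ℕ} (hmn : m ≤ n) (C : Circuit n) (s : Bits m) : ℝ :=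
  ∑ y, Complex.normSq (C.op y (zeros n)) * chi s fun j => y (Fin.castLE hmn j)

section
variable {n : ℕ}

/-! ### Inverse circuits over H, T, CZ. -/

theorem Circuit.op_append (c c' : Circuit n) :
    Circuit.op (c ++ c') = Circuit.op c' * Circuit.op c := by
  induction c with
  | nil => simp [Circuit.op]
  | cons g c ih => simp only [List.cons_append, Circuit.op, ih, mul_assoc]

/-- The inverse of a gate. -/
def Gate.inverse : Gate n → Circuit n
  | .h i => [.h i]
  | .t i => List.replicate 7 (.t i)
  | .cz i j hij => [.cz i j hij]

/-- The inverse circuit. -/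
def Circuit.inverse (C : Circuit n) : Circuit n := C.reverse.flatMap Gate.inverse

theorem onQubit_conjTranspose (i : Fin n) (A : Matrix Bool Bool ℂ) :
    (onQubit i A)ᴴ = onQubit i Aᴴ := by
  ext x y
  simp only [onQubit, Matrix.conjTranspose_apply, Matrix.of_apply]
  have : (∀ k, k ≠ i → y k = x k) ↔ ∀ k, k ≠ i → x k = y k :=
    forall_congr' fun k => forall_congr' fun _ => eq_comm
  simp only [this]
  split_ifs <;> simp

theorem hMat_conjTranspose : hMatᴴ = hMat := by
  ext a b
  cases a <;> cases b <;> simp [hMat]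

theorem onQubit_tMat (i : Fin n) : onQubit i tMat =
    Matrix.diagonal fun x : Bits n => if x i then Complex.exp (Real.pi * Complex.I / 4) else 1 := by
  ext x y
  by_cases hxy : x = y
  · subst hxy
    simp [onQubit, tMat]
  · rw [Matrix.diagonal_apply_ne _ hxy]
    simp only [onQubit, Matrix.of_apply]
    split_ifs with h
    · refine Matrix.diagonal_apply_ne _ fun hi => hxy ?_
      funext k
      by_cases hk : k = i
      · rw [hk, hi]
      · exact h k hk
    · rfl

theorem t_op_pow (i : Fin n) : (Gate.t i).op ^ 8 = 1 := by
  have h : Complex.exp (Real.pi * Complex.I / 4) ^ 8 = 1 := by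
    rw [← Complex.exp_nat_mul]
    have : ((8 : ℕ) : ℂ) * (Real.pi * Complex.I / 4) = 2 * Real.pi * Complex.I := by
      push_cast; ring
    rw [this, Complex.exp_two_pi_mul_I]
  rw [Gate.op, onQubit_tMat, Matrix.diagonal_pow, ← Matrix.diagonal_one]
  congr 1
  funext x
  simp only [Pi.pow_apply]
  split_ifs
  · exact h
  · simp

theorem Gate.op_inverse (g : Gate n) : Circuit.op g.inverse = g.opᴴ := by
  cases g with
  | h i =>
    simp only [Gate.inverse, Circuit.op, one_mul, Gate.op]
    rw [onQubit_conjTranspose, hMat_conjTranspose]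
  | t i =>
    have h : Circuit.op (Gate.t i).inverse = (Gate.t i).op ^ 7 := by
      simp only [Gate.inverse, List.replicate, Circuit.op, one_mul, pow_succ, pow_zero]
    rw [h]
    calc (Gate.t i).op ^ 7 = (Gate.t i).opᴴ * (Gate.t i).op * (Gate.t i).op ^ 7 := by
          rw [Gate.op_unitary, one_mul]
      _ = (Gate.t i).opᴴ * (Gate.t i).op ^ 8 := by rw [mul_assoc, ← pow_succ']
      _ = (Gate.t i).opᴴ := by rw [t_op_pow, mul_one]
  | cz i j hij =>
    simp only [Gate.inverse, Circuit.op, one_mul, Gate.op]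
    rw [Matrix.diagonal_conjTranspose]
    congr 1
    funext x
    simp only [Pi.star_apply]
    split_ifs <;> simp

theorem Circuit.op_inverse (C : Circuit n) : Circuit.op C.inverse = (Circuit.op C)ᴴ := by
  induction C with
  | nil => simp [Circuit.inverse, Circuit.op]
  | cons g c ih =>
    have : Circuit.inverse (g :: c) = Circuit.inverse c ++ g.inverse := by
      simp [Circuit.inverse]
    rw [this, Circuit.op_append, ih, g.op_inverse, Circuit.op, Matrix.conjTranspose_mul]

/-- The gate on one more qubit. -/
def Gate.lift : Gate n → Gate (n + 1)
  | .h i => .h i.castSucc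
  | .t i => .t i.castSucc
  | .cz i j hij => .cz i.castSucc j.castSucc (by simpa using hij)

/-- The operator that applies `A` or `B` depending on the last qubit. -/
def blk (A B : Op n) : Op (n + 1) :=
  Matrix.of fun x y => if x (Fin.last n) = y (Fin.last n) then
    (if x (Fin.last n) then B (Fin.init x) (Fin.init y) else A (Fin.init x) (Fin.init y)) else 0

/-! ### Operators that are block diagonal with respect to an added last qubit. -/

theorem sum_bits_succ {M : Type*} [AddCommMonoid M] (F : Bits (n + 1) → M) :
    ∑ z, F z = ∑ b : Bool, ∑ x : Bits n, F (Fin.snoc (α := fun _ => Bool) x b) := by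
  rw [← Fintype.sum_prod_type', ← (Fin.snocEquiv fun _ : Fin (n + 1) => Bool).sum_comp]
  rfl

theorem bits_ext_init {x y : Bits (n + 1)} (h1 : x (Fin.last n) = y (Fin.last n))
    (h2 : (Fin.init x : Bits n) = Fin.init y) : x = y := by
  rw [← Fin.snoc_init_self x, ← Fin.snoc_init_self y, h1, h2]

theorem blk_mul (A B A' B' : Op n) : blk A B * blk A' B' = blk (A * A') (B * B') := by
  ext x y
  rw [Matrix.mul_apply, sum_bits_succ, Fintype.sum_bool]
  simp only [blk, Matrix.of_apply, Fin.snoc_last, Fin.init_snoc, Matrix.mul_apply]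
  cases hx : x (Fin.last n) <;> cases hy : y (Fin.last n) <;> simp

theorem blk_one : blk (1 : Op n) 1 = 1 := by
  ext x y
  simp only [blk, Matrix.of_apply, ite_self]
  by_cases h : x = y
  · subst h; simp
  · rw [Matrix.one_apply_ne h]
    split_ifs with h1
    · exact Matrix.one_apply_ne fun h2 => h (bits_ext_init h1 h2)
    · rfl

theorem blk_conjTranspose (A B : Op n) : (blk A B)ᴴ = blk Aᴴ Bᴴ := by
  ext x y
  simp only [blk, Matrix.of_apply, Matrix.conjTranspose_apply]
  cases hx : x (Fin.last n) <;> cases hy : y (Fin.last n) <;> simp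

theorem blk_diagonal (D D' : Bits n → ℂ) :
    blk (Matrix.diagonal D) (Matrix.diagonal D') = Matrix.diagonal fun x : Bits (n + 1) =>
      if x (Fin.last n) then D' (Fin.init x) else D (Fin.init x) := by
  ext x y
  by_cases h : x = y
  · subst h; simp [blk]
  · rw [Matrix.diagonal_apply_ne _ h]
    simp only [blk, Matrix.of_apply]
    by_cases h1 : x (Fin.last n) = y (Fin.last n)
    · have h2 : (Fin.init x : Bits n) ≠ Fin.init y := fun h2 => h (bits_ext_init h1 h2)
      simp [Matrix.diagonal_apply_ne _ h2]
    · rw [if_neg h1]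

theorem onQubit_castSucc (i : Fin n) (A : Matrix Bool Bool ℂ) :
    onQubit i.castSucc A = blk (onQubit i A) (onQubit i A) := by
  ext x y
  simp only [onQubit, blk, Matrix.of_apply, ite_self]
  have h : (∀ k, k ≠ i.castSucc → x k = y k) ↔
      x (Fin.last n) = y (Fin.last n) ∧ ∀ k, k ≠ i → (Fin.init x : Bits n) k = Fin.init y k := by
    constructor
    · exact fun h => ⟨h _ (Fin.castSucc_lt_last i).ne', fun k hk => h _ (by simpa using hk)⟩
    · rintro ⟨h1, h2⟩ k
      refine Fin.lastCases (fun _ => h1) (fun k hk => h2 k (by simpa using hk)) k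
  by_cases h1 : x (Fin.last n) = y (Fin.last n)
  · rw [if_pos h1]
    by_cases h2 : ∀ k, k ≠ i → (Fin.init x : Bits n) k = Fin.init y k
    · rw [if_pos (h.2 ⟨h1, h2⟩), if_pos h2]; rfl
    · rw [if_neg fun h3 => h2 (h.1 h3).2, if_neg h2]
  · rw [if_neg h1, if_neg fun h3 => h1 (h.1 h3).1]

theorem Gate.op_lift (g : Gate n) : g.lift.op = blk g.op g.op := by
  cases g with
  | h i => exact onQubit_castSucc i _
  | t i => exact onQubit_castSucc i _
  | cz i j hij =>
    simp only [Gate.lift, Gate.op, blk_diagonal, ite_self]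
    rfl

/-- The circuit on one more qubit. -/
def Circuit.lift (C : Circuit n) : Circuit (n + 1) := C.map Gate.lift

theorem Circuit.op_lift (C : Circuit n) : Circuit.op C.lift = blk (Circuit.op C) (Circuit.op C) := by
  induction C with
  | nil => simp [Circuit.lift, Circuit.op, blk_one]
  | cons g c ih =>
    have : Circuit.lift (g :: c) = g.lift :: Circuit.lift c := rfl
    rw [this, Circuit.op, ih, g.op_lift, blk_mul, Circuit.op]

/-- The gate `H C† CZ C H` with `H` on the last qubit and `CZ` on the last qubit and `j`. -/
def testGate (C : Circuit n) (j : Fin n) : Circuit (n + 1) :=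
  .h (Fin.last n) :: (C.lift ++ .cz (Fin.last n) j.castSucc (Fin.castSucc_lt_last j).ne' ::
    (Circuit.inverse C.lift ++ [.h (Fin.last n)]))

/-- The Hadamard gate on the last qubit. -/
def lastH (n : ℕ) : Op (n + 1) := onQubit (Fin.last n) hMat

theorem lastH_mul_lastH : lastH n * lastH n = 1 := by
  have := onQubit_unitary (Fin.last n) hMat hMat_unitary
  rwa [onQubit_conjTranspose, hMat_conjTranspose] at this

theorem pauliZ_eq_diagonal (j : Fin n) :
    (pauliZ j : Op n) = Matrix.diagonal fun x => if x j then -1 else 1 := by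
  ext x y
  by_cases hxy : x = y
  · subst hxy; simp [pauliZ, onQubit]
  · rw [Matrix.diagonal_apply_ne _ hxy]
    simp only [pauliZ, onQubit, Matrix.of_apply]
    split_ifs with h
    · refine Matrix.diagonal_apply_ne _ fun hi => hxy ?_
      funext k
      by_cases hk : k = j
      · rw [hk, hi]
      · exact h k hk
    · rfl

theorem cz_last (j : Fin n) (h : Fin.last n ≠ j.castSucc) :
    (Gate.cz (Fin.last n) j.castSucc h).op = blk 1 (pauliZ j) := by
  rw [pauliZ_eq_diagonal, ← Matrix.diagonal_one, blk_diagonal, Gate.op]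
  congr 1
  funext x
  cases hx : x (Fin.last n)
  · simp
  · simp only [Bool.true_and, if_true]; rfl

/-- Only Z is controlled by the ancilla; `C` and its inverse are applied unconditionally and cancel
in the other branch. So no controlled version of `C` is needed. -/
theorem testGate_op (C : Circuit n) (j : Fin n) : Circuit.op (testGate C j) =
    lastH n * blk 1 ((Circuit.op C)ᴴ * pauliZ j * Circuit.op C) * lastH n := by
  have h : (Gate.h (Fin.last n)).op = lastH n := rfl
  simp only [testGate, Circuit.op, Circuit.op_append, Circuit.op_inverse, Circuit.op_lift, one_mul,
    h, cz_last, blk_conjTranspose, mul_assoc]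
  rw [← mul_assoc (blk 1 (pauliZ j)), blk_mul, ← mul_assoc (blk _ _) (blk _ _), blk_mul]
  simp only [one_mul, Circuit.op_unitary]

/-- The Hadamards act on the ancilla only, and both blocks, the identity and C†Z_jC, are trivial on
qubit `k`. -/
theorem testGate_actsTrivially (C : Circuit n) (j k : Fin n)
    (h : ActsTrivially ((Circuit.op C)ᴴ * pauliZ j * Circuit.op C) k) :
    ActsTrivially (Circuit.op (testGate C j)) k.castSucc := by
  have hH : ActsTrivially (lastH n) k.castSucc :=
    onQubit_actsTrivially (Fin.castSucc_lt_last k).ne _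
  rw [testGate_op]
  refine (hH.mul ?_).mul hH
  generalize (Circuit.op C)ᴴ * pauliZ j * Circuit.op C = U at h
  rw [actsTrivially_iff] at h ⊢
  have hlast : ∀ x : Bits (n + 1), flip k.castSucc x (Fin.last n) = x (Fin.last n) := fun x =>
    flip_of_ne (Fin.castSucc_lt_last k).ne' x
  have hflip : ∀ x : Bits (n + 1), (Fin.init (flip k.castSucc x) : Bits n) =
      flip k (Fin.init x) := by
    intro x
    funext i
    by_cases hi : i = k
    · subst hi; simp [Fin.init]
    · rw [flip_of_ne hi]
      exact flip_of_ne (by simpa using hi) x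
  have h1 : ∀ x y : Bits n, (1 : Op n) (flip k x) (flip k y) = (1 : Op n) x y := by
    intro x y
    by_cases hxy : x = y
    · subst hxy; simp
    · rw [Matrix.one_apply_ne hxy, Matrix.one_apply_ne]
      exact fun h' => hxy (by rw [← flip_flip k x, h', flip_flip])
  constructor
  · intro x y hxy
    simp only [blk, Matrix.of_apply]
    rw [h.1 (Fin.init x) (Fin.init y) hxy,
      Matrix.one_apply_ne fun h' => hxy (congrFun h' k)]
    simp
  · intro x y
    simp only [blk, Matrix.of_apply, hlast]
    rw [hflip, hflip, h.2, h1]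

theorem card_supp_testGate_le (C : Circuit n) (j : Fin n) :
    (supp (Circuit.op (testGate C j))).card ≤
      1 + (supp ((Circuit.op C)ᴴ * pauliZ j * Circuit.op C)).card := by
  classical
  have : supp (Circuit.op (testGate C j)) ⊆
      insert (Fin.last n) ((supp ((Circuit.op C)ᴴ * pauliZ j * Circuit.op C)).map
        Fin.castSuccEmb) := by
    intro k
    refine Fin.lastCases (by simp) (fun k hk => ?_) k
    refine Finset.mem_insert_of_mem (Finset.mem_map.2 ⟨k, ?_, rfl⟩)
    exact mem_supp.2 fun h => mem_supp.1 hk (testGate_actsTrivially C j k h)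
  refine (Finset.card_le_card this).trans ((Finset.card_insert_le _ _).trans ?_)
  rw [Finset.card_map]; omega

theorem Circuit.op_unitary' (C : Circuit n) : Circuit.op C * (Circuit.op C)ᴴ = 1 :=
  mul_eq_one_comm.1 C.op_unitary

theorem conj_mul_conj (C : Circuit n) (A B : Op n) :
    ((Circuit.op C)ᴴ * A * Circuit.op C) * ((Circuit.op C)ᴴ * B * Circuit.op C) =
      (Circuit.op C)ᴴ * (A * B) * Circuit.op C := by
  calc _ = (Circuit.op C)ᴴ * A * (Circuit.op C * (Circuit.op C)ᴴ) * B * Circuit.op C := by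
        simp only [mul_assoc]
    _ = _ := by rw [C.op_unitary', mul_one]; simp only [mul_assoc]

/-- The two inner Hadamards cancel: successive tests sharing an ancilla form a single test of the
product. -/
theorem test_mul_test (U V : Op n) :
    (lastH n * blk 1 U * lastH n) * (lastH n * blk 1 V * lastH n) =
      lastH n * blk 1 (U * V) * lastH n := by
  calc _ = lastH n * blk 1 U * (lastH n * lastH n) * blk 1 V * lastH n := by
        simp only [mul_assoc]
    _ = lastH n * (blk 1 U * blk 1 V) * lastH n := by
        rw [lastH_mul_lastH, mul_one]; simp only [mul_assoc]
    _ = _ := by rw [blk_mul, one_mul]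

/-- The product of two test gates is the test of a conjugated product of Pauli Z operators, and
these are diagonal. -/
theorem testGate_commute (C : Circuit n) (i j : Fin n) :
    Commute (Circuit.op (testGate C i)) (Circuit.op (testGate C j)) := by
  unfold Commute SemiconjBy
  rw [testGate_op, testGate_op, test_mul_test, test_mul_test, conj_mul_conj, conj_mul_conj,
    pauliZ_eq_diagonal, pauliZ_eq_diagonal, Matrix.diagonal_mul_diagonal,
    Matrix.diagonal_mul_diagonal]
  simp only [mul_comm]

theorem op_flatten_testGate (C : Circuit n) (J : List (Fin n)) :
    Circuit.op (J.map (testGate C)).flatten = lastH n * blk 1 ((Circuit.op C)ᴴ *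
      (Matrix.diagonal fun x : Bits n => (J.map fun j => if x j then (-1 : ℂ) else 1).prod) *
        Circuit.op C) * lastH n := by
  induction J with
  | nil =>
    have h1 : (Matrix.diagonal fun _ : Bits n => (1 : ℂ)) = 1 := Matrix.diagonal_one
    simp only [List.map_nil, List.flatten_nil, List.prod_nil, Circuit.op, h1, mul_one,
      Circuit.op_unitary, blk_one, lastH_mul_lastH]
  | cons j J ih =>
    rw [List.map_cons, List.flatten_cons, Circuit.op_append, ih, testGate_op, test_mul_test,
      conj_mul_conj, pauliZ_eq_diagonal, Matrix.diagonal_mul_diagonal]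
    simp only [List.map_cons, List.prod_cons, mul_comm]

/-- The amplitudes at the end of a Hadamard test. -/
theorem test_amplitude (U : Op n) (x : Bits n) (b : Bool) :
    (lastH n * blk 1 U * lastH n) (Fin.snoc (α := fun _ => Bool) x b) (zeros (n + 1)) =
      ((1 : Op n) x (zeros n) + (if b then -1 else 1) * U x (zeros n)) / 2 := by
  have h2 : ((Real.sqrt 2 : ℝ) : ℂ)⁻¹ * ((Real.sqrt 2 : ℝ) : ℂ)⁻¹ = 1 / 2 := by
    rw [← mul_inv, ← Complex.ofReal_mul, Real.mul_self_sqrt (by norm_num)]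
    norm_num
  have hz : zeros (n + 1) = Fin.snoc (α := fun _ => Bool) (zeros n) false := by
    funext k
    refine Fin.lastCases (by simp [zeros]) (fun k => by simp [zeros]) k
  have hH : ∀ (z z' : Bits n) (c c' : Bool), lastH n (Fin.snoc (α := fun _ => Bool) z c)
      (Fin.snoc (α := fun _ => Bool) z' c') = if z = z' then hMat c c' else 0 := by
    intro z z' c c'
    simp only [lastH, onQubit, Matrix.of_apply, Fin.snoc_last]
    congr 1
    refine propext ⟨fun h => ?_, ?_⟩
    · funext k
      simpa using h k.castSucc (Fin.castSucc_lt_last k).ne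
    · rintro rfl k
      refine Fin.lastCases (by simp) (fun k _ => by simp) k
  have hcol : ∀ (z : Bits n) (c : Bool), (blk 1 U * lastH n) (Fin.snoc (α := fun _ => Bool) z c)
      (zeros (n + 1)) = (if c then U z (zeros n) else (1 : Op n) z (zeros n)) *
        ((Real.sqrt 2 : ℝ) : ℂ)⁻¹ := by
    intro z c
    rw [Matrix.mul_apply, sum_bits_succ, Fintype.sum_bool]
    simp only [hz, hH, blk, Matrix.of_apply, Fin.snoc_last, Fin.init_snoc]
    cases c
    · simp [hMat]
      rw [Fin.init_snoc, Fin.init_snoc]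
    · simp [hMat]
  rw [mul_assoc, Matrix.mul_apply, sum_bits_succ, Fintype.sum_bool]
  simp only [hcol, hH]
  simp only [ite_mul, zero_mul, Finset.sum_ite_eq, Finset.mem_univ, if_true, Bool.false_eq_true,
    if_false]
  cases b
  · simp only [hMat, Matrix.of_apply, Bool.false_and, Bool.false_eq_true, if_false, mul_one, one_mul]
    linear_combination (U x (zeros n) + (1 : Op n) x (zeros n)) * h2
  · simp only [hMat, Matrix.of_apply, Bool.true_and, Bool.false_eq_true, if_false, if_true, mul_one,
      Bool.and_self]
    linear_combination ((1 : Op n) x (zeros n) - U x (zeros n)) * h2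

/-- For a first register x different from zero, the two ancilla outcomes both have probability
|U_{x0}|²/4 and cancel. For x = 0, with u = U_{00}, the difference is |1+u|²/4 - |1-u|²/4 = Re u.
Hence the ancilla alone carries the information. -/
theorem test_bias (U : Op n) :
    ∑ y : Bits (n + 1), Complex.normSq ((lastH n * blk 1 U * lastH n) y (zeros (n + 1))) *
      (if y (Fin.last n) then -1 else 1) = (U (zeros n) (zeros n)).re := by
  rw [sum_bits_succ, Fintype.sum_bool, ← Finset.sum_add_distrib,
    Finset.sum_eq_single (zeros n)]
  · simp only [test_amplitude, Fin.snoc_last, Complex.normSq_apply]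
    simp
    ring
  · intro x _ hx
    simp only [test_amplitude, Fin.snoc_last, Matrix.one_apply_ne hx, Complex.normSq_apply]
    simp
    ring
  · simp

end

/-! ### The test circuit of a character: its shape and the mean of its outcome. -/

section
variable {n m : ℕ}

/-- The commuting circuit for the character `s`. -/
def testCircuit (hmn : m ≤ n) (C : Circuit n) (s : Bits m) : GateList (n + 1) :=
  (((List.finRange m).filter fun j => s j).map (Fin.castLE hmn)).map (testGate C)

/-- There is one test gate for each j with s_j = 1, and the ancilla contributes the summand 1 to the
support. -/
theorem testCircuit_isCommuting (hmn : m ≤ n) (C : Circuit n) (s : Bits m) :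
    (testCircuit hmn C s).IsCommuting (∑ j, (s j).toNat) (1 + maxSupp hmn C) := by
  refine ⟨?_, ?_, ?_⟩
  · simp only [testCircuit, List.length_map]
    rw [← List.countP_eq_length_filter]
    apply le_of_eq
    rw [Fin.sum_univ_def]
    generalize List.finRange m = l
    induction l with
    | nil => rfl
    | cons j l ih =>
      rw [List.countP_cons, ih, List.map_cons, List.sum_cons, Nat.add_comm]
      cases s j <;> rfl
  · unfold testCircuit
    rw [List.pairwise_map]
    exact List.pairwise_of_forall fun i j => testGate_commute C i j
  · intro U hU
    simp only [testCircuit, List.mem_map] at hU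
    obtain ⟨_, ⟨j, -, rfl⟩, rfl⟩ := hU
    refine (card_supp_testGate_le C _).trans (Nat.add_le_add_left ?_ 1)
    exact Finset.le_sup (f := fun j : Fin m =>
      (supp (C.opᴴ * pauliZ (Fin.castLE hmn j) * C.op)).card) (Finset.mem_univ j)

theorem measure_toReal (C : Circuit n) (y : Bits n) :
    (measure C y).toReal = Complex.normSq (C.op y (zeros n)) := by
  simp only [measure, PMF.ofFintype_apply]
  exact ENNReal.toReal_ofReal (Complex.normSq_nonneg _)

/-- The whole circuit is one Hadamard test of C†Z_sC, so `test_bias` applies; expanding the diagonal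
entry over the outcomes of `C` turns it into the Born average of the character. -/
theorem testCircuit_mean (hmn : m ≤ n) (C : Circuit n) (s : Bits m) :
    ∑ y, (measure (testCircuit hmn C s).flatten y).toReal *
      (if y (Fin.last n) then -1 else 1) = charMean hmn C s := by
  simp only [measure_toReal, testCircuit, op_flatten_testGate]
  rw [test_bias, Matrix.mul_apply, Complex.re_sum]
  refine Finset.sum_congr rfl fun y _ => ?_
  rw [Matrix.mul_diagonal, Matrix.conjTranspose_apply, List.map_map]
  have h1 : ((((List.finRange m).filter fun j => s j).map
      ((fun j => if y j then (-1 : ℂ) else 1) ∘ Fin.castLE hmn)).prod) =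
      ((chi s fun j => y (Fin.castLE hmn j) : ℝ) : ℂ) := by
    rw [chi, Complex.ofReal_prod, ← List.prod_ofFn, List.ofFn_eq_map]
    generalize List.finRange m = l
    induction l with
    | nil => simp
    | cons j l ih =>
      rw [List.filter_cons]
      cases hj : s j <;> simp [ih, hj]
      split_ifs <;> simp
  rw [h1, mul_right_comm, Complex.star_def, ← Complex.normSq_eq_conj_mul_self,
    ← Complex.ofReal_mul, Complex.ofReal_re]

end

/-! ### Fourier expansion -/

section
variable {m : ℕ}

/-- The sign `(-1)^{ab}`. -/
def sgn (a b : Bool) : ℝ := if a && b then -1 else 1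

/-- The values of a Boolean function as real numbers. -/
def realVal (f : Bits m → Bool) (x : Bits m) : ℝ := if f x then 1 else 0

theorem chi_eq_prod_sgn (s x : Bits m) : chi s x = ∏ j, sgn (s j) (x j) := rfl

theorem abs_chi (s x : Bits m) : |chi s x| = 1 := by
  rw [chi, Finset.abs_prod]
  exact Finset.prod_eq_one fun j _ => by split_ifs <;> simp

theorem fourier_eq (f : Bits m → Bool) (s : Bits m) :
    fourier f s = (1 / 2 ^ m) * ∑ x, realVal f x * chi s x := by
  unfold fourier
  congr 1
  refine Finset.sum_congr rfl fun x _ => ?_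
  unfold realVal
  congr 1
  rw [← Finset.prod_pow_eq_pow_sum, chi]
  exact Finset.prod_congr rfl fun j _ => by cases s j && x j <;> simp

theorem prod_ite_eq {ι : Type*} [Fintype ι] (p : ι → Prop) [DecidablePred p] [Decidable (∀ i, p i)] :
    (∏ i, if p i then (1 : ℝ) else 0) = if ∀ i, p i then 1 else 0 := by
  rw [Finset.prod_ite_zero]
  simp

/-- Fourier inversion: the sum of χ_s(y)χ_s(x) over s factorizes over the positions, each factor
being 2 or 0. -/
theorem realVal_eq_sum (f : Bits m → Bool) (x : Bits m) :
    realVal f x = ∑ s, fourier f s * chi s x := by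
  simp only [fourier_eq, mul_assoc, Finset.mul_sum, Finset.sum_mul]
  rw [Finset.sum_comm]
  have key : ∀ y : Bits m, ∑ s : Bits m, (1 / 2 ^ m : ℝ) * (realVal f y * (chi s y * chi s x)) =
      if y = x then realVal f y else 0 := by
    intro y
    have h1 : ∑ s : Bits m, chi s y * chi s x =
        ∏ j, ∑ b : Bool, sgn b (y j) * sgn b (x j) := by
      rw [Finset.prod_univ_sum, Fintype.piFinset_univ]
      simp only [chi_eq_prod_sgn, Finset.prod_mul_distrib]
    have h2 : ∀ j, ∑ b : Bool, sgn b (y j) * sgn b (x j) =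
        2 * if y j = x j then 1 else 0 := by
      intro j
      rw [Fintype.sum_bool]
      cases y j <;> cases x j <;> simp [sgn] <;> norm_num
    rw [← Finset.mul_sum, ← Finset.mul_sum, h1]
    simp only [h2]
    rw [Finset.prod_mul_distrib, prod_ite_eq]
    simp only [← funext_iff, Finset.prod_const, Finset.card_univ, Fintype.card_fin]
    split_ifs
    · field_simp
    · simp
  rw [Finset.sum_congr rfl fun y _ => key y]
  simp

/-- The inputs drawn for one sample. -/
abbrev Draw (m : ℕ) : Type := Fin m → Bool × Bool × Bool

/-! ### Sample means equal to Fourier coefficients and to weights of prefixes. -/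

theorem sum_draw_prod (φ : Fin m → Bool × Bool × Bool → ℝ) :
    ∑ w : Draw m, ∏ i, φ i (w i) = ∏ i, ∑ t, φ i t := by
  rw [Finset.prod_univ_sum, Fintype.piFinset_univ]

theorem sum_triple (φ : Bool × Bool × Bool → ℝ) : ∑ t, φ t =
    φ (true, true, true) + φ (true, true, false) + φ (true, false, true) +
    φ (true, false, false) + φ (false, true, true) + φ (false, true, false) +
    φ (false, false, true) + φ (false, false, false) := by
  simp only [Fintype.sum_prod_type, Fintype.sum_bool]
  ring

/-- The mean of the samples for a Fourier coefficient. -/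
theorem coeff_mean (f : Bits m → Bool) (s : Bits m) :
    ∑ w : Draw m, (1 / 8 ^ m : ℝ) * (realVal f (fun i => (w i).1) * chi s fun i => (w i).1) =
      fourier f s := by
  have key : ∀ t : Bits m, ∑ w : Draw m, (1 / 8 ^ m : ℝ) *
      ((chi t fun i => (w i).1) * chi s fun i => (w i).1) = if t = s then 1 else 0 := by
    intro t
    simp only [chi_eq_prod_sgn, ← Finset.prod_mul_distrib]
    rw [← Finset.mul_sum, sum_draw_prod fun i u => sgn (t i) u.1 * sgn (s i) u.1]
    have h2 : ∀ j, ∑ u : Bool × Bool × Bool, sgn (t j) u.1 * sgn (s j) u.1 =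
        8 * if t j = s j then 1 else 0 := by
      intro j
      rw [sum_triple]
      cases t j <;> cases s j <;> simp [sgn] <;> norm_num
    simp only [h2]
    rw [Finset.prod_mul_distrib, prod_ite_eq]
    simp only [← funext_iff, Finset.prod_const, Finset.card_univ, Fintype.card_fin]
    split_ifs
    · field_simp
    · simp
  simp only [realVal_eq_sum, Finset.sum_mul, Finset.mul_sum]
  rw [Finset.sum_comm]
  have : ∀ t : Bits m, ∑ w : Draw m, (1 / 8 ^ m : ℝ) *
      (fourier f t * (chi t fun i => (w i).1) * chi s fun i => (w i).1) =
      fourier f t * if t = s then 1 else 0 := by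
    intro t
    rw [← key t, Finset.mul_sum]
    exact Finset.sum_congr rfl fun w _ => by ring
  simp only [this]
  simp

/-- The coordinates of the first string at positions in `mask`, the others of the third. -/
def mixFst (mask : Bits m) (w : Draw m) : Bits m := fun i => if mask i then (w i).1 else (w i).2.2

/-- The coordinates of the second string at positions in `mask`, the others of the third. -/
def mixSnd (mask : Bits m) (w : Draw m) : Bits m :=
  fun i => if mask i then (w i).2.1 else (w i).2.2

/-- The sum of the squares of the Fourier coefficients that agree with `a` on `mask`. -/
def weight (f : Bits m → Bool) (mask a : Bits m) : ℝ :=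
  ∑ s, if ∀ i, (s i && mask i) = a i then fourier f s ^ 2 else 0

/-- The mean of the samples for the weight. -/
theorem weight_mean (f : Bits m → Bool) (mask a : Bits m) (ha : ∀ i, mask i = false → a i = false) :
    ∑ w : Draw m, (1 / 8 ^ m : ℝ) * ((realVal f (mixFst mask w) * realVal f (mixSnd mask w)) *
      chi a fun i => xor (w i).1 (w i).2.1) = weight f mask a := by
  -- The average factorizes over positions. On the mask the two strings are independent, which
  -- forces s_i = a_i and t_i = a_i; off the mask both read the same bit, which forces s_i = t_i,
  -- while a_i = 0 removes the sign.
  have key : ∀ s t : Bits m, ∑ w : Draw m, (1 / 8 ^ m : ℝ) *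
      ((chi s (mixFst mask w) * chi t (mixSnd mask w)) * chi a fun i => xor (w i).1 (w i).2.1) =
      if t = s ∧ ∀ i, (s i && mask i) = a i then 1 else 0 := by
    intro s t
    simp only [chi_eq_prod_sgn, ← Finset.prod_mul_distrib, mixFst, mixSnd]
    rw [← Finset.mul_sum, sum_draw_prod fun i u =>
      sgn (s i) (if mask i then u.1 else u.2.2) * sgn (t i) (if mask i then u.2.1 else u.2.2) *
        sgn (a i) (xor u.1 u.2.1)]
    have h2 : ∀ j, ∑ u : Bool × Bool × Bool, sgn (s j) (if mask j then u.1 else u.2.2) *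
        sgn (t j) (if mask j then u.2.1 else u.2.2) * sgn (a j) (xor u.1 u.2.1) =
        8 * if t j = s j ∧ (s j && mask j) = a j then 1 else 0 := by
      intro j
      have := ha j
      rw [sum_triple]
      cases hm : mask j
      · rw [this hm]
        cases t j <;> cases s j <;> simp [sgn] <;> norm_num
      · cases t j <;> cases s j <;> cases a j <;> simp [sgn] <;> norm_num
    simp only [h2]
    rw [Finset.prod_mul_distrib, prod_ite_eq]
    simp only [forall_and, ← funext_iff, Finset.prod_const, Finset.card_univ, Fintype.card_fin]
    split_ifs
    · field_simp
    · simp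
  have expand : ∀ w : Draw m, (1 / 8 ^ m : ℝ) * ((realVal f (mixFst mask w) *
      realVal f (mixSnd mask w)) * chi a fun i => xor (w i).1 (w i).2.1) =
      ∑ s, ∑ t, fourier f s * fourier f t * ((1 / 8 ^ m : ℝ) * ((chi s (mixFst mask w) *
        chi t (mixSnd mask w)) * chi a fun i => xor (w i).1 (w i).2.1)) := by
    intro w
    rw [realVal_eq_sum, realVal_eq_sum, Finset.sum_mul_sum, Finset.sum_mul, Finset.mul_sum]
    refine Finset.sum_congr rfl fun s _ => ?_
    rw [Finset.sum_mul, Finset.mul_sum]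
    exact Finset.sum_congr rfl fun t _ => by ring
  simp only [expand]
  rw [Finset.sum_comm, weight]
  refine Finset.sum_congr rfl fun s _ => ?_
  rw [Finset.sum_comm]
  simp only [← Finset.mul_sum, key]
  rw [Finset.sum_eq_single s]
  · simp only [true_and]
    split_ifs <;> simp [sq]
  · intro t _ ht
    simp [ht]
  · simp

theorem weight_nonneg_term (f : Bits m → Bool) (mask a s : Bits m)
    (hs : ∀ i, (s i && mask i) = a i) : fourier f s ^ 2 ≤ weight f mask a := by
  have := Finset.single_le_sum (f := fun s => if ∀ i, (s i && mask i) = a i then fourier f s ^ 2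
    else 0) (s := Finset.univ) (fun t _ => by split_ifs <;> positivity)
    (Finset.mem_univ s)
  rwa [if_pos hs] at this

theorem exists_of_weight_pos {f : Bits m → Bool} {mask a : Bits m} (h : 0 < weight f mask a) :
    ∃ s ∈ spectrum f, ∀ i, (s i && mask i) = a i := by
  obtain ⟨s, -, hs⟩ := Finset.exists_ne_zero_of_sum_ne_zero h.ne'
  by_cases h1 : ∀ i, (s i && mask i) = a i
  · rw [if_pos h1] at hs
    refine ⟨s, ?_, h1⟩
    simp only [spectrum, Finset.mem_filter, Finset.mem_univ, true_and]
    exact fun h2 => hs (by rw [h2]; simp)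
  · exact absurd (if_neg h1) hs

theorem realVal_nonneg (f : Bits m → Bool) (x : Bits m) : 0 ≤ realVal f x := by
  unfold realVal; split_ifs <;> norm_num

theorem acceptProb_eq {n : ℕ} (hmn : m ≤ n) (C : Circuit n) (f : Bits m → Bool) :
    acceptProb hmn C f = ∑ y, Complex.normSq (C.op y (zeros n)) *
      realVal f fun j => y (Fin.castLE hmn j) := by
  have h : ∀ x, outcomeProb hmn C x = ∑ y, if x = (fun j => y (Fin.castLE hmn j)) then
      Complex.normSq (C.op y (zeros n)) else 0 := by
    intro x
    rw [outcomeProb, Matrix.mul_apply, Complex.re_sum]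
    refine Finset.sum_congr rfl fun y _ => ?_
    rw [outcomeProj, Matrix.mul_diagonal, Matrix.conjTranspose_apply]
    have h1 : (∀ j : Fin m, y (Fin.castLE hmn j) = x j) ↔ x = fun j => y (Fin.castLE hmn j) :=
      ⟨fun h => funext fun j => (h j).symm, fun h j => (congrFun h j).symm⟩
    simp only [h1]
    split_ifs
    · rw [mul_one, Complex.star_def, ← Complex.normSq_eq_conj_mul_self, Complex.ofReal_re]
    · simp
  simp only [acceptProb, h, Finset.mul_sum]
  rw [Finset.sum_comm]
  refine Finset.sum_congr rfl fun y _ => ?_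
  simp [realVal, mul_comm]

theorem acceptProb_nonneg {n : ℕ} (hmn : m ≤ n) (C : Circuit n) (f : Bits m → Bool) :
    0 ≤ acceptProb hmn C f := by
  rw [acceptProb_eq]
  exact Finset.sum_nonneg fun y _ => mul_nonneg (Complex.normSq_nonneg _) (realVal_nonneg _ _)

theorem acceptProb_eq_sum_fourier {n : ℕ} (hmn : m ≤ n) (C : Circuit n) (f : Bits m → Bool) :
    acceptProb hmn C f = ∑ s, fourier f s * charMean hmn C s := by
  rw [acceptProb_eq]
  simp only [realVal_eq_sum, charMean, Finset.mul_sum]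
  rw [Finset.sum_comm]
  exact Finset.sum_congr rfl fun s _ => Finset.sum_congr rfl fun y _ => by ring

theorem sum_normSq {n : ℕ} (C : Circuit n) :
    ∑ y, Complex.normSq (C.op y (zeros n)) = 1 := by
  have := born_sum C
  rw [← ENNReal.ofReal_sum_of_nonneg fun _ _ => Complex.normSq_nonneg _,
    ENNReal.ofReal_eq_one] at this
  exact this

theorem abs_charMean_le {n : ℕ} (hmn : m ≤ n) (C : Circuit n) (s : Bits m) :
    |charMean hmn C s| ≤ 1 := by
  rw [← sum_normSq C, charMean]
  refine (Finset.abs_sum_le_sum_abs _ _).trans (Finset.sum_le_sum fun y _ => ?_)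
  rw [abs_mul, abs_chi, mul_one, abs_of_nonneg (Complex.normSq_nonneg _)]

end

/-! ### Concentration of sums of independent random variables -/

section
variable {α β κ : Type}

/-- Draw independently from the distributions `E k` for `k` in a list. -/
def seqPMF (E : κ → PMF α) : List κ → PMF (List α)
  | [] => PMF.pure []
  | k :: l => (seqPMF E l).bind fun r => (E k).map fun a => a :: r

/-- The expectation of a non-negative function. -/
def expect (D : PMF α) (F : α → ENNReal) : ENNReal := ∑' a, D a * F a

theorem expect_bind (D : PMF α) (k : α → PMF β) (F : β → ENNReal) :
    expect (D.bind k) F = expect D fun a => expect (k a) F := by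
  unfold expect
  simp only [PMF.bind_apply, ← ENNReal.tsum_mul_right, ← ENNReal.tsum_mul_left]
  rw [ENNReal.tsum_comm]
  simp only [mul_assoc]

theorem expect_pure (a : α) (F : α → ENNReal) : expect (PMF.pure a) F = F a := by
  unfold expect
  rw [tsum_eq_single a]
  · simp
  · intro b hb; simp [hb]

theorem expect_map (D : PMF α) (g : α → β) (F : β → ENNReal) :
    expect (D.map g) F = expect D fun a => F (g a) := by
  rw [← PMF.bind_pure_comp, expect_bind]
  simp [expect_pure]

theorem expect_mono (D : PMF α) {F G : α → ENNReal} (h : ∀ a, F a ≤ G a) :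
    expect D F ≤ expect D G :=
  ENNReal.tsum_le_tsum fun a => mul_le_mul_right (h a) _

theorem expect_mul_const (D : PMF α) (F : α → ENNReal) (c : ENNReal) :
    expect D (fun a => F a * c) = expect D F * c := by
  unfold expect
  simp only [← mul_assoc, ENNReal.tsum_mul_right]

theorem toOuterMeasure_eq_expect (D : PMF α) (S : Set α) :
    D.toOuterMeasure S = expect D (S.indicator fun _ => 1) := by
  rw [PMF.toOuterMeasure_apply, expect]
  exact tsum_congr fun a => by by_cases h : a ∈ S <;> simp [h]

/-- Markov's inequality. -/
theorem toOuterMeasure_le_of_expect_le (D : PMF α) (S : Set α) (F : α → ℝ) (B : ℝ)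
    (hS : ∀ a ∈ S, 0 ≤ F a) (h : expect D (fun a => ENNReal.ofReal (Real.exp (F a))) ≤
      ENNReal.ofReal (Real.exp B)) : D.toOuterMeasure S ≤ ENNReal.ofReal (Real.exp B) := by
  refine le_trans ?_ h
  rw [toOuterMeasure_eq_expect]
  refine expect_mono D fun a => ?_
  by_cases ha : a ∈ S
  · simp [ha, hS a ha]
  · simp [ha]

theorem sum_toReal [Fintype α] (E : PMF α) : ∑ a, (E a).toReal = 1 := by
  rw [← ENNReal.toReal_sum fun a _ => E.apply_ne_top a, ← tsum_fintype (L := .unconditional α),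
    E.tsum_coe, ENNReal.toReal_one]

/-- For |X| ≤ 1 one has exp X ≤ 1 + X + X². Here X = t(g - mu) with |g - mu| ≤ 2, hence the range of
`t` and the bound X² ≤ 4t²; the linear term has mean zero. -/
theorem exp_moment_le [Fintype α] (E : PMF α) (g : α → ℝ) (hg : ∀ a, |g a| ≤ 1) (mu : ℝ)
    (hmu : ∑ a, (E a).toReal * g a = mu) {t : ℝ} (ht : |t| ≤ 1 / 2) :
    expect E (fun a => ENNReal.ofReal (Real.exp (t * (g a - mu)))) ≤
      ENNReal.ofReal (Real.exp (4 * t ^ 2)) := by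
  have hmu1 : |mu| ≤ 1 := by
    rw [← hmu, ← sum_toReal E]
    refine (Finset.abs_sum_le_sum_abs _ _).trans (Finset.sum_le_sum fun a _ => ?_)
    rw [abs_mul, abs_of_nonneg ENNReal.toReal_nonneg]
    exact mul_le_of_le_one_right ENNReal.toReal_nonneg (hg a)
  have h1 : expect E (fun a => ENNReal.ofReal (Real.exp (t * (g a - mu)))) =
      ENNReal.ofReal (∑ a, (E a).toReal * Real.exp (t * (g a - mu))) := by
    rw [expect, tsum_fintype, ENNReal.ofReal_sum_of_nonneg
      fun a _ => mul_nonneg ENNReal.toReal_nonneg (Real.exp_nonneg _)]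
    refine Finset.sum_congr rfl fun a _ => ?_
    rw [ENNReal.ofReal_mul ENNReal.toReal_nonneg, ENNReal.ofReal_toReal (E.apply_ne_top a)]
  rw [h1]
  refine ENNReal.ofReal_le_ofReal ?_
  have h2 : ∀ a, Real.exp (t * (g a - mu)) ≤ 1 + t * (g a - mu) + 4 * t ^ 2 := by
    intro a
    have hX : |g a - mu| ≤ 2 := (abs_sub _ _).trans (by linarith [hg a])
    have hle : |t * (g a - mu)| ≤ 1 := by
      rw [abs_mul]
      calc |t| * |g a - mu| ≤ 1 / 2 * 2 := mul_le_mul ht hX (abs_nonneg _) (by norm_num)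
        _ = 1 := by norm_num
    have := (abs_le.1 (Real.abs_exp_sub_one_sub_id_le hle)).2
    have h4 : (g a - mu) ^ 2 ≤ 4 := by
      rw [← sq_abs]; nlinarith [abs_nonneg (g a - mu)]
    have h5 : (t * (g a - mu)) ^ 2 ≤ 4 * t ^ 2 := by
      rw [mul_pow]; nlinarith [sq_nonneg t]
    linarith
  calc ∑ a, (E a).toReal * Real.exp (t * (g a - mu))
      ≤ ∑ a, (E a).toReal * (1 + t * (g a - mu) + 4 * t ^ 2) :=
        Finset.sum_le_sum fun a _ => mul_le_mul_of_nonneg_left (h2 a) ENNReal.toReal_nonneg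
    _ = ∑ a, ((1 - t * mu + 4 * t ^ 2) * (E a).toReal + t * ((E a).toReal * g a)) :=
        Finset.sum_congr rfl fun a _ => by ring
    _ = 4 * t ^ 2 + 1 := by
        rw [Finset.sum_add_distrib, ← Finset.mul_sum, ← Finset.mul_sum, sum_toReal, hmu]; ring
    _ ≤ Real.exp (4 * t ^ 2) := Real.add_one_le_exp _

variable [Fintype α]

theorem exp_moment_seqPMF_le (E : κ → PMF α) (g : κ → α → ℝ) (hg : ∀ k a, |g k a| ≤ 1) (mu : κ → ℝ)
    (hmu : ∀ k, ∑ a, (E k a).toReal * g k a = mu k) {t : ℝ} (ht : |t| ≤ 1 / 2) (l : List κ) :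
    expect (seqPMF E l) (fun r => ENNReal.ofReal (Real.exp
      (t * (List.zipWith (fun k a => g k a - mu k) l r).sum))) ≤
      ENNReal.ofReal (Real.exp (4 * t ^ 2 * l.length)) := by
  induction l with
  | nil => simp [seqPMF, expect_pure]
  | cons k l ih =>
    simp only [seqPMF, expect_bind, expect_map, List.zipWith_cons_cons, List.sum_cons, mul_add,
      Real.exp_add, ENNReal.ofReal_mul (Real.exp_nonneg _)]
    simp only [expect_mul_const]
    calc _ ≤ expect (seqPMF E l) (fun r => ENNReal.ofReal (Real.exp (4 * t ^ 2)) *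
            ENNReal.ofReal (Real.exp
              (t * (List.zipWith (fun k a => g k a - mu k) l r).sum))) :=
          expect_mono _ fun r => mul_le_mul_left (exp_moment_le (E k) (g k) (hg k) (mu k) (hmu k) ht) _
      _ ≤ ENNReal.ofReal (Real.exp (4 * t ^ 2 * l.length)) *
            ENNReal.ofReal (Real.exp (4 * t ^ 2)) := by
          simp only [mul_comm (ENNReal.ofReal (Real.exp (4 * t ^ 2)))]
          rw [expect_mul_const]
          exact mul_le_mul_left ih _
      _ = _ := by
          rw [← ENNReal.ofReal_mul (Real.exp_nonneg _), ← Real.exp_add]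
          congr 2
          push_cast [List.length_cons]; ring

/-- Hoeffding's inequality. -/
theorem seqPMF_tail_le (E : κ → PMF α) (g : κ → α → ℝ) (hg : ∀ k a, |g k a| ≤ 1) (mu : κ → ℝ)
    (hmu : ∀ k, ∑ a, (E k a).toReal * g k a = mu k) (l : List κ) {K d : ℝ} (hK : 0 < K)
    (hl : l.length ≤ K) (hd : 0 ≤ d) (hdK : d ≤ 4 * K) :
    (seqPMF E l).toOuterMeasure
      {r | d ≤ |(List.zipWith (fun k a => g k a - mu k) l r).sum|} ≤
      2 * ENNReal.ofReal (Real.exp (-(d ^ 2 / (16 * K)))) := by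
  -- The value d/(8K) minimizes 4t²K - td, with minimum -d²/(16K), and `d ≤ 4 * K` makes |t| ≤ 1/2.
  -- The two signs of `t` give the two tails. Only an upper bound `K` for the length enters, since
  -- the number of tests depends on the search.
  have tail : ∀ t : ℝ, |t| = d / (8 * K) → (seqPMF E l).toOuterMeasure
      {r | d * |t| ≤ t * (List.zipWith (fun k a => g k a - mu k) l r).sum} ≤
      ENNReal.ofReal (Real.exp (-(d ^ 2 / (16 * K)))) := by
    intro t ht
    have ht2 : |t| ≤ 1 / 2 := by
      rw [ht, div_le_iff₀ (by positivity)]; linarith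
    have h1 := exp_moment_seqPMF_le E g hg mu hmu ht2 l
    refine toOuterMeasure_le_of_expect_le _ _
      (fun r => t * (List.zipWith (fun k a => g k a - mu k) l r).sum + -(d * |t|)) _
      (fun r hr => by simpa [sub_nonneg, ← sub_eq_add_neg] using hr) ?_
    simp only [Real.exp_add, ENNReal.ofReal_mul (Real.exp_nonneg _)]
    rw [expect_mul_const]
    refine (mul_le_mul_left h1 _).trans ?_
    rw [← ENNReal.ofReal_mul (Real.exp_nonneg _), ← Real.exp_add]
    refine ENNReal.ofReal_le_ofReal (Real.exp_le_exp.2 ?_)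
    rw [← sq_abs t, ht]
    have e1 : 4 * (d / (8 * K)) ^ 2 * l.length ≤ 4 * (d / (8 * K)) ^ 2 * K :=
      mul_le_mul_of_nonneg_left hl (by positivity)
    have e2 : 4 * (d / (8 * K)) ^ 2 * K + -(d * (d / (8 * K))) = -(d ^ 2 / (16 * K)) := by
      field_simp; ring
    linarith
  have hpos : 0 ≤ d / (8 * K) := by positivity
  refine (MeasureTheory.measure_mono (t := {r | d * |d / (8 * K)| ≤
      (d / (8 * K)) * (List.zipWith (fun k a => g k a - mu k) l r).sum} ∪
    {r | d * |-(d / (8 * K))| ≤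
      -(d / (8 * K)) * (List.zipWith (fun k a => g k a - mu k) l r).sum}) ?_).trans
    ((MeasureTheory.measure_union_le _ _).trans ?_)
  · intro r hr
    simp only [Set.mem_ofPred_eq, Set.mem_union, abs_neg, abs_of_nonneg hpos] at hr ⊢
    rcases le_abs.1 hr with h | h
    · left; nlinarith
    · right; nlinarith
  · rw [two_mul]
    exact add_le_add (tail _ (abs_of_nonneg hpos)) (tail _ (by rw [abs_neg, abs_of_nonneg hpos]))

end

/-! ### Sequences of independent draws: lengths, images, uniformity. -/

section
variable {α β κ : Type}

theorem length_of_mem_support_seqPMF {E : κ → PMF α} {l : List κ} {r : List α}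
    (h : r ∈ (seqPMF E l).support) : r.length = l.length := by
  induction l generalizing r with
  | nil => simp [seqPMF] at h; simp [h]
  | cons k l ih =>
    simp only [seqPMF, PMF.mem_support_bind_iff, PMF.mem_support_map_iff] at h
    obtain ⟨r', hr', a, -, rfl⟩ := h
    simp [ih hr']

theorem seqPMF_map (E : κ → PMF α) (g : α → β) (l : List κ) :
    seqPMF (fun k => (E k).map g) l = (seqPMF E l).map (List.map g) := by
  induction l with
  | nil => simp [seqPMF, PMF.pure_map]
  | cons k l ih =>
    simp only [seqPMF, ih, PMF.bind_map, PMF.map_bind, PMF.map_comp]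
    rfl

/-- Sequences of successful computations. -/
theorem mapListO_map_some (E : κ → PMF α) (l : List κ) :
    mapListO (fun k => (E k).map some) l = (seqPMF E l).map some := by
  induction l with
  | nil => simp [mapListO, seqPMF, pureO, PMF.pure_map]
  | cons k l ih =>
    rw [mapListO, ih, seqPMF, bindO, PMF.bind_map, PMF.map_bind]
    congr 1
    funext r
    simp [mapO, PMF.map_comp, Function.comp_def]

/-- Independent uniform choices are uniform. -/
theorem seqPMF_uniform [Fintype α] [Nonempty α] (l : List κ) {m : ℕ} (hm : l.length = m) :
    seqPMF (fun _ => PMF.uniformOfFintype α) l =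
      (PMF.uniformOfFintype (Fin m → α)).map List.ofFn := by
  classical
  induction l generalizing m with
  | nil =>
    obtain rfl : m = 0 := by simpa using hm.symm
    have : (List.ofFn : (Fin 0 → α) → List α) = fun _ => [] := by funext f; simp
    rw [this, seqPMF]
    exact (PMF.map_const _ _).symm
  | cons k l ih =>
    obtain ⟨m, rfl⟩ : ∃ m', m = m' + 1 := ⟨l.length, by simpa using hm.symm⟩
    have h1 : PMF.uniformOfFintype (Fin (m + 1) → α) =
        (PMF.uniformOfFintype (Fin m → α)).bind fun x =>
          (PMF.uniformOfFintype α).map fun a => (Fin.cons a x : Fin (m + 1) → α) := by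
      ext y
      simp only [PMF.bind_apply, PMF.map_apply, PMF.uniformOfFintype_apply, tsum_fintype]
      rw [Finset.sum_eq_single (Fin.tail y)]
      · rw [Finset.sum_eq_single (y 0)]
        · rw [if_pos (Fin.cons_self_tail y).symm]
          simp only [Fintype.card_pi, Finset.prod_const, Finset.card_univ, Fintype.card_fin,
            pow_succ, Nat.cast_mul]
          exact ENNReal.mul_inv (Or.inr (ENNReal.natCast_ne_top _))
            (Or.inl (ENNReal.natCast_ne_top _))
        · intro a _ ha
          exact if_neg fun h => ha (by rw [h]; simp)
        · simp
      · intro x _ hx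
        rw [Finset.sum_eq_zero, mul_zero]
        intro a _
        exact if_neg fun h => hx (by rw [h]; simp)
      · simp
    rw [seqPMF, ih (m := m) (by simpa using hm), h1, PMF.bind_map, PMF.map_bind]
    congr 1
    funext x
    simp only [Function.comp_apply, PMF.map_comp]
    congr 1
    funext a
    simp [List.ofFn_succ]

end

/-! ### Runs do not depend on the bound for loops unless they are cut off -/

/-- No run is cut off. -/
def NoCutoff (μ : Runs) : Prop := ∀ o ∈ μ.support, o.1 ≠ Res.cutoff

theorem NoCutoff.of_charge {t : ℕ} {μ : Runs} (h : NoCutoff (Runs.charge t μ)) : NoCutoff μ :=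
  fun o ho => h (o.1, t + o.2) (by
    rw [Runs.charge, PMF.mem_support_map_iff]; exact ⟨o, ho, rfl⟩)

theorem NoCutoff.of_andThen {μ : Runs} {k : Val → Runs} (h : NoCutoff (μ.andThen k)) :
    NoCutoff μ ∧ ∀ v t, (Res.out v, t) ∈ μ.support → NoCutoff (k v) := by
  constructor
  · rintro ⟨r, t⟩ ho hr
    simp only at hr
    subst hr
    exact h (.cutoff, t) (by
      rw [Runs.andThen, PMF.mem_support_bind_iff]; exact ⟨_, ho, by simp⟩) rfl
  · intro v t hv
    refine NoCutoff.of_charge (t := t) fun o ho => h o ?_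
    rw [Runs.andThen, PMF.mem_support_bind_iff]
    exact ⟨_, hv, ho⟩

/-- If the composite is never cut off, neither is the continuation on any output that is actually
reached, and only these matter. -/
theorem andThen_congr {μ μ' : Runs} {k k' : Val → Runs} (h : NoCutoff (μ.andThen k))
    (hμ : NoCutoff μ → μ' = μ) (hk : ∀ v, NoCutoff (k v) → k' v = k v) :
    μ'.andThen k' = μ.andThen k := by
  obtain ⟨h1, h2⟩ := h.of_andThen
  rw [hμ h1]
  ext o
  simp only [Runs.andThen, PMF.bind_apply]
  refine tsum_congr fun o' => ?_
  obtain ⟨r, t⟩ := o'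
  by_cases ho : (r, t) ∈ μ.support
  · cases r with
    | out v => simp [hk v (h2 v t ho)]
    | refused => rfl
    | cutoff => rfl
  · rw [PMF.mem_support_iff, not_not] at ho
    simp [ho]

theorem whileLoop_congr {c a c' a' : Val → Runs} (hc : ∀ v, NoCutoff (c v) → c' v = c v)
    (ha : ∀ v, NoCutoff (a v) → a' v = a v) {N : ℕ} :
    ∀ {N' : ℕ} {v : Val}, N ≤ N' → NoCutoff (Runs.whileLoop c a N v) →
      Runs.whileLoop c' a' N' v = Runs.whileLoop c a N v := by
  induction N with
  | zero =>
    intro N' v _ h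
    exact absurd rfl (h (.cutoff, 0) (by simp [Runs.whileLoop]))
  | succ N ih =>
    intro N' v hN h
    obtain ⟨N', rfl⟩ : ∃ k, N' = k + 1 := ⟨N' - 1, by omega⟩
    simp only [Runs.whileLoop] at h ⊢
    refine andThen_congr h (hc v) fun r hr => ?_
    split_ifs with hnil
    · rfl
    · rw [if_neg hnil] at hr
      exact andThen_congr hr (ha v) fun w hw => ih (by omega) hw

/-- The subroutine is specified under the loop bound T(m) but executed under the bound of the whole
algorithm; this lemma transfers its behaviour. -/
theorem exec_mono (sub dev : Val → Runs) {N N' : ℕ} (hN : N ≤ N') (p : Prog) :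
    ∀ v, NoCutoff (p.exec sub dev N v) → p.exec sub dev N' v = p.exec sub dev N v := by
  induction p with
  | id | nil | fst | snd | coin | sub | query => exact fun _ _ => rfl
  | pair a b iha ihb =>
    intro v h
    simp only [Prog.exec] at h ⊢
    rw [andThen_congr h.of_charge (iha v) fun x hx => andThen_congr hx (ihb v) fun _ _ => rfl]
  | comp b a ihb iha =>
    intro v h
    simp only [Prog.exec] at h ⊢
    rw [andThen_congr h.of_charge (iha v) ihb]
  | ite c a b ihc iha ihb =>
    intro v h
    simp only [Prog.exec] at h ⊢
    rw [andThen_congr h.of_charge (ihc v) fun r hr => ?_]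
    split_ifs with hnil
    · rw [if_pos hnil] at hr; exact ihb v hr
    · rw [if_neg hnil] at hr; exact iha v hr
  -- The remaining constructor is `while`.
  | _ =>
    rename_i c a ihc iha
    intro v h
    simp only [Prog.exec] at h ⊢
    rw [whileLoop_congr ihc iha hN h.of_charge]

/-! ### The environment of the algorithm -/

/-- An input of the algorithm, with a program for the Boolean function. -/
structure Instance (T : Polynomial ℕ) where
  n : ℕ
  m : ℕ
  hmn : m ≤ n
  C : Circuit n
  f : Bits m → Bool
  P : Prog
  hP : Evaluates P f (T.eval m)

/-- The environment in which the algorithm runs on an input. -/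
def Instance.env {T : Polynomial ℕ} (I : Instance T) : Env where
  sub N := I.P.exec refuse refuse N
  dev := device (I.n + 1) (fourierDegree I.f) (1 + maxSupp I.hmn I.C)
  par := I.n

/-- A bit string read from a list. -/
def ofList {m : ℕ} (x : List Bool) : Bits m := fun j => x.getD j false

theorem ofList_ofFn {m : ℕ} (x : Bits m) : ofList (List.ofFn x) = x := by
  funext j
  simp [ofList, List.getD]

/-- The distribution of the answers of the device. -/
def answer {T : Polynomial ℕ} (I : Instance T) (Q : List (List RawGate)) :
    PMF (Option (List Bool)) :=
  open Classical in
  match Function.partialInv (encGateList (N := I.n + 1)) (Enc.enc Q) with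
  | some Q => if Q.IsCommuting (fourierDegree I.f) (1 + maxSupp I.hmn I.C) then
      (measure Q.flatten).map fun y => some (List.ofFn y) else PMF.pure none
  | none => PMF.pure none

section
variable {T : Polynomial ℕ} {α β γ : Type} [Enc α] [Enc β] [Enc γ]

/-- The subroutine is only trusted on codes of strings of length `m`, where its specified run has no
cutoff and so persists under the larger loop bound. -/
theorem Poly.sub : Poly (Instance.env (T := T)) (fun I x => ∃ b : Bits I.m, x = List.ofFn b)
    fun I x => pureO (I.f (ofList x)) := by
  refine ⟨.sub, 4 + Polynomial.X + T, ?_⟩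
  rintro I x ⟨b, rfl⟩ N hN
  obtain ⟨t, ht, h⟩ := I.hP.2 b
  simp only [Polynomial.eval_add, Polynomial.eval_X, Polynomial.eval_ofNat] at hN ⊢
  have hT : T.eval I.m ≤ T.eval (I.n + sz (List.ofFn b)) :=
    eval_mono _ (I.hmn.trans (Nat.le_add_right _ _))
  change T.eval I.m ≤ T.eval (I.env.par + sz (List.ofFn b)) at hT
  have hno : NoCutoff (I.P.exec refuse refuse (T.eval I.m) (encBits b)) := by
    rw [h]
    intro o ho
    simp [Runs.done] at ho
    simp [ho]
  have h2 := exec_mono refuse refuse (N' := N) (by omega) I.P _ hno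
  rw [h] at h2
  have h3 : Spec (Prog.exec (I.env.sub N) I.env.dev N .sub (Enc.enc (List.ofFn b)))
      (pureO (I.f (ofList (List.ofFn b)))) ((1 + sz (List.ofFn b)) + (3 + T.eval I.m)) := by
    refine Spec.charge _ ?_
    change Spec (I.P.exec refuse refuse N (encBits b)) _ _
    rw [h2, ofList_ofFn]
    exact Spec.done rfl (by omega) ((sz_bool_le _).trans (by omega))
  exact h3.mono (by omega)

theorem sz_ofFn_le {m : ℕ} (y : Bits m) : sz (List.ofFn y) ≤ 1 + 4 * m := by
  have := sz_le_of_forall_mem (l := List.ofFn y) (B := 3) fun b _ => sz_bool_le b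
  rw [List.length_ofFn] at this
  omega

theorem Spec.refuse (v : Val) (B : ℕ) : Spec (α := α) (refuse v) (PMF.pure none) B := by
  refine ⟨by simp [SCP.refuse, PMF.pure_map, resOf], ?_, by simp⟩
  intro o ho
  simp [SCP.refuse] at ho
  simp [ho]

/-- No condition is imposed on the request: a refusal is the failure `none`, which ends the run in
time. So the time bound survives a search that went wrong. -/
theorem Poly.query : Poly (Instance.env (T := T)) (fun _ _ => True) answer := by
  refine ⟨.query, 10 + 5 * Polynomial.X, fun I Q _ N hN => ?_⟩
  simp only [Polynomial.eval_add, Polynomial.eval_mul, Polynomial.eval_X, Polynomial.eval_ofNat]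
  have hpar : I.env.par = I.n := rfl
  have h : Spec (I.env.dev (Enc.enc Q)) (answer I Q) (1 + 4 * (I.n + 1)) := by
    simp only [Instance.env, device, answer]
    cases hQ : Function.partialInv (encGateList (N := I.n + 1)) (Enc.enc Q) with
    | none => exact Spec.refuse _ _
    | some Q' =>
      simp only
      split_ifs
      · refine ⟨?_, ?_, ?_⟩
        · rw [PMF.map_bind, PMF.map_comp, ← PMF.bind_pure_comp]
          congr 1
          funext y
          simp only [Runs.done, PMF.pure_map, Function.comp_apply, resOf]
          rfl
        · intro o ho
          rw [PMF.mem_support_bind_iff] at ho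
          obtain ⟨y, -, hy⟩ := ho
          simp [Runs.done] at hy
          rw [hy]
          exact sz_ofFn_le y
        · intro a ha
          rw [PMF.mem_support_map_iff] at ha
          obtain ⟨y, -, hy⟩ := ha
          rw [← Option.some.inj hy]
          exact sz_ofFn_le y
      · exact Spec.refuse _ _
  refine (h.charge (1 + (Enc.enc Q).size)).mono ?_
  rw [size_enc]; omega

theorem uniform_prod {α β : Type} [Fintype α] [Nonempty α] [Fintype β] [Nonempty β] :
    PMF.uniformOfFintype (α × β) = (PMF.uniformOfFintype α).bind fun a =>
      (PMF.uniformOfFintype β).map fun b => (a, b) := by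
  classical
  ext ⟨a, b⟩
  simp only [PMF.bind_apply, PMF.map_apply, PMF.uniformOfFintype_apply, tsum_fintype]
  rw [Finset.sum_eq_single a]
  · rw [Finset.sum_eq_single b]
    · simp only [if_true, Fintype.card_prod, Nat.cast_mul]
      exact ENNReal.mul_inv (Or.inr (ENNReal.natCast_ne_top _))
        (Or.inl (ENNReal.natCast_ne_top _))
    · intro b' _ hb
      exact if_neg fun h => hb (by rw [Prod.mk.injEq] at h; exact h.2.symm)
    · simp
  · intro a' _ ha
    rw [Finset.sum_eq_zero, mul_zero]
    intro b' _
    exact if_neg fun h => ha (by rw [Prod.mk.injEq] at h; exact h.1.symm)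
  · simp

theorem Poly.coin {ι : Type} {env : ι → Env} :
    Poly env (fun _ (_ : α) => True) fun _ _ => (PMF.uniformOfFintype Bool).map some := by
  refine ⟨.coin, 4 + Polynomial.X, fun i a _ N hN => ?_⟩
  simp only [Polynomial.eval_add, Polynomial.eval_X, Polynomial.eval_ofNat]
  have h : Spec ((PMF.uniformOfFintype Bool).bind fun b => Runs.done (encBool b) (encBool b).size)
      ((PMF.uniformOfFintype Bool).map some) 3 := by
    refine ⟨?_, ?_, fun b _ => sz_bool_le b⟩
    · rw [PMF.map_bind, PMF.map_comp, ← PMF.bind_pure_comp]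
      congr 1
      funext y
      simp only [Runs.done, PMF.pure_map, Function.comp_apply, resOf]
      rfl
    · intro o ho
      rw [PMF.mem_support_bind_iff] at ho
      obtain ⟨b, -, hb⟩ := ho
      simp [Runs.done] at hb
      rw [hb]
      exact sz_bool_le b
  refine (h.charge (1 + (Enc.enc a).size)).mono ?_
  rw [size_enc]; omega

theorem bindO_map_some {α β : Type} (D : PMF α) (k : α → PMF (Option β)) :
    bindO (D.map some) k = D.bind k := by
  simp only [bindO, PMF.bind_map]
  rfl

theorem bind_bindO {α β γ : Type} (D : PMF α) (k : α → PMF (Option β)) (k' : β → PMF (Option γ)) :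
    bindO (D.bind k) k' = D.bind fun a => bindO (k a) k' := by
  simp only [bindO, PMF.bind_bind]

theorem mapO_map_some {α β : Type} (D : PMF α) (g : α → β) :
    mapO g (D.map some) = (D.map g).map some := by
  simp only [mapO, PMF.map_comp]
  rfl

theorem Poly.triple {ι : Type} {env : ι → Env} : Poly env (fun _ (_ : α) => True)
    fun _ _ => (PMF.uniformOfFintype (Bool × Bool × Bool)).map some := by
  refine (Poly.coin.pair (Poly.coin.pair Poly.coin)).congr (fun _ _ h => h) fun i a _ => ?_
  simp only [bindO_map_some, mapO, PMF.map_bind, uniform_prod, PMF.map_comp]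
  rfl

end

/-! ### The algorithm -/

/-- The number of samples, the threshold for estimated weights, and the maximal number of candidates,
as polynomials in the number of qubits. -/
structure Params where
  num : Polynomial ℕ
  thr : Polynomial ℕ
  cap : Polynomial ℕ

/-- Evaluate the Boolean function at the two points of a sample. -/
def evalSample {m : ℕ} (f : Bits m → Bool) (x : Sample) : List Bool × Bool :=
  (x.1, f (ofList x.2.1) && f (ofList x.2.2))

/-- The data for estimating Fourier coefficients. -/
def coeffData {m : ℕ} (f : Bits m → Bool) (ds : List (Draw m)) : List (List Bool × Bool) :=
  ds.map fun d => evalSample f (coeffSample (List.ofFn d))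

/-- The data for estimating weights. -/
def weightData {m : ℕ} (f : Bits m → Bool) (ds : List (Draw m)) (j : ℕ) :
    List (List Bool × Bool) :=
  ds.map fun d => evalSample f (weightSample (maskBits m j) (List.ofFn d))

/-- The candidates found by the search. -/
def candidates {T : Polynomial ℕ} (pr : Params) (I : Instance T) (ds : List (Draw I.m)) :
    List (List Bool) :=
  search I.m (pr.thr.eval I.n) (pr.cap.eval I.n)
    ((List.range I.m).map (weightData I.f ds))

/-- The encoded gate. -/
def rawGate {n : ℕ} : Gate n → RawGate
  | .h i => (0, encNat i)
  | .t i => (1, encNat i)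
  | .cz i j _ => (2, .cons (encNat i) (encNat j))

/-- The encoded circuit. -/
def rawCircuit {n : ℕ} (C : Circuit n) : List RawGate := C.map rawGate

/-- The random output, given the samples drawn. -/
def outcome {T : Polynomial ℕ} (pr : Params) (I : Instance T) (ds : List (Draw I.m)) :
    PMF (Option (ℕ × ℕ)) :=
  mapO (fun V => (posVotes V - negVotes V, pr.num.eval I.n))
    (mapListO (fun x => mapO (combine x.1) (answer I x.2))
      (requests I.m I.n (rawCircuit I.C) (candidates pr I ds) (coeffData I.f ds)))

/-- The input of the algorithm. -/
def Instance.input {T : Polynomial ℕ} (I : Instance T) : ℕ × ℕ × List RawGate :=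
  (I.m, I.n, rawCircuit I.C)

/-- The random strings. -/
def draws {T : Polynomial ℕ} (pr : Params) (I : Instance T) : PMF (List (Draw I.m)) :=
  seqPMF (fun _ => PMF.uniformOfFintype (Draw I.m)) (List.replicate (pr.num.eval I.n) ())

section
variable {T : Polynomial ℕ}

theorem poly_draws (pr : Params) : Poly (Instance.env (T := T)) (fun I a => a = I.input)
    fun I _ => ((draws pr I).map (List.map List.ofFn)).map some := by
  have h1 : Poly (Instance.env (T := T)) (fun _ _ => True)
      fun _ (x : Unit × Unit) => (PMF.uniformOfFintype (Bool × Bool × Bool)).map some := Poly.triple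
  have h2 := (Poly.map h1).comp_det (f := fun x : (ℕ × ℕ × List RawGate) × Unit =>
    ((), List.replicate x.1.1 ())) (.pair (.const ()) (.units PolyTime.id.proj₁.proj₁))
  have h3 := (Poly.map h2).comp_det (f := fun x : ℕ × ℕ × List RawGate =>
    (x, List.replicate (pr.num.eval x.2.1) ()))
    (.pair .id (.units (.eval _ PolyTime.id.proj₂.proj₁)))
  refine h3.congr (fun _ _ _ _ _ _ _ => trivial) ?_
  rintro I _ rfl
  have e : ∀ m : ℕ, mapListO (fun _ : Unit => (PMF.uniformOfFintype (Bool × Bool × Bool)).map some)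
      (List.replicate m ()) = ((PMF.uniformOfFintype (Draw m)).map List.ofFn).map some := by
    intro m
    rw [mapListO_map_some fun _ => PMF.uniformOfFintype (Bool × Bool × Bool),
      seqPMF_uniform (m := m) _ (by simp)]
  simp only [e, Instance.input]
  rw [mapListO_map_some fun _ => (PMF.uniformOfFintype (Draw I.m)).map List.ofFn, seqPMF_map]
  rfl

/-- All points of a sample are inputs of the Boolean function. -/
def Sample.Valid (m : ℕ) (x : Sample) : Prop :=
  (∃ b : Bits m, x.2.1 = List.ofFn b) ∧ ∃ b : Bits m, x.2.2 = List.ofFn b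

theorem poly_evalSample : Poly (Instance.env (T := T))
    (fun I (x : Unit × Sample) => x.2.Valid I.m) fun I x => pureO (evalSample I.f x.2) := by
  have h1 := (Poly.sub (T := T)).comp_det (f := fun x : Unit × Sample => x.2.2.1)
    PolyTime.id.proj₂.proj₂.proj₁
  have h2 := (Poly.sub (T := T)).comp_det (f := fun x : Unit × Sample => x.2.2.2)
    PolyTime.id.proj₂.proj₂.proj₂
  have h3 : PolyTime (Instance.env (T := T)) (fun x : Unit × Sample => x.2.1) :=
    PolyTime.id.proj₂.proj₁
  have h4 : PolyTime (Instance.env (T := T)) (fun y : List Bool × Bool × Bool =>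
      (y.1, y.2.1 && y.2.2)) :=
    .pair .fst (PolyTime.bool_comp₂ and PolyTime.id.proj₂.proj₁ PolyTime.id.proj₂.proj₂)
  refine (h4.after ((h3.poly (fun I x => x.2.Valid I.m)).pair
    ((h1.congr (dom' := fun I x => x.2.Valid I.m) (fun _ _ h => h.1) fun _ _ _ => rfl).pair
      (h2.congr (dom' := fun I x => x.2.Valid I.m) (fun _ _ h => h.2) fun _ _ _ => rfl)))).congr
    (fun _ _ h => h) fun I x _ => ?_
  simp [evalSample]

theorem map_range_eq_ofFn {α : Type} (m : ℕ) (g : ℕ → α) :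
    (List.range m).map g = List.ofFn fun i : Fin m => g i := by
  refine List.ext_getElem (by simp) fun i h1 h2 => by simp

theorem zip_ofFn {α β : Type} {m : ℕ} (x : Fin m → α) (y : Fin m → β) :
    (List.ofFn x).zip (List.ofFn y) = List.ofFn fun i => (x i, y i) := by
  refine List.ext_getElem (by simp) fun i h1 h2 => by simp

theorem coeffSample_ofFn {m : ℕ} (d : Draw m) : coeffSample (List.ofFn d) =
    (List.ofFn fun i => (d i).1, List.ofFn fun i => (d i).1, List.ofFn fun i => (d i).1) := by
  simp [coeffSample, List.map_ofFn, Function.comp_def]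

/-- The positions up to `j`. -/
def mask (m j : ℕ) : Bits m := fun i => decide ((i : ℕ) ≤ j)

theorem weightSample_ofFn {m : ℕ} (j : ℕ) (d : Draw m) :
    weightSample (maskBits m j) (List.ofFn d) =
    (List.ofFn fun i => xor (d i).1 (d i).2.1, List.ofFn (mixFst (mask m j) d),
      List.ofFn (mixSnd (mask m j) d)) := by
  simp only [weightSample, maskBits, map_range_eq_ofFn, zip_ofFn, List.map_ofFn, Function.comp_def]
  rfl

theorem poly_mapSamples : Poly (Instance.env (T := T))
    (fun I (x : Unit × List Sample) => ∀ s ∈ x.2, s.Valid I.m)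
    fun I x => pureO (x.2.map (evalSample I.f)) :=
  (Poly.map poly_evalSample).congr (fun _ _ h => h) fun I x _ =>
    mapListO_pureO (evalSample I.f) x.2

/-- The input together with the data obtained from the samples. -/
theorem poly_data : Poly (Instance.env (T := T))
    (fun I (x : (ℕ × ℕ × List RawGate) × List (List (Bool × Bool × Bool))) =>
      x.1 = I.input ∧ ∃ ds : List (Draw I.m), x.2 = ds.map List.ofFn)
    fun I x => pureO (x.1, (samples x.1.1 x.2).1.map (evalSample I.f),
      -- The same draws are reused for the coefficients and for all masks, which is harmless because
      -- the accuracy events are combined by a union bound.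
      (samples x.1.1 x.2).2.map fun l => l.map (evalSample I.f)) := by
  have hs : PolyTime (Instance.env (T := T))
      (fun x : (ℕ × ℕ × List RawGate) × List (List (Bool × Bool × Bool)) => samples x.1.1 x.2) :=
    .samples PolyTime.id.proj₁.proj₁ .snd
  have h1 := poly_mapSamples.comp_det (PolyTime.pair (.const ()) hs.proj₁)
  have h2 : Poly (Instance.env (T := T))
      (fun I (x : Unit × List (List Sample)) => ∀ l ∈ x.2, ∀ s ∈ l, s.Valid I.m)
      fun I x => pureO (x.2.map fun l => l.map (evalSample I.f)) :=
    (Poly.map poly_mapSamples).congr (fun _ _ h => h) fun I x _ =>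
      mapListO_pureO (fun l : List Sample => l.map (evalSample I.f)) x.2
  have h3 := h2.comp_det (PolyTime.pair (.const ()) hs.proj₂)
  have h0 : PolyTime (Instance.env (T := T))
      (fun x : (ℕ × ℕ × List RawGate) × List (List (Bool × Bool × Bool)) => x.1) := .fst
  refine ((h0.poly _).pair ((h1.congr (fun I x hx => ?_) fun _ _ _ => rfl).pair
    (h3.congr (fun I x hx => ?_) fun _ _ _ => rfl))).congr (fun _ _ h => h) ?_
  · obtain ⟨h1, ds, h2⟩ := hx
    intro s hs
    simp only [samples, h2, List.map_map, List.mem_map, Function.comp_apply] at hs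
    obtain ⟨d, -, rfl⟩ := hs
    rw [coeffSample_ofFn]
    exact ⟨⟨_, rfl⟩, ⟨_, rfl⟩⟩
  · obtain ⟨h1, ds, h2⟩ := hx
    intro l hl s hs
    simp only [samples, h1, h2, Instance.input, List.map_map, List.mem_map] at hl
    obtain ⟨j, -, rfl⟩ := hl
    rw [List.mem_map] at hs
    obtain ⟨d, -, rfl⟩ := hs
    rw [Function.comp_apply, weightSample_ofFn]
    exact ⟨⟨_, rfl⟩, ⟨_, rfl⟩⟩
  · intro I x _
    simp

/-- The algorithm up to its random choices. -/
theorem poly_outcome (pr : Params) : Poly (Instance.env (T := T)) (fun I a => a = I.input)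
    fun I _ => (draws pr I).bind (outcome pr I) := by
  have hin : PolyTime (Instance.env (T := T)) (fun a : ℕ × ℕ × List RawGate => a) := .id
  have h1 := (hin.poly _).pair (poly_draws (T := T) pr)
  have h2 := Poly.comp poly_data h1 (by
    rintro I _ rfl b hb
    obtain ⟨a, ha, hb⟩ := some_mem_support_bindO.1 hb
    rw [some_mem_support_pureO] at ha
    subst ha
    obtain ⟨W, hW, rfl⟩ := some_mem_support_mapO.1 hb
    refine ⟨rfl, ?_⟩
    rw [PMF.mem_support_map_iff] at hW
    obtain ⟨W', hW', h⟩ := hW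
    rw [PMF.mem_support_map_iff] at hW'
    obtain ⟨ds, -, hds⟩ := hW'
    exact ⟨ds, by rw [← Option.some.inj h, hds]⟩)
  let E : Type := (ℕ × ℕ × List RawGate) × List (List Bool × Bool) ×
    List (List (List Bool × Bool))
  have hm : PolyTime (Instance.env (T := T)) (fun x : E => x.1.1) := PolyTime.id.proj₁.proj₁
  have hn : PolyTime (Instance.env (T := T)) (fun x : E => x.1.2.1) :=
    PolyTime.id.proj₁.proj₂.proj₁
  have hreq : PolyTime (Instance.env (T := T)) (fun x : E =>
      requests x.1.1 x.1.2.1 x.1.2.2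
        (search x.1.1 (pr.thr.eval x.1.2.1) (pr.cap.eval x.1.2.1) x.2.2) x.2.1) :=
    .requests hm hn PolyTime.id.proj₁.proj₂.proj₂
      (.search hm (hn.eval _) (hn.eval _) PolyTime.id.proj₂.proj₂) PolyTime.id.proj₂.proj₁
  have hq : Poly (Instance.env (T := T)) (fun _ _ => True)
      (fun I (x : Unit × (Bool × Bool) × List (List RawGate)) =>
        mapO (combine x.2.1) (answer I x.2.2)) := by
    have hw : PolyTime (Instance.env (T := T))
      (fun x : Unit × (Bool × Bool) × List (List RawGate) => x.2.1) := PolyTime.id.proj₂.proj₁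
    have hcomb : PolyTime (Instance.env (T := T))
      (fun y : (Bool × Bool) × List Bool => combine y.1 y.2) := .combine .fst .snd
    have ha := (Poly.query (T := T)).comp_det
      (f := fun x : Unit × (Bool × Bool) × List (List RawGate) => x.2.2) PolyTime.id.proj₂.proj₂
    refine (hcomb.after ((hw.poly _).pair ha)).congr (fun _ _ _ => trivial) fun I x _ => ?_
    simp [mapO_mapO]
  have hans := (Poly.map hq).comp_det (PolyTime.pair (.const ()) hreq)
  have hfin : PolyTime (Instance.env (T := T)) (fun y : E × List (Bool × Bool) =>
      (posVotes y.2 - negVotes y.2, pr.num.eval y.1.1.2.1)) :=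
    .pair (.sub (.posVotes .snd) (.negVotes .snd)) (.eval _ (hn.comp .fst))
  have hE : PolyTime (Instance.env (T := T)) (fun x : E => x) := .id
  have h3 := hfin.after ((hE.poly _).pair hans)
  refine (Poly.comp h3 h2 fun _ _ _ _ _ _ _ => trivial).congr (fun _ _ h => h) ?_
  rintro I _ rfl
  simp only [pureO_bindO, bindO_mapO, bindO_map_some, PMF.bind_map, mapO_mapO, bind_bindO,
    Function.comp_apply]
  congr 1
  funext ds
  simp only [outcome, candidates, coeffData, Instance.input, samples, List.map_map,
    Function.comp_def]
  rfl

theorem enc_rawCircuit {n : ℕ} (C : Circuit n) : Enc.enc (rawCircuit C) = encCircuit C := by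
  induction C with
  | nil => rfl
  | cons g c ih =>
    have h : Enc.enc (rawGate g) = encGate g := by cases g <;> rfl
    change Val.cons (Enc.enc (rawGate g)) (Enc.enc (rawCircuit c)) = _
    rw [ih, h]
    rfl

theorem sz_val_nat (k : ℕ) : sz (encNat k) = 2 * k + 1 := sz_nat k

theorem sz_rawGate_le {n : ℕ} (g : Gate n) : sz (rawGate g) ≤ 9 + 4 * n := by
  have hc : ∀ v w : Val, sz (Val.cons v w) = 1 + sz v + sz w := fun _ _ => rfl
  cases g with
  | h i => have := i.2; simp [rawGate, sz_val_nat]; omega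
  | t i => have := i.2; simp [rawGate, sz_val_nat]; omega
  | cz i j h => have := i.2; have := j.2; simp [rawGate, sz_val_nat, hc]; omega

/-- The bound of `poly_outcome` is polynomial in the size of the input, and a circuit with at most
size(n) gates, each with a code of size linear in n, has a code polynomial in n. The loop bound is
set to the time bound itself. -/
theorem exists_algorithm (pr : Params) (size : Polynomial ℕ) :
    ∃ (A : Prog) (R : Polynomial ℕ), ∀ I : Instance T, I.C.length ≤ size.eval I.n →
      Spec (A.runs I.P I.m I.C (fourierDegree I.f) (1 + maxSupp I.hmn I.C) (R.eval I.n))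
        ((draws pr I).bind (outcome pr I)) (R.eval I.n) := by
  obtain ⟨A, R, h⟩ := poly_outcome (T := T) pr
  let S : Polynomial ℕ := 5 * Polynomial.X + 5 + size * (10 + 4 * Polynomial.X)
  refine ⟨A, R.comp S, fun I hI => ?_⟩
  have hsz : I.env.par + sz I.input ≤ S.eval I.n := by
    have h1 : sz (rawCircuit I.C) ≤ 1 + (rawCircuit I.C).length * (1 + (9 + 4 * I.n)) := by
      refine sz_le_of_forall_mem fun g hg => ?_
      simp only [rawCircuit, List.mem_map] at hg
      obtain ⟨g, -, rfl⟩ := hg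
      exact sz_rawGate_le g
    have h2 : (rawCircuit I.C).length * (1 + (9 + 4 * I.n)) ≤
        size.eval I.n * (1 + (9 + 4 * I.n)) := Nat.mul_le_mul_right _ (by simpa [rawCircuit])
    have h3 : I.env.par = I.n := rfl
    have h4 := I.hmn
    have h5 : 1 + (9 + 4 * I.n) = 10 + 4 * I.n := by omega
    rw [h5] at h1 h2
    simp only [S, Instance.input, sz_prod, sz_nat, Polynomial.eval_add, Polynomial.eval_mul,
      Polynomial.eval_X, Polynomial.eval_ofNat]
    omega
  have h1 := eval_mono R hsz
  rw [Polynomial.eval_comp]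
  have h2 := (h I I.input rfl _ h1).mono h1
  have h3 : Enc.enc I.input = .cons (encNat I.m) (.cons (encNat I.n) (encCircuit I.C)) := by
    rw [← enc_rawCircuit]; rfl
  rw [h3] at h2
  exact h2

end

/-! ### Correctness of the search -/

/-- The value of a vote. -/
def voteVal (w : Bool × Bool) : ℝ := if w.1 then (if w.2 then -1 else 1) else 0

theorem posVotes_sub_negVotes (V : List (Bool × Bool)) :
    (posVotes V : ℝ) - negVotes V = (V.map voteVal).sum := by
  induction V with
  | nil => simp [posVotes, negVotes]
  | cons w V ih =>
    obtain ⟨a, b⟩ := w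
    simp only [posVotes, negVotes, List.filter_cons, List.map_cons, List.sum_cons] at ih ⊢
    rw [← ih]
    cases a <;> cases b <;> simp [voteVal] <;> ring

theorem foldl_xor_sign (l : List Bool) (b : Bool) :
    (if l.foldl xor b then (-1 : ℝ) else 1) =
      (if b then -1 else 1) * (l.map fun c => if c then (-1 : ℝ) else 1).prod := by
  induction l generalizing b with
  | nil => cases b <;> simp
  | cons c l ih =>
    rw [List.foldl_cons, ih, List.map_cons, List.prod_cons]
    cases b <;> cases c <;> simp

section
variable {m : ℕ}

theorem parity_sign (s u : Bits m) :
    (if parity (List.ofFn s) (List.ofFn u) then (-1 : ℝ) else 1) = chi s u := by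
  rw [parity, zip_ofFn, List.map_ofFn, foldl_xor_sign, List.map_ofFn, List.prod_ofFn]
  simp [chi]

/-- The contribution of a draw to the estimate of a Fourier coefficient. -/
def coeffTerm (f : Bits m → Bool) (s : Bits m) (d : Draw m) : ℝ :=
  realVal f (fun i => (d i).1) * chi s fun i => (d i).1

/-- The contribution of a draw to the estimate of a weight. -/
def weightTerm (f : Bits m → Bool) (mask s : Bits m) (d : Draw m) : ℝ :=
  (realVal f (mixFst mask d) * realVal f (mixSnd mask d)) * chi s fun i => xor (d i).1 (d i).2.1

theorem abs_realVal_le (f : Bits m → Bool) (x : Bits m) : |realVal f x| ≤ 1 := by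
  unfold realVal; split_ifs <;> simp

theorem abs_coeffTerm_le (f : Bits m → Bool) (s : Bits m) (d : Draw m) :
    |coeffTerm f s d| ≤ 1 := by
  rw [coeffTerm, abs_mul, abs_chi, mul_one]
  exact abs_realVal_le _ _

theorem abs_weightTerm_le (f : Bits m → Bool) (mask s : Bits m) (d : Draw m) :
    |weightTerm f mask s d| ≤ 1 := by
  rw [weightTerm, abs_mul, abs_chi, mul_one, abs_mul]
  exact mul_le_one₀ (abs_realVal_le _ _) (abs_nonneg _) (abs_realVal_le _ _)

theorem voteVal_eq (v p : Bool) :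
    voteVal (v, p) = (if v then 1 else 0) * (if p then (-1 : ℝ) else 1) := by
  cases v <;> cases p <;> simp [voteVal]

/-- The vote of a draw on a Fourier coefficient. -/
def coeffVote (f : Bits m → Bool) (s : Bits m) (d : Draw m) : Bool × Bool :=
  (f fun i => (d i).1, parity (List.ofFn s) (List.ofFn fun i => (d i).1))

theorem voteVal_coeffVote (f : Bits m → Bool) (s : Bits m) (d : Draw m) :
    voteVal (coeffVote f s d) = coeffTerm f s d := by
  rw [coeffVote, voteVal_eq, parity_sign]
  rfl

theorem votes_coeffData (f : Bits m → Bool) (s : Bits m) (ds : List (Draw m)) :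
    votes (List.ofFn s) (coeffData f ds) = ds.map (coeffVote f s) := by
  simp only [votes, coeffData, List.map_map]
  refine List.map_congr_left fun d _ => ?_
  simp only [Function.comp_apply, evalSample, coeffSample_ofFn, ofList_ofFn, coeffVote,
    Bool.and_self]

theorem weight_estimate (f : Bits m → Bool) (s : Bits m) (ds : List (Draw m)) (j : ℕ) :
    (posVotes (votes (List.ofFn s) (weightData f ds j)) : ℝ) -
      negVotes (votes (List.ofFn s) (weightData f ds j)) =
      (ds.map (weightTerm f (mask m j) s)).sum := by
  rw [posVotes_sub_negVotes]
  simp only [votes, weightData, List.map_map]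
  congr 1
  refine List.map_congr_left fun d _ => ?_
  simp only [Function.comp_apply, evalSample, weightSample_ofFn, ofList_ofFn, voteVal_eq,
    parity_sign, weightTerm, realVal]
  cases f (mixFst (mask m j) d) <;> cases f (mixSnd (mask m j) d) <;> simp

/-- All estimates of weights are accurate up to `thr / 2`. -/
def WeightsAccurate (f : Bits m → Bool) (M thr : ℝ) (ds : List (Draw m)) : Prop :=
  ∀ (j : Fin m) (a : Bits m), (∀ i, mask m j i = false → a i = false) →
    |(ds.map (weightTerm f (mask m j) a)).sum - M * weight f (mask m j) a| < thr / 2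

/-- Set bit `j` to one if `b` is true. -/
def extendBits (b : Bool) (j : ℕ) (a : Bits m) : Bits m :=
  fun i => a i || (b && decide ((i : ℕ) = j))

theorem extend_ofFn (b : Bool) (j : ℕ) (a : Bits m) :
    extend b (unitBits m j) (List.ofFn a) = List.ofFn (extendBits b j a) := by
  simp only [extend, unitBits, map_range_eq_ofFn, zip_ofFn, List.map_ofFn]
  rfl

theorem extendBits_false (j : ℕ) (a : Bits m) : extendBits false j a = a := by
  funext i; simp [extendBits]

/-- The state of the search after `k` rounds. -/
structure SearchInv (f : Bits m → Bool) (heavy : ℝ) (k : ℕ) (L : List (Bits m)) : Prop where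
  nodup : L.Nodup
  low : ∀ a ∈ L, ∀ i : Fin m, k ≤ i → a i = false
  sound : ∀ a ∈ L, ∃ s ∈ spectrum f, (fun i : Fin m => s i && decide ((i : ℕ) < k)) = a
  complete : ∀ s, heavy ≤ fourier f s ^ 2 → (fun i : Fin m => s i && decide ((i : ℕ) < k)) ∈ L

/-- Soundness places the distinct candidates among the prefixes of elements of the spectrum. -/
theorem SearchInv.length_le {f : Bits m → Bool} {heavy : ℝ} {k : ℕ} {L : List (Bits m)}
    (h : SearchInv f heavy k L) : L.length ≤ (spectrum f).card := by
  classical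
  rw [← List.toFinset_card_of_nodup h.nodup]
  refine (Finset.card_le_card (t := (spectrum f).image
    fun s => fun i : Fin m => s i && decide ((i : ℕ) < k)) fun a ha => ?_).trans
      Finset.card_image_le
  rw [List.mem_toFinset] at ha
  exact Finset.mem_image.2 (h.sound a ha)

/-- The gap between zero and `heavy` absorbs the error: a prefix of weight zero scores below thr/2
and is rejected, while one above a heavy coefficient scores more than 2thr - thr/2 and is kept.
Prefixes of intermediate weight may go either way; if kept, their weight is positive, which suffices
for soundness. -/
theorem searchStep_inv {f : Bits m → Bool} {ds : List (Draw m)} {thr cap : ℕ} {M heavy : ℝ}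
    (hthr : 0 < thr) (hM : 0 ≤ M) (hheavy : 2 * (thr : ℝ) ≤ M * heavy)
    (hacc : WeightsAccurate f M thr ds)
    (hcap : (spectrum f).card ≤ cap) (j : Fin m) {L : List (Bits m)} (h : SearchInv f heavy j L) :
    ∃ L', SearchInv f heavy (j + 1) L' ∧
      searchStep thr cap (L.map List.ofFn) (unitBits m j, weightData f ds j) =
        L'.map List.ofFn := by
  classical
  have hthr' : (0 : ℝ) < thr := by exact_mod_cast hthr
  let keep : Bits m → Bool := fun s => decide (negVotes (votes (List.ofFn s) (weightData f ds j)) +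
    thr ≤ posVotes (votes (List.ofFn s) (weightData f ds j)))
  have hkeep : ∀ s, keep s = true ↔ (thr : ℝ) ≤ (ds.map (weightTerm f (mask m j) s)).sum := by
    intro s
    rw [← weight_estimate]
    simp only [keep, decide_eq_true_eq]
    rw [← Nat.cast_le (α := ℝ)]
    push_cast
    constructor <;> intro h <;> linarith
  have hmask : ∀ i : Fin m, mask m j i = decide ((i : ℕ) < j + 1) := fun i => by
    simp [mask]
  let Cs : List (Bits m) := L ++ L.map (extendBits true j)
  have hlow : ∀ a ∈ Cs, ∀ i : Fin m, (j : ℕ) + 1 ≤ i → a i = false := by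
    intro a ha i hi
    rcases List.mem_append.1 ha with ha | ha
    · exact h.low a ha i (by omega)
    · obtain ⟨a', ha', rfl⟩ := List.mem_map.1 ha
      simp only [extendBits, h.low a' ha' i (by omega), Bool.true_and, Bool.false_or,
        decide_eq_false_iff_not]
      omega
  have hj : ∀ a ∈ L, a j = false := fun a ha => h.low a ha j le_rfl
  have hnodup : Cs.Nodup := by
    refine List.Nodup.append h.nodup ?_ ?_
    · refine List.Nodup.map_on ?_ h.nodup
      intro a ha b hb hab
      funext i
      by_cases hi : i = j
      · rw [hi, hj a ha, hj b hb]
      · have := congrFun hab i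
        have hi' : (i : ℕ) ≠ j := fun h => hi (Fin.ext h)
        simpa [extendBits, hi'] using this
    · intro a ha ha'
      obtain ⟨b, -, rfl⟩ := List.mem_map.1 ha'
      have := hj _ ha
      simp [extendBits] at this
  -- The accuracy hypothesis concerns only strings vanishing off the mask; the candidates of round
  -- `j` do.
  have hsupp : ∀ a ∈ Cs, ∀ i, mask m j i = false → a i = false := by
    intro a ha i hi
    rw [hmask, decide_eq_false_iff_not] at hi
    exact hlow a ha i (by omega)
  have hsound : ∀ a ∈ Cs, keep a = true → ∃ s ∈ spectrum f,
      (fun i : Fin m => s i && decide ((i : ℕ) < j + 1)) = a := by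
    intro a ha hk
    have h1 := (abs_lt.1 (hacc j a (hsupp a ha))).2
    have h2 := (hkeep a).1 hk
    have h3 : 0 < M * weight f (mask m j) a := by linarith
    obtain ⟨s, hs, hs'⟩ := exists_of_weight_pos (pos_of_mul_pos_right h3 hM)
    exact ⟨s, hs, funext fun i => by rw [← hmask, hs' i]⟩
  have hinv : SearchInv f heavy (j + 1) (Cs.filter keep) := by
    refine ⟨hnodup.filter _, fun a ha => hlow a (List.mem_of_mem_filter ha),
      fun a ha => hsound a (List.mem_of_mem_filter ha) (List.of_mem_filter ha), ?_⟩
    intro s hs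
    have hmem : (fun i : Fin m => s i && decide ((i : ℕ) < j + 1)) ∈ Cs := by
      have h1 := h.complete s hs
      cases hsj : s j
      · refine List.mem_append_left _ ?_
        convert h1 using 2 with i
        by_cases hi : i = j
        · rw [hi, hsj]; rfl
        · have hi' : (i : ℕ) ≠ j := fun h => hi (Fin.ext h)
          congr 2
          exact propext (by omega)
      · refine List.mem_append_right _ (List.mem_map.2 ⟨_, h1, ?_⟩)
        funext i
        by_cases hi : i = j
        · rw [hi]; simp [extendBits, hsj]
        · have hi' : (i : ℕ) ≠ j := fun h => hi (Fin.ext h)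
          simp only [extendBits, hi', decide_false, Bool.and_false, Bool.or_false]
          congr 2
          exact propext (by omega)
    refine List.mem_filter.2 ⟨hmem, (hkeep _).2 ?_⟩
    have h1 := (abs_lt.1 (hacc j _ (hsupp _ hmem))).1
    have h2 := weight_nonneg_term f (mask m j) (fun i : Fin m => s i && decide ((i : ℕ) < j + 1)) s
      fun i => by rw [hmask]
    have h3 := mul_le_mul_of_nonneg_left (hs.trans h2) hM
    linarith
  refine ⟨Cs.filter keep, hinv, ?_⟩
  have e1 : (L.map List.ofFn).map (extend false (unitBits m j)) ++
      (L.map List.ofFn).map (extend true (unitBits m j)) = Cs.map List.ofFn := by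
    simp only [List.map_map, Function.comp_def, extend_ofFn, extendBits_false, Cs, List.map_append]
  simp only [searchStep]
  -- By soundness the survivors number at most the sparsity, so the truncation is void.
  rw [e1, List.filter_map, List.take_of_length_le]
  · rfl
  · rw [List.length_map]
    exact hinv.length_le.trans hcap

/-- The search starts from the empty prefix, which is sound because a non-zero `f` has a non-empty
spectrum. After `m` rounds prefixes are full strings. -/
theorem search_correct {f : Bits m → Bool} {ds : List (Draw m)} {thr cap : ℕ} {M heavy : ℝ}
    (hf : ∃ x, f x = true) (hthr : 0 < thr) (hM : 0 ≤ M) (hheavy : 2 * (thr : ℝ) ≤ M * heavy)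
    (hacc : WeightsAccurate f M thr ds) (hcap : (spectrum f).card ≤ cap) :
    ∃ L : List (Bits m), SearchInv f heavy m L ∧
      search m thr cap ((List.range m).map (weightData f ds)) = L.map List.ofFn := by
  have hzip : ((List.range m).map (unitBits m)).zip ((List.range m).map (weightData f ds)) =
      (List.range m).map fun j => (unitBits m j, weightData f ds j) := by
    rw [List.zip_map']
  rw [search, hzip, List.foldl_map]
  suffices h : ∀ k ≤ m, ∃ L : List (Bits m), SearchInv f heavy k L ∧
      (List.range k).foldl (fun s j => searchStep thr cap s (unitBits m j, weightData f ds j))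
        [(List.range m).map fun _ => false] = L.map List.ofFn from h m le_rfl
  intro k hk
  induction k with
  | zero =>
    refine ⟨[fun _ => false], ⟨by simp, by simp, ?_, by simp⟩, ?_⟩
    · intro a ha
      rw [List.mem_singleton] at ha
      obtain ⟨x, hx⟩ := hf
      have h1 : realVal f x ≠ 0 := by simp [realVal, hx]
      rw [realVal_eq_sum] at h1
      obtain ⟨s, -, hs⟩ := Finset.exists_ne_zero_of_sum_ne_zero h1
      refine ⟨s, ?_, by simp [ha]⟩
      simp only [spectrum, Finset.mem_filter, Finset.mem_univ, true_and]
      exact left_ne_zero_of_mul hs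
    · simp
  | succ k ih =>
    obtain ⟨L, hL, he⟩ := ih (by omega)
    obtain ⟨L', hL', he'⟩ := searchStep_inv hthr hM hheavy hacc hcap ⟨k, by omega⟩ hL
    refine ⟨L', hL', ?_⟩
    rw [List.range_succ, List.foldl_append, he]
    exact he'

end

/-! ### The answers of the device -/

section
variable {n m : ℕ}

theorem rawGate_lift (g : Gate n) : rawGate g.lift = rawGate g := by cases g <;> rfl

theorem rawCircuit_lift (C : Circuit n) : rawCircuit C.lift = rawCircuit C := by
  simp [rawCircuit, Circuit.lift, Function.comp_def, rawGate_lift]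

theorem rawCircuit_inverse (C : Circuit n) :
    rawCircuit C.inverse = rawInverse (rawCircuit C) := by
  simp only [rawCircuit, Circuit.inverse, rawInverse, ← List.map_reverse, List.map_flatMap,
    List.flatMap_map]
  congr 1
  funext g
  cases g <;> rfl

theorem rawCircuit_testGate (C : Circuit n) (j : Fin n) :
    rawCircuit (testGate C j) = rawTestGate n (rawCircuit C) j := by
  have h1 : ∀ (g : Gate (n + 1)) c, rawCircuit (g :: c) = rawGate g :: rawCircuit c :=
    fun _ _ => rfl
  have h2 : ∀ c c' : Circuit (n + 1), rawCircuit (c ++ c') = rawCircuit c ++ rawCircuit c' :=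
    fun _ _ => List.map_append
  simp only [testGate, h1, h2, rawCircuit_inverse, rawCircuit_lift]
  rfl

theorem rawTest_eq (hmn : m ≤ n) (C : Circuit n) (s : Bits m) :
    rawTest m n (rawCircuit C) (List.ofFn s) = (testCircuit hmn C s).map rawCircuit := by
  have h : List.range m = List.ofFn fun i : Fin m => (i : ℕ) := by
    rw [← map_range_eq_ofFn m fun i => i]; simp
  rw [rawTest, h, zip_ofFn, List.ofFn_eq_map, List.flatMap_map, testCircuit, List.map_map,
    List.map_map]
  generalize List.finRange m = l
  induction l with
  | nil => rfl
  | cons j l ih =>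
    rw [List.flatMap_cons, ih, List.filter_cons]
    cases s j <;> simp [rawCircuit_testGate]

theorem enc_map_rawCircuit (Q : GateList n) : Enc.enc (Q.map rawCircuit) = encGateList Q := by
  induction Q with
  | nil => rfl
  | cons C Q ih =>
    rw [List.map_cons, enc_cons, ih, enc_rawCircuit]
    rfl

theorem foldl_last (y : Bits (n + 1)) :
    (List.ofFn y).foldl (fun _ b => b) false = y (Fin.last n) := by
  rw [List.ofFn_succ', List.concat_eq_append, List.foldl_append]
  rfl

end

section
variable {T : Polynomial ℕ}

/-- Membership in the spectrum bounds |s| by the degree, so the request is admissible; injectivity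
of the encoding makes the device decode exactly this circuit. -/
theorem answer_test (I : Instance T) {s : Bits I.m} (hs : s ∈ spectrum I.f) :
    answer I (rawTest I.m I.n (rawCircuit I.C) (List.ofFn s)) =
      ((measure (testCircuit I.hmn I.C s).flatten).map List.ofFn).map some := by
  have hinj : Function.Injective (encGateList (N := I.n + 1)) :=
    encList_injective encCircuit_injective
  have hc : (testCircuit I.hmn I.C s).IsCommuting (fourierDegree I.f) (1 + maxSupp I.hmn I.C) := by
    obtain ⟨h1, h2, h3⟩ := testCircuit_isCommuting I.hmn I.C s
    exact ⟨h1.trans (Finset.le_sup (f := fun s : Bits I.m => ∑ j, (s j).toNat) hs), h2, h3⟩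
  rw [rawTest_eq I.hmn, answer, enc_map_rawCircuit, Function.partialInv_left hinj]
  simp only [if_pos hc, PMF.map_comp]
  rfl

theorem seqPMF_zipWith {α β κ : Type} (E : κ → PMF α) (g : κ → α → β) (l : List κ) :
    seqPMF (fun k => (E k).map (g k)) l = (seqPMF E l).map (List.zipWith g l) := by
  induction l with
  | nil => simp [seqPMF, PMF.pure_map]
  | cons k l ih =>
    simp only [seqPMF, ih, PMF.bind_map, PMF.map_bind, PMF.map_comp]
    rfl

theorem mapListO_map {α β κ : Type} (F : α → PMF (Option β)) (g : κ → α) (l : List κ) :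
    mapListO F (l.map g) = mapListO (fun k => F (g k)) l := by
  induction l with
  | nil => rfl
  | cons k l ih => simp only [List.map_cons, mapListO, ih]

/-- The pairs of a candidate and a draw. -/
def pairs {m : ℕ} (L : List (Bits m)) (ds : List (Draw m)) : List (Bits m × Draw m) :=
  L.flatMap fun s => ds.map fun d => (s, d)

/-- The output, given the measurement outcomes. -/
def resultVotes {n m : ℕ} (f : Bits m → Bool) (l : List (Bits m × Draw m))
    (ys : List (Bits (n + 1))) : List (Bool × Bool) :=
  List.zipWith (fun k y => combine (coeffVote f k.1 k.2) (List.ofFn y)) l ys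

/-- When all candidates lie in the spectrum no request is refused, and the answers form a sequence
of independent measurements, one for each pair of a candidate and a draw. -/
theorem outcome_eq (pr : Params) (I : Instance T) (ds : List (Draw I.m)) {L : List (Bits I.m)}
    (hL : candidates pr I ds = L.map List.ofFn) (hsub : ∀ s ∈ L, s ∈ spectrum I.f) :
    outcome pr I ds =
      (seqPMF (fun k : Bits I.m × Draw I.m => measure (testCircuit I.hmn I.C k.1).flatten)
        (pairs L ds)).map fun ys => some (posVotes (resultVotes I.f (pairs L ds) ys) -
          negVotes (resultVotes I.f (pairs L ds) ys), pr.num.eval I.n) := by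
  have hreq : requests I.m I.n (rawCircuit I.C) (candidates pr I ds) (coeffData I.f ds) =
      (pairs L ds).map fun k => (coeffVote I.f k.1 k.2,
        rawTest I.m I.n (rawCircuit I.C) (List.ofFn k.1)) := by
    rw [requests, hL, pairs, List.flatMap_map, List.map_flatMap]
    congr 1
    funext s
    rw [votes_coeffData, List.map_map, List.map_map]
    rfl
  rw [outcome, hreq, mapListO_map]
  have h1 : mapListO (fun k : Bits I.m × Draw I.m => mapO (combine (coeffVote I.f k.1 k.2))
      (answer I (rawTest I.m I.n (rawCircuit I.C) (List.ofFn k.1)))) (pairs L ds) =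
      mapListO (fun k : Bits I.m × Draw I.m =>
        ((measure (testCircuit I.hmn I.C k.1).flatten).map fun y =>
          combine (coeffVote I.f k.1 k.2) (List.ofFn y)).map some) (pairs L ds) := by
    refine mapListO_congr fun k hk => ?_
    obtain ⟨s, hs, hk⟩ := List.mem_flatMap.1 hk
    obtain ⟨d, -, rfl⟩ := List.mem_map.1 hk
    rw [answer_test I (hsub s hs), mapO_map_some]
    simp only [PMF.map_comp]
    rfl
  rw [h1, mapListO_map_some fun k : Bits I.m × Draw I.m =>
    (measure (testCircuit I.hmn I.C k.1).flatten).map fun y =>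
      combine (coeffVote I.f k.1 k.2) (List.ofFn y), seqPMF_zipWith, mapO_map_some, PMF.map_comp,
    PMF.map_comp]
  rfl

/-! ### Accuracy of the output -/

/-- The contribution of a measurement outcome. -/
def outcomeTerm {n m : ℕ} (f : Bits m → Bool) (k : Bits m × Draw m) (y : Bits (n + 1)) : ℝ :=
  coeffTerm f k.1 k.2 * if y (Fin.last n) then -1 else 1

theorem abs_outcomeTerm_le {n m : ℕ} (f : Bits m → Bool) (k : Bits m × Draw m)
    (y : Bits (n + 1)) : |outcomeTerm f k y| ≤ 1 := by
  rw [outcomeTerm, abs_mul]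
  have : |(if y (Fin.last n) then (-1 : ℝ) else 1)| = 1 := by split_ifs <;> simp
  rw [this, mul_one]
  exact abs_coeffTerm_le _ _ _

theorem resultVotes_sum {n m : ℕ} (f : Bits m → Bool) (l : List (Bits m × Draw m))
    (ys : List (Bits (n + 1))) :
    (posVotes (resultVotes f l ys) : ℝ) - negVotes (resultVotes f l ys) =
      (List.zipWith (outcomeTerm f) l ys).sum := by
  rw [posVotes_sub_negVotes, resultVotes, List.map_zipWith]
  congr 2
  funext k y
  rw [outcomeTerm, ← voteVal_coeffVote]
  obtain ⟨s, d⟩ := k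
  simp only [combine, foldl_last]
  generalize coeffVote f s d = w
  obtain ⟨a, b⟩ := w
  cases a <;> cases b <;> cases y (Fin.last n) <;> simp [voteVal]

theorem sum_zipWith_sub {κ α : Type} (g : κ → α → ℝ) (mu : κ → ℝ) (l : List κ) (r : List α)
    (h : r.length = l.length) : (List.zipWith (fun k a => g k a - mu k) l r).sum =
      (List.zipWith g l r).sum - (l.map mu).sum := by
  induction l generalizing r with
  | nil => simp
  | cons k l ih =>
    cases r with
    | nil => simp at h
    | cons a r =>
      simp only [List.zipWith_cons_cons, List.sum_cons, List.map_cons,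
        ih r (by simpa using h)]
      ring

theorem sum_pairs {m : ℕ} (F : Bits m × Draw m → ℝ) (L : List (Bits m)) (ds : List (Draw m)) :
    ((pairs L ds).map F).sum = (L.map fun s => (ds.map fun d => F (s, d)).sum).sum := by
  induction L with
  | nil => simp [pairs]
  | cons s L ih =>
    simp only [pairs, List.flatMap_cons, List.map_append, List.sum_append, List.map_cons,
      List.sum_cons, List.map_map] at ih ⊢
    rw [ih]
    rfl

theorem length_pairs {m : ℕ} (L : List (Bits m)) (ds : List (Draw m)) :
    (pairs L ds).length = L.length * ds.length := by
  simp [pairs, List.length_flatMap]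

/-- All estimates of Fourier coefficients are accurate up to `thr / 2`. -/
def CoeffsAccurate {m : ℕ} (f : Bits m → Bool) (M thr : ℝ) (ds : List (Draw m)) : Prop :=
  ∀ s : Bits m, |(ds.map (coeffTerm f s)).sum - M * fourier f s| < thr / 2

/-- The error made by replacing the Fourier coefficients by their estimates. -/
theorem classical_error {n m : ℕ} (hmn : m ≤ n) (C : Circuit n) (f : Bits m → Bool)
    {L : List (Bits m)} {ds : List (Draw m)} {M thr theta : ℝ} (hM : 0 ≤ M) (hthr : 0 ≤ thr)
    (htheta : 0 ≤ theta)
    (hL : SearchInv f (theta ^ 2) m L) (hacc : CoeffsAccurate f M thr ds) :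
    |((pairs L ds).map fun k => coeffTerm f k.1 k.2 * charMean hmn C k.1).sum -
      M * acceptProb hmn C f| ≤ (spectrum f).card * (thr / 2) + M * ((spectrum f).card * theta) := by
  classical
  have hfull : ∀ s : Bits m, (fun i : Fin m => s i && decide ((i : ℕ) < m)) = s := fun s =>
    funext fun i => by simp
  have hsub : L.toFinset ⊆ spectrum f := by
    intro a ha
    obtain ⟨s, hs, h⟩ := hL.sound a (List.mem_toFinset.1 ha)
    rw [hfull s] at h
    rwa [← h]
  -- Completeness, read backwards: whatever the search missed is light.
  have hheavy : ∀ s, s ∉ L.toFinset → |fourier f s| ≤ theta := by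
    intro s hs
    by_contra hlt
    rw [not_le] at hlt
    refine hs (List.mem_toFinset.2 ?_)
    have := hL.complete s (by rw [← sq_abs (fourier f s)]; gcongr)
    rwa [hfull s] at this
  have e1 : ((pairs L ds).map fun k => coeffTerm f k.1 k.2 * charMean hmn C k.1).sum =
      ∑ s ∈ L.toFinset, (ds.map (coeffTerm f s)).sum * charMean hmn C s := by
    rw [sum_pairs, List.sum_toFinset _ hL.nodup]
    simp only [List.sum_map_mul_right]
  have e2 : acceptProb hmn C f = ∑ s ∈ spectrum f, fourier f s * charMean hmn C s := by
    rw [acceptProb_eq_sum_fourier]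
    symm
    refine Finset.sum_subset (Finset.subset_univ _) fun s _ hs => ?_
    simp only [spectrum, Finset.mem_filter, Finset.mem_univ, true_and, not_not] at hs
    rw [hs, zero_mul]
  -- The error splits into the estimation error on the candidates and the light coefficients
  -- omitted; in both, the quantum mean is at most 1 in absolute value.
  rw [e1, e2, ← Finset.sum_sdiff hsub, mul_add, Finset.mul_sum, Finset.mul_sum]
  have e3 : |∑ s ∈ L.toFinset, ((ds.map (coeffTerm f s)).sum * charMean hmn C s -
      M * (fourier f s * charMean hmn C s))| ≤ (spectrum f).card * (thr / 2) := by
    refine (Finset.abs_sum_le_sum_abs _ _).trans ?_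
    calc _ ≤ ∑ s ∈ L.toFinset, thr / 2 := Finset.sum_le_sum fun s _ => by
          rw [show (ds.map (coeffTerm f s)).sum * charMean hmn C s -
            M * (fourier f s * charMean hmn C s) =
            ((ds.map (coeffTerm f s)).sum - M * fourier f s) * charMean hmn C s by ring, abs_mul]
          exact (mul_le_of_le_one_right (abs_nonneg _) (abs_charMean_le hmn C s)).trans
            (hacc s).le
      _ = L.toFinset.card * (thr / 2) := by simp
      _ ≤ _ := by
        gcongr
  have e4 : |∑ s ∈ spectrum f \ L.toFinset, M * (fourier f s * charMean hmn C s)| ≤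
      M * ((spectrum f).card * theta) := by
    refine (Finset.abs_sum_le_sum_abs _ _).trans ?_
    calc _ ≤ ∑ s ∈ spectrum f \ L.toFinset, M * theta := Finset.sum_le_sum fun s hs => by
          rw [abs_mul, abs_mul, abs_of_nonneg hM]
          refine mul_le_mul_of_nonneg_left ?_ hM
          exact (mul_le_of_le_one_right (abs_nonneg _) (abs_charMean_le hmn C s)).trans
            (hheavy s (Finset.mem_sdiff.1 hs).2)
      _ = (spectrum f \ L.toFinset).card * (M * theta) := by simp
      _ ≤ (spectrum f).card * (M * theta) := by
        gcongr
        exact Finset.sdiff_subset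
      _ = _ := by ring
  rw [Finset.sum_sub_distrib] at e3
  rw [abs_le] at *
  constructor <;> linarith

end

/-! ### Success probability -/

section
variable {m : ℕ}

theorem zipWith_units {α β : Type} (g : α → β) (r : List α) :
    List.zipWith (fun (_ : Unit) a => g a) (List.replicate r.length ()) r = r.map g := by
  induction r with
  | nil => rfl
  | cons a r ih => simp [List.replicate_succ, ih]

/-- The mean over the draws is estimated accurately. -/
theorem estimate_tail_le (g : Draw m → ℝ) (hg : ∀ d, |g d| ≤ 1) (mu : ℝ)
    (hmu : ∑ d, (1 / 8 ^ m : ℝ) * g d = mu) {M : ℕ} (hM : 0 < M) {d : ℝ} (hd : 0 ≤ d)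
    (hdM : d ≤ 4 * M) :
    (seqPMF (fun _ : Unit => PMF.uniformOfFintype (Draw m)) (List.replicate M ())).toOuterMeasure
      {ds | d ≤ |(ds.map g).sum - M * mu|} ≤
      2 * ENNReal.ofReal (Real.exp (-(d ^ 2 / (16 * M)))) := by
  have hunif : ∀ w : Draw m, (PMF.uniformOfFintype (Draw m) w).toReal = 1 / 8 ^ m := by
    intro w
    rw [PMF.uniformOfFintype_apply, ENNReal.toReal_inv, ENNReal.toReal_natCast]
    simp
  have h := seqPMF_tail_le (fun _ : Unit => PMF.uniformOfFintype (Draw m)) (fun _ => g)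
    (fun _ => hg) (fun _ => mu) (fun _ => by simp only [hunif]; exact hmu) (List.replicate M ())
    (K := M) (d := d) (by exact_mod_cast hM) (by simp) hd hdM
  -- Only lists in the support have to be compared; they have length `M`, which identifies the
  -- `zipWith` over units with a `map`.
  refine le_trans (PMF.toOuterMeasure_mono _ ?_) h
  rintro ds ⟨h1, h2⟩
  have hlen := length_of_mem_support_seqPMF h2
  rw [Set.mem_ofPred_eq, sum_zipWith_sub _ _ _ _ hlen]
  rw [List.length_replicate] at hlen
  subst hlen
  rw [zipWith_units]
  simpa using h1

/-- A union bound over 2^m coefficients and over m masks with 2^m strings each. The exponential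
number of events is absorbed by the exponent chosen later. -/
theorem accurate_tail_le (f : Bits m → Bool) {M : ℕ} (hM : 0 < M) {thr : ℝ} (hthr : 0 ≤ thr)
    (hthrM : thr / 2 ≤ 4 * M) :
    (seqPMF (fun _ : Unit => PMF.uniformOfFintype (Draw m)) (List.replicate M ())).toOuterMeasure
      {ds | ¬ (WeightsAccurate f M thr ds ∧ CoeffsAccurate f M thr ds)} ≤
      ((m + 1) * 2 ^ m : ℕ) * (2 * ENNReal.ofReal (Real.exp (-((thr / 2) ^ 2 / (16 * M))))) := by
  let B : Option (Fin m) × Bits m → Set (List (Draw m)) := fun x => match x with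
    | (none, s) => {ds | thr / 2 ≤ |(ds.map (coeffTerm f s)).sum - M * fourier f s|}
    | (some j, a) => {ds | (∀ i, mask m j i = false → a i = false) ∧
        thr / 2 ≤ |(ds.map (weightTerm f (mask m j) a)).sum - M * weight f (mask m j) a|}
  have hB : {ds | ¬ (WeightsAccurate f M thr ds ∧ CoeffsAccurate f M thr ds)} ⊆ ⋃ x, B x := by
    intro ds hds
    rw [Set.mem_ofPred_eq, not_and_or] at hds
    rw [Set.mem_iUnion]
    rcases hds with h | h
    · simp only [WeightsAccurate, not_forall, not_lt] at h
      obtain ⟨j, a, h1, h2⟩ := h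
      exact ⟨(some j, a), h1, h2⟩
    · simp only [CoeffsAccurate, not_forall, not_lt] at h
      obtain ⟨s, h⟩ := h
      exact ⟨(none, s), h⟩
  refine (MeasureTheory.measure_mono hB).trans
    ((MeasureTheory.measure_iUnion_fintype_le _ _).trans ?_)
  have hcard : ((m + 1) * 2 ^ m : ℕ) = Fintype.card (Option (Fin m) × Bits m) := by simp
  rw [hcard, ← nsmul_eq_mul, ← Finset.card_univ, ← Finset.sum_const]
  refine Finset.sum_le_sum fun x _ => ?_
  obtain ⟨o, a⟩ := x
  cases o with
  | none =>
    exact estimate_tail_le (coeffTerm f a) (abs_coeffTerm_le f a) _ (coeff_mean f a) hM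
      (by positivity) hthrM
  | some j =>
    by_cases ha : ∀ i, mask m j i = false → a i = false
    · refine le_trans (MeasureTheory.measure_mono fun ds hds => ?_)
        (estimate_tail_le (weightTerm f (mask m j) a) (abs_weightTerm_le f _ a) _
          (weight_mean f (mask m j) a ha) hM (by positivity) hthrM)
      exact hds.2
    · have : B (some j, a) = ∅ := Set.eq_empty_of_forall_notMem fun ds hds => ha hds.1
      rw [this, MeasureTheory.measure_empty]
      exact zero_le

end

/-- The outputs that are close to `p`. -/
def goodOutputs (p ε : ℝ) : Set (Option (ℕ × ℕ)) :=
  {o | ∃ a b : ℕ, 0 < b ∧ o = some (a, b) ∧ |p - (a : ℝ) / (b : ℝ)| ≤ ε}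

/-- Truncating a negative estimate to zero only brings it closer to p, which is non-negative. -/
theorem abs_sub_truncated_le {p M e : ℝ} {a b : ℕ} (hp : 0 ≤ p) (hM : 0 < M)
    (h : |((a : ℝ) - b) - M * p| ≤ M * e) : |p - ((a - b : ℕ) : ℝ) / M| ≤ e := by
  have h1 := abs_le.1 h
  have hMp : 0 ≤ M * p := mul_nonneg hM.le hp
  have key : |M * p - ((a - b : ℕ) : ℝ)| ≤ M * e := by
    rcases le_total b a with hab | hab
    · rw [Nat.cast_sub hab, abs_sub_comm]; exact h
    · rw [Nat.sub_eq_zero_of_le hab, Nat.cast_zero, sub_zero, abs_of_nonneg hMp]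
      have : (a : ℝ) ≤ b := by exact_mod_cast hab
      linarith
  have e1 : p - ((a - b : ℕ) : ℝ) / M = (M * p - ((a - b : ℕ) : ℝ)) / M := by
    field_simp
  rw [e1, abs_div, abs_of_pos hM, div_le_iff₀ hM, mul_comm e]
  exact key

section
variable {T : Polynomial ℕ}

/-- Before division by M the permitted error is M/Q. Estimated coefficients, omitted light
coefficients and the fluctuation of the measurements use at most M/(4Q) each. The measurements are
at most cap·M independent terms, whence the exponent. -/
theorem outcome_tail_le (pr : Params) (I : Instance T) {ds : List (Draw I.m)} {M thr cap : ℕ}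
    {Q theta : ℝ} (hpM : pr.num.eval I.n = M) (hpt : pr.thr.eval I.n = thr)
    (hpc : pr.cap.eval I.n = cap) (hf : ∃ x, I.f x = true)
    (hlen : ds.length = M) (hM : 0 < M) (hthr : 0 < thr) (hcap0 : 0 < cap) (hQ : 1 ≤ Q)
    (htheta : 0 ≤ theta) (hcap : (spectrum I.f).card ≤ cap)
    (h1 : 2 * (thr : ℝ) ≤ M * theta ^ 2) (h2 : (cap : ℝ) * (thr / 2) ≤ M / (4 * Q))
    (h3 : (cap : ℝ) * theta ≤ 1 / (4 * Q))
    (hW : WeightsAccurate I.f M thr ds) (hC : CoeffsAccurate I.f M thr ds) :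
    (outcome pr I ds).toOuterMeasure (goodOutputs (acceptProb I.hmn I.C I.f) (1 / Q))ᶜ ≤
      2 * ENNReal.ofReal (Real.exp (-((M / (4 * Q)) ^ 2 / (16 * (cap * M))))) := by
  have hM' : (0 : ℝ) < M := by exact_mod_cast hM
  have hcap0' : (1 : ℝ) ≤ cap := by exact_mod_cast hcap0
  have hcap' : ((spectrum I.f).card : ℝ) ≤ cap := by exact_mod_cast hcap
  obtain ⟨L, hL, hsearch⟩ := search_correct hf hthr hM'.le h1 hW hcap
  have hcand : candidates pr I ds = L.map List.ofFn := by
    rw [candidates, hpt, hpc, hsearch]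
  have hsub : ∀ s ∈ L, s ∈ spectrum I.f := by
    intro a ha
    obtain ⟨s, hs, h⟩ := hL.sound a ha
    have : (fun i : Fin I.m => s i && decide ((i : ℕ) < I.m)) = s := funext fun i => by simp
    rwa [← h, this]
  rw [outcome_eq pr I ds hcand hsub, PMF.toOuterMeasure_map_apply]
  have hK : ((pairs L ds).length : ℝ) ≤ cap * M := by
    rw [length_pairs, hlen]
    push_cast
    have : (L.length : ℝ) ≤ cap := by exact_mod_cast hL.length_le.trans hcap
    gcongr
  have htail := seqPMF_tail_le
    (fun k : Bits I.m × Draw I.m => measure (testCircuit I.hmn I.C k.1).flatten)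
    (outcomeTerm I.f) (abs_outcomeTerm_le I.f)
    (fun k => coeffTerm I.f k.1 k.2 * charMean I.hmn I.C k.1) (fun k => by
      rw [← testCircuit_mean, Finset.mul_sum]
      exact Finset.sum_congr rfl fun y _ => by rw [outcomeTerm]; ring)
    (pairs L ds) (K := cap * M) (d := M / (4 * Q)) (by positivity) hK (by positivity) (by
      rw [div_le_iff₀ (by positivity)]
      have : 1 ≤ (cap : ℝ) * Q := one_le_mul_of_one_le_of_one_le hcap0' hQ
      nlinarith)
  refine le_trans (PMF.toOuterMeasure_mono _ ?_) htail
  rintro ys ⟨hbad, hsupp⟩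
  rw [Set.mem_ofPred_eq, sum_zipWith_sub _ _ _ _ (length_of_mem_support_seqPMF hsupp)]
  by_contra hlt
  rw [not_le] at hlt
  refine hbad ⟨_, M, hM, by rw [← hpM], ?_⟩
  refine abs_sub_truncated_le (acceptProb_nonneg _ _ _) hM' ?_
  rw [resultVotes_sum]
  have hcl := classical_error I.hmn I.C I.f hM'.le (Nat.cast_nonneg thr) htheta hL hC
  have e1 : ((spectrum I.f).card : ℝ) * (thr / 2) ≤ M / (4 * Q) :=
    (mul_le_mul_of_nonneg_right hcap' (by positivity)).trans h2
  have e2 : (M : ℝ) * ((spectrum I.f).card * theta) ≤ M * (1 / (4 * Q)) :=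
    mul_le_mul_of_nonneg_left ((mul_le_mul_of_nonneg_right hcap' htheta).trans h3) hM'.le
  have e3 : (M : ℝ) * (1 / Q) = 4 * (M / (4 * Q)) := by field_simp
  have e4 : (M : ℝ) * (1 / (4 * Q)) = M / (4 * Q) := by field_simp
  have e5 : 0 ≤ (M : ℝ) / (4 * Q) := by positivity
  rw [e3]
  rw [e4] at e2
  rw [abs_le] at hcl ⊢
  rw [abs_lt] at hlt
  constructor <;> linarith [hcl.1, hcl.2, hlt.1, hlt.2]

theorem expect_mono_support {α : Type} (D : PMF α) {F G : α → ENNReal}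
    (h : ∀ a ∈ D.support, F a ≤ G a) : expect D F ≤ expect D G := by
  refine ENNReal.tsum_le_tsum fun a => ?_
  by_cases ha : a ∈ D.support
  · exact mul_le_mul_right (h a ha) _
  · rw [PMF.mem_support_iff, not_not] at ha
    simp [ha]

/-- A two-stage failure bound: the first stage goes wrong, or it succeeds and the second fails
conditionally. -/
theorem toOuterMeasure_bind_le {α β : Type} (D : PMF α) (k : α → PMF β) (S : Set α) (G : Set β)
    {c c' : ENNReal} (hS : D.toOuterMeasure S ≤ c)
    (hk : ∀ a ∈ D.support, a ∉ S → (k a).toOuterMeasure G ≤ c') :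
    (D.bind k).toOuterMeasure G ≤ c + c' := by
  have hone : ∀ (E : PMF β), E.toOuterMeasure G ≤ 1 := fun E => by
    rw [PMF.toOuterMeasure_apply, ← E.tsum_coe]
    exact ENNReal.tsum_le_tsum fun b => Set.indicator_le_self _ _ _
  rw [PMF.toOuterMeasure_bind_apply]
  calc ∑' a, D a * (k a).toOuterMeasure G = expect D fun a => (k a).toOuterMeasure G := rfl
    _ ≤ expect D fun a => S.indicator (fun _ => 1) a + c' := by
      refine expect_mono_support D fun a ha => ?_
      by_cases h : a ∈ S
      · simp only [h, Set.indicator_of_mem]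
        exact (hone _).trans le_self_add
      · simp only [h, not_false_eq_true, Set.indicator_of_notMem, zero_add]
        exact hk a ha h
    _ = D.toOuterMeasure S + c' := by
      rw [toOuterMeasure_eq_expect]
      simp only [expect, mul_add, ENNReal.tsum_add, ENNReal.tsum_mul_right, D.tsum_coe, one_mul]
    _ ≤ c + c' := add_le_add_left hS _

theorem toOuterMeasure_add_compl {α : Type} (D : PMF α) (S : Set α) :
    D.toOuterMeasure S + D.toOuterMeasure Sᶜ = 1 := by
  rw [PMF.toOuterMeasure_apply, PMF.toOuterMeasure_apply, ← ENNReal.tsum_add, ← D.tsum_coe]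
  exact tsum_congr fun a => by
    by_cases h : a ∈ S <;> simp [h]

/-- The number of events is at most exp(2n + 2), because m + 1 and 2^m are both at most exp m; the
factor exp(-(4n + 4)) leaves room. -/
theorem failure_bound_lt {m n : ℕ} (hmn : m ≤ n) :
    (((m + 1) * 2 ^ m : ℕ) * 2 + 2 : ℝ) * Real.exp (-(4 * n + 4)) < 1 / Real.exp n := by
  have h1 : ((m + 1 : ℕ) : ℝ) ≤ Real.exp m := by
    push_cast; exact Real.add_one_le_exp _
  have h2 : (2 : ℝ) ≤ Real.exp 1 := by
    have := Real.add_one_le_exp (1 : ℝ); linarith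
  have h3 : (2 : ℝ) ^ m ≤ Real.exp m := by
    calc (2 : ℝ) ^ m ≤ Real.exp 1 ^ m := by gcongr
      _ = Real.exp m := by rw [← Real.exp_nat_mul, mul_one]
  have hmn' : (m : ℝ) ≤ n := by exact_mod_cast hmn
  have h4 : (((m + 1) * 2 ^ m : ℕ) * 2 + 2 : ℝ) ≤ Real.exp (2 * n + 2) := by
    have e1 : (((m + 1) * 2 ^ m : ℕ) : ℝ) ≤ Real.exp (2 * n) := by
      rw [Nat.cast_mul, Nat.cast_pow, Nat.cast_ofNat]
      calc _ ≤ Real.exp m * Real.exp m := mul_le_mul h1 h3 (by positivity) (by positivity)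
        _ = Real.exp (2 * m) := by rw [← Real.exp_add]; ring_nf
        _ ≤ _ := Real.exp_le_exp.2 (by linarith)
    have e2 : (1 : ℝ) ≤ Real.exp (2 * n) := Real.one_le_exp (by positivity)
    have e3 : Real.exp (2 * n + 2) = Real.exp (2 * n) * (Real.exp 1 * Real.exp 1) := by
      rw [← Real.exp_add, ← Real.exp_add]; ring_nf
    have e4 : (4 : ℝ) ≤ Real.exp 1 * Real.exp 1 := by nlinarith
    have e5 := mul_le_mul_of_nonneg_left e4 (Real.exp_nonneg (2 * (n : ℝ)))
    rw [e3]
    linarith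
  calc _ ≤ Real.exp (2 * n + 2) * Real.exp (-(4 * n + 4)) := by gcongr
    _ = Real.exp (-(2 * n + 2)) := by rw [← Real.exp_add]; ring_nf
    _ < Real.exp (-n) := Real.exp_lt_exp.2 (by linarith [Nat.cast_nonneg (α := ℝ) n])
    _ = _ := by rw [Real.exp_neg, one_div]

/-- The parameters of the algorithm for accuracy `1 / q`. -/
def algParams (q sparsity : Polynomial ℕ) : Params where
  -- With S = `sparsity + 1` and θ = 1/(4qS), the recurring factor Θ = 16q²S² is 1/θ². The choice
  -- num = 2Θ·thr gives num·θ² = 2thr, as the search requires, and thr = 128Θ(4n + 4) makes the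
  -- exponent (thr/2)²/(16num) of the classical estimates equal to 4n + 4.
  num := 2 * (16 * q ^ 2 * (sparsity + 1) ^ 2) *
    (128 * (16 * q ^ 2 * (sparsity + 1) ^ 2) * (4 * Polynomial.X + 4))
  thr := 128 * (16 * q ^ 2 * (sparsity + 1) ^ 2) * (4 * Polynomial.X + 4)
  cap := sparsity + 1

theorem success_prob (q sparsity : Polynomial ℕ) (I : Instance T) (hq : 0 < q.eval I.n)
    (hf : ∃ x, I.f x = true) (hs : (spectrum I.f).card ≤ sparsity.eval I.m) :
    (((draws (algParams q sparsity) I).bind (outcome (algParams q sparsity) I)).toOuterMeasure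
      (goodOutputs (acceptProb I.hmn I.C I.f) (1 / (q.eval I.n : ℕ)))).toReal >
      1 - 1 / Real.exp I.n := by
  set pr := algParams q sparsity with hpr
  set Q : ℕ := q.eval I.n with hQ
  set S : ℕ := sparsity.eval I.n + 1 with hS
  set Θ : ℕ := 16 * Q ^ 2 * S ^ 2 with hΘ
  set thr : ℕ := 128 * Θ * (4 * I.n + 4) with hthr
  set M : ℕ := 2 * Θ * thr with hM
  have hpM : pr.num.eval I.n = M := by
    simp [hpr, algParams, hM, hthr, hΘ, hS, hQ]
  have hpt : pr.thr.eval I.n = thr := by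
    simp [hpr, algParams, hthr, hΘ, hS, hQ]
  have hpc : pr.cap.eval I.n = S := by
    simp [hpr, algParams, hS]
  have hS0 : 0 < S := Nat.succ_pos _
  have hΘ0 : 0 < Θ := by positivity
  have hthr0 : 0 < thr := by positivity
  have hM0 : 0 < M := by positivity
  have hcap : (spectrum I.f).card ≤ S :=
    hs.trans ((eval_mono _ I.hmn).trans (Nat.le_succ _))
  have hQr : (1 : ℝ) ≤ Q := by exact_mod_cast hq
  have hSr : (1 : ℝ) ≤ S := by exact_mod_cast hS0
  have hΘr : (Θ : ℝ) = 16 * Q ^ 2 * S ^ 2 := by rw [hΘ]; push_cast; ring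
  have hthrr : (thr : ℝ) = 128 * Θ * (4 * I.n + 4) := by rw [hthr]; push_cast; ring
  have hMr : (M : ℝ) = 2 * Θ * thr := by rw [hM]; push_cast; ring
  have hΘpos : (0 : ℝ) < Θ := by exact_mod_cast hΘ0
  have hthrpos : (0 : ℝ) < thr := by exact_mod_cast hthr0
  have hMpos : (0 : ℝ) < M := by exact_mod_cast hM0
  have hΘ1 : (1 : ℝ) ≤ Θ := by exact_mod_cast hΘ0
  set δ : ENNReal := ENNReal.ofReal (Real.exp (-(4 * I.n + 4))) with hδ
  have hdraws : (draws pr I).toOuterMeasure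
      {ds | ¬ (WeightsAccurate I.f M thr ds ∧ CoeffsAccurate I.f M thr ds)} ≤
      ((I.m + 1) * 2 ^ I.m : ℕ) * (2 * δ) := by
    have h := accurate_tail_le I.f (M := M) hM0 (thr := thr) hthrpos.le (by
      rw [hMr]; nlinarith)
    have e : ((thr : ℝ) / 2) ^ 2 / (16 * M) = 4 * I.n + 4 := by
      rw [hMr, div_eq_iff (by positivity)]
      have : (thr : ℝ) ^ 2 = thr * (128 * Θ * (4 * I.n + 4)) := by rw [← hthrr]; ring
      rw [div_pow, this]; ring
    rw [e] at h
    rw [draws, hpM]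
    exact h
  have hfail := toOuterMeasure_bind_le (draws pr I) (outcome pr I) _
    (goodOutputs (acceptProb I.hmn I.C I.f) (1 / (Q : ℝ)))ᶜ hdraws (c' := 2 * δ) (by
      intro ds hds hgood
      have hgood' : WeightsAccurate I.f M thr ds ∧ CoeffsAccurate I.f M thr ds :=
        not_not.1 hgood
      have hlen : ds.length = M := by
        rw [draws, hpM] at hds
        rw [length_of_mem_support_seqPMF hds, List.length_replicate]
      refine (outcome_tail_le pr I (theta := 1 / (4 * Q * S)) (Q := Q) hpM hpt hpc hf hlen hM0 hthr0
        hS0 hQr (by positivity) hcap ?_ ?_ ?_ hgood'.1 hgood'.2).trans ?_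
      · rw [hMr, hΘr]
        apply le_of_eq
        field_simp
        norm_num
      · rw [hMr, hΘr, le_div_iff₀ (by positivity)]
        have : 1 ≤ (Q : ℝ) * S := one_le_mul_of_one_le_of_one_le hQr hSr
        have h4 : (0 : ℝ) ≤ Q * S * thr := by positivity
        nlinarith
      · apply le_of_eq
        field_simp
      -- The exponent of the quantum stage is M/(256Q²S). Since M = 256Θ²(4n + 4) and Q²S ≤ Θ², it
      -- is at least 4n + 4 too.
      · refine mul_le_mul_right (ENNReal.ofReal_le_ofReal (Real.exp_le_exp.2 (neg_le_neg ?_))) _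
        rw [le_div_iff₀ (by positivity), div_pow, le_div_iff₀ (by positivity)]
        have e1 : (M : ℝ) = 256 * Θ ^ 2 * (4 * I.n + 4) := by rw [hMr, hthrr]; ring
        have e2 : (Q : ℝ) ^ 2 * S ≤ Θ ^ 2 := by
          have : (Q : ℝ) ^ 2 * S ≤ Θ := by
            rw [hΘr]; nlinarith [sq_nonneg (Q : ℝ), mul_nonneg (sq_nonneg (Q : ℝ)) (zero_le_one.trans hSr)]
          nlinarith
        calc (4 * (I.n : ℝ) + 4) * (16 * ((S : ℝ) * M)) * (4 * (Q : ℝ)) ^ 2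
            = (256 * ((Q : ℝ) ^ 2 * S) * (4 * I.n + 4)) * M := by ring
          _ ≤ (256 * (Θ : ℝ) ^ 2 * (4 * I.n + 4)) * M := by gcongr
          _ = (M : ℝ) ^ 2 := by rw [← e1]; ring)
  have hsum := toOuterMeasure_add_compl ((draws pr I).bind (outcome pr I))
    (goodOutputs (acceptProb I.hmn I.C I.f) (1 / (Q : ℝ)))
  set x := ((draws pr I).bind (outcome pr I)).toOuterMeasure
    (goodOutputs (acceptProb I.hmn I.C I.f) (1 / (Q : ℝ))) with hx
  set y := ((draws pr I).bind (outcome pr I)).toOuterMeasure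
    (goodOutputs (acceptProb I.hmn I.C I.f) (1 / (Q : ℝ)))ᶜ with hy
  have hxt : x ≠ ⊤ := fun h => by rw [h, top_add] at hsum; exact ENNReal.top_ne_one hsum
  have hyt : y ≠ ⊤ := fun h => by rw [h, add_top] at hsum; exact ENNReal.top_ne_one hsum
  have hsum' : x.toReal + y.toReal = 1 := by
    rw [← ENNReal.toReal_add hxt hyt, hsum, ENNReal.toReal_one]
  have hδt : δ ≠ ⊤ := ENNReal.ofReal_ne_top
  have hδr : δ.toReal = Real.exp (-(4 * I.n + 4)) := ENNReal.toReal_ofReal (Real.exp_nonneg _)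
  have hyle : y.toReal ≤ (((I.m + 1) * 2 ^ I.m : ℕ) * 2 + 2 : ℝ) *
      Real.exp (-(4 * I.n + 4)) := by
    have h := ENNReal.toReal_mono (ENNReal.add_ne_top.2
      ⟨ENNReal.mul_ne_top (ENNReal.natCast_ne_top _) (ENNReal.mul_ne_top (by simp) hδt),
        ENNReal.mul_ne_top (by simp) hδt⟩) hfail
    rw [ENNReal.toReal_add (ENNReal.mul_ne_top (ENNReal.natCast_ne_top _)
      (ENNReal.mul_ne_top (by simp) hδt)) (ENNReal.mul_ne_top (by simp) hδt)] at h
    simp only [ENNReal.toReal_mul, ENNReal.toReal_natCast, hδr, ENNReal.toReal_ofNat] at h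
    linarith
  have := failure_bound_lt I.hmn
  linarith

end

end

end SCP


theorem theorem2 (d : ℕ) (q r size sparsity T : Polynomial ℕ)
    (hq : ∀ n : ℕ, 0 < n → 0 < q.eval n) :
    ∃ (A : SCP.Prog) (R : Polynomial ℕ),
      ∀ (n m : ℕ) (_ : 0 < m) (hmn : m ≤ n) (_ : n ≤ r.eval m)
        (C : SCP.Circuit n) (_ : C.length ≤ size.eval n) (_ : C.DepthLE d)
        (f : SCP.Bits m → Bool) (_ : ∃ x, f x = true)
        (_ : (SCP.spectrum f).card ≤ sparsity.eval m)
        (P : SCP.Prog) (_ : SCP.Evaluates P f (T.eval m)),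
        A.RunsInTime P m C (SCP.fourierDegree f) (1 + SCP.maxSupp hmn C) (R.eval n) ∧
        ((A.runs P m C (SCP.fourierDegree f) (1 + SCP.maxSupp hmn C)
            (R.eval n)).toOuterMeasure
          (SCP.goodRuns (SCP.acceptProb hmn C f) (1 / ((q.eval n : ℕ) : ℝ)))).toReal
          > 1 - 1 / Real.exp n ∧
        1 + SCP.maxSupp hmn C ≤ 2 ^ d + 1 := by
  obtain ⟨A, R, h⟩ := SCP.exists_algorithm (T := T) (SCP.algParams q sparsity) size
  refine ⟨A, R, fun n m hm hmn _ C hC hd f hf hs P hP => ?_⟩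
  let I : SCP.Instance T := ⟨n, m, hmn, C, f, P, hP⟩
  have hspec := h I hC
  refine ⟨fun o ho => ⟨fun hcut => ?_, hspec.time o ho⟩, ?_, ?_⟩
  -- A cut-off run would show up in the law of the results, which consists of outputs and refusals
  -- only.
  · have h1 : o.1 ∈ ((A.runs P m C (SCP.fourierDegree f) (1 + SCP.maxSupp hmn C)
        (R.eval n)).map Prod.fst).support := by
      rw [PMF.mem_support_map_iff]
      exact ⟨o, ho, rfl⟩
    rw [hspec.dist, PMF.mem_support_map_iff] at h1
    obtain ⟨x, -, hx⟩ := h1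
    rw [hcut] at hx
    cases x <;> simp [SCP.resOf] at hx
  · refine lt_of_lt_of_le (SCP.success_prob q sparsity I (hq n (hm.trans_le hmn)) hf hs) ?_
    refine ENNReal.toReal_mono ?_ ?_
    · exact ne_top_of_le_ne_top ENNReal.one_ne_top (le_of_le_of_eq le_self_add
        (SCP.toOuterMeasure_add_compl _ _))
    · have e1 : SCP.goodRuns (SCP.acceptProb hmn C f) (1 / ((q.eval n : ℕ) : ℝ)) =
          Prod.fst ⁻¹' {x : SCP.Res | ∃ a b : ℕ, 0 < b ∧
            x = SCP.Res.out (.cons (SCP.encNat a) (SCP.encNat b)) ∧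
            |SCP.acceptProb hmn C f - (a : ℝ) / (b : ℝ)| ≤ 1 / ((q.eval n : ℕ) : ℝ)} := rfl
      rw [e1, ← PMF.toOuterMeasure_map_apply, hspec.dist, PMF.toOuterMeasure_map_apply]
      refine MeasureTheory.measure_mono ?_
      rintro _ ⟨a, b, hb, rfl, hab⟩
      exact ⟨a, b, hb, rfl, hab⟩
  · have := SCP.maxSupp_le hmn C hd
    omega
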